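/- Let $\ell>0$. Let $M=\mathbb{R}^2\times S^1\times S^1$, with $S^1=\mathbb{R}/2\pi\mathbb{Z}$ and coordinates $(x,y,\alpha,\beta)$, be the configuration space of a car of length $\ell$ (position $(x,y)$ of the rear wheels, direction $\alpha$ of the chassis, angle $\beta$ of the front wheels), and let $$\mathcal D_w=\mathrm{Span}(\partial_\beta),\qquad \mathcal D_g=\mathrm{Span}\big(-\sin\beta\,\partial_\alpha+\ell\cos\beta(\cos\alpha\,\partial_x+\sin\alpha\,\partial_y)\big).$$ A contact projective structure on a 3-manifold is a contact distribution $\mathcal C$ together with a family of unparametrized curves everywhere tangent to $\mathcal C$ such that through each point there is exactly one curve of the family tangent to each given direction in $\mathcal C$, and such that the curves of the family are among the unparametrized geodesics of some linear connection. An infinitesimal symmetry of it is a vector field $S$ with $\mathcal L_S\mathcal C\subset\mathcal C$ and with $(\mathcal L_S\nabla)(X,X)\in\mathrm{Span}(X)$ for all sections $X$ of $\mathcal C$, where $\nabla$ is a torsion free connection as above. **Theorem.** The distribution $\mathcal D=\mathcal D_w\oplus\mathcal D_g$ is an Engel distribution with a split (each summand has rank $1$, and the derived flag of $\mathcal D$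 has ranks $2,3,4$). The space $P$ of leaves of the steering wheel foliation, whose leaves are the integral curves of $\mathcal D_w$, is $\mathbb{R}^2\times S^1$ with coordinates $(x,y,\alpha)$; let $\pi:M\to P$ be the projection. Then: 1. The distribution $\mathcal C$ on $P$ that is spanned at each $p\in P$ by the lines $d\pi(\mathcal D_g|_m)$, $\pi(m)=p$, together with the family of the projections to $P$ of the integral curves of $\mathcal D_g$, is a contact projective structure on $P$. 2. $P$ is identified with the first jet space of the car's equation $y'''=\frac{3y'y''^2}{1+y'^2}$: by $(x,y,\alpha)\mapsto(x,y,p)=(x,y,\tan\alpha)$ each of the two parts $\{\cos\alpha>0\}$, $\{\cos\alpha<0\}$ of $P$ is diffeomorphic to the first jet space $J^1=\mathbb{R}^3$ with coordinates $(x,y,p)$; the distribution $\mathcal C$ becomes $\ker(dy-p\,dx)$; and a smooth function $y$ on an open interval is a solution of the equation if and only if its $1$-jet $x\mapsto(x,y(x),y'(x))$ lies on a curve of the family. 3. The Lie algebra of infinitesimal symmetries of this contact projective structure has dimension $10$ and is isomorphic to $\mathfrak{sp}(2,\mathbb{R})$ (the Lie algebra of the symplectic group of $\mathbb{R}^4$).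 The same holds, by restriction, for its Lie algebra of infinitesimal symmetries over any non-empty connected open subset of $P$. 4. Let $P_2\subset\mathbf{Sp}(2,\mathbb{R})$ be the stabilizer of a line in $\mathbb{R}^4$. The contact distribution $\mathcal C$ is co-orientable. For each co-orientation of $\mathcal C$ there is exactly one regular normal $\mathfrak{sp}(2,\mathbb{R})$-valued Cartan connection on $P$, modelled on $\mathbf{Sp}(2,\mathbb{R})/P_2$, that induces this contact projective structure with this co-orientation, and the curvature of this Cartan connection vanishes. Here a Cartan connection is a maximal atlas of Cartan gauges, i.e. of $\mathfrak{sp}(2,\mathbb{R})$-valued $1$-forms $\theta$ on open subsets of $P$ that induce isomorphisms of the tangent spaces with $\mathfrak{sp}(2,\mathbb{R})/\mathfrak{p}_2$ and are related on overlaps, locally, by $\theta'=h^{-1}\theta h+h^{-1}dh$ with smooth $P_2$-valued functions $h$; its curvature is $d\theta+\tfrac12[\theta,\theta]$; normality is the vanishing of the Kostant codifferential of the curvature; regularity means that the curvature maps $\Lambda^2\mathcal C$ into $\mathfrak g^{-1}$, the subspace of codimension one in the filtration $\mathfrak{sp}(2,\mathbb{R})\supset\mathfrak g^{-1}\supset\mathfrak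 p_2$ defined by the line. The connection induces the structure if $\mathcal C=\theta^{-1}(\mathfrak g^{-1})$, with the co-orientation given by $\theta$ modulo $\mathfrak g^{-1}$, and if every curve of the family develops into a projective line in the model $\mathbf{Sp}(2,\mathbb{R})/P_2=\mathbb{R}P^3$. -/

import Mathlib

open scoped ContDiff

noncomputable section

namespace CarGeometry

/-! ## Calculus on the configuration space and on the space of positions

An angle is an element of `Real.Angle = ℝ / 2πℤ`.  The manifolds below are products of lines and
circles; each of them carries the smooth structure for which the covering map `cov` from the
Euclidean space of its coordinates is a local diffeomorphism.  Its tangent bundle is trivialised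
by the coordinate vector fields, so a tangent vector is an element of the model space `E`, and a
vector field is a function with values in `E`. -/

/-- Coordinates `(x, y, α)`, or tangent vectors `a ∂_x + b ∂_y + c ∂_α`. -/
abbrev E3 : Type := ℝ × ℝ × ℝ

/-- Coordinates `(x, y, α, β)`, or tangent vectors `a ∂_x + b ∂_y + c ∂_α + d ∂_β`. -/
abbrev E4 : Type := ℝ × ℝ × ℝ × ℝ

/-- The configuration space `M = ℝ² × S¹ × S¹` of the car, with points `(x, y, α, β)`. -/
abbrev Config : Type := ℝ × ℝ × Real.Angle × Real.Angle

/-- The space `P = ℝ² × S¹` of positions `(x, y, α)` of the car, the orientation of the front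
wheels being disregarded. -/
abbrev Pos : Type := ℝ × ℝ × Real.Angle

/-- A space with a covering map from its coordinate space, and a choice of coordinates for each
of its points. -/
class Coords (N : Type) (E : outParam Type) where
  cov : E → N
  lift : N → E
  cov_lift : ∀ p, cov (lift p) = p

instance : Coords Pos E3 where
  cov c := (c.1, c.2.1, (c.2.2 : Real.Angle))
  lift p := (p.1, p.2.1, p.2.2.toReal)
  cov_lift p := by simp

instance : Coords Config E4 where
  cov c := (c.1, c.2.1, (c.2.2.1 : Real.Angle), (c.2.2.2 : Real.Angle))
  lift p := (p.1, p.2.1, p.2.2.1.toReal, p.2.2.2.toReal)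
  cov_lift p := by simp

section Calculus

variable {N E F : Type} [NormedAddCommGroup E] [NormedSpace ℝ E] [NormedAddCommGroup F]
  [NormedSpace ℝ F] [Coords N E]

/-- `f` is of class `C^∞` on the open set `U`. -/
def SmoothOn (U : Set N) (f : N → F) : Prop :=
  ContDiffOn ℝ ∞ (fun c : E => f (Coords.cov c)) (Coords.cov ⁻¹' U)

/-- The derivative of `f` at the point `p` in the direction of the tangent vector `u`. -/
def dirDeriv (f : N → F) (p : N) (u : E) : F :=
  fderiv ℝ (fun c : E => f (Coords.cov c)) (Coords.lift p) u

/-- The Lie bracket of vector fields. -/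
def bracket (V W : N → E) (p : N) : E :=
  VectorField.lieBracket ℝ (fun c => V (Coords.cov c)) (fun c => W (Coords.cov c)) (Coords.lift p)

/-- The leaf through `m` of a rank one distribution `D`: the points that can be joined to `m` by
a smooth curve which is everywhere tangent to `D`.  A curve in `N` is given by its coordinates. -/
def leaf (D : N → Submodule ℝ E) (m : N) : Set N :=
  {m' | ∃ c : ℝ → E, ContDiff ℝ ∞ c ∧ (∀ t, deriv c t ∈ D (Coords.cov (c t))) ∧
    Coords.cov (c 0) = m ∧ Coords.cov (c 1) = m'}

/-- A vector field is a (smooth, globally defined) section of the distribution `D`. -/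
def IsSection (D : N → Submodule ℝ E) (V : N → E) : Prop :=
  SmoothOn Set.univ V ∧ ∀ p, V p ∈ D p

/-- A distribution of subspaces is smooth if it is spanned by its smooth sections. -/
def IsSmoothDistribution (D : N → Submodule ℝ E) : Prop :=
  ∀ p, ∀ v ∈ D p, ∃ V, IsSection D V ∧ V p = v

/-- The distribution spanned by `D'` and by the brackets of sections of `D` with those of `D'`. -/
def bracketDistribution (D D' : N → Submodule ℝ E) (p : N) : Submodule ℝ E :=
  D' p ⊔ Submodule.span ℝ {v | ∃ V W, IsSection D V ∧ IsSection D' W ∧ v = bracket V W p}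

/-- `D₁ ⊕ D₂` is an Engel distribution, with a split into the rank one distributions `D₁`, `D₂`:
its derived flag has the constant ranks `2`, `3`, `4`. -/
def IsEngelWithSplit (D₁ D₂ : N → Submodule ℝ E) : Prop :=
  IsSmoothDistribution D₁ ∧ IsSmoothDistribution D₂ ∧
  ∀ p, Module.finrank ℝ (D₁ p) = 1 ∧ Module.finrank ℝ (D₂ p) = 1 ∧
    Module.finrank ℝ ↥(D₁ p ⊔ D₂ p) = 2 ∧
    Module.finrank ℝ (bracketDistribution (D₁ ⊔ D₂) (D₁ ⊔ D₂) p) = 3 ∧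
    Module.finrank ℝ
      (bracketDistribution (D₁ ⊔ D₂) (bracketDistribution (D₁ ⊔ D₂) (D₁ ⊔ D₂)) p) = 4

end Calculus

/-! ## The car -/

/-- The steering wheel vector field `X₃ = ∂_β`. -/
def steeringField (_ : Config) : E4 := (0, 0, 0, 1)

/-- The gas vector field `X₄ = - sin β ∂_α + ℓ cos β (cos α ∂_x + sin α ∂_y)` of a car of
length `ℓ`. -/
def gasField (ℓ : ℝ) (m : Config) : E4 :=
  (ℓ * m.2.2.2.cos * m.2.2.1.cos, ℓ * m.2.2.2.cos * m.2.2.1.sin, - m.2.2.2.sin, 0)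

/-- The steering wheel space `D_w`. -/
def steering (m : Config) : Submodule ℝ E4 := Submodule.span ℝ {steeringField m}

/-- The gas space `D_g`. -/
def gas (ℓ : ℝ) (m : Config) : Submodule ℝ E4 := Submodule.span ℝ {gasField ℓ m}

/-- The space of leaves of the steering wheel foliation, with the quotient topology. -/
def LeafSpace : Type := Quot fun m m' : Config => m' ∈ leaf steering m

instance : TopologicalSpace LeafSpace :=
  inferInstanceAs (TopologicalSpace (Quot fun m m' : Config => m' ∈ leaf steering m))

/-- The projection `(x, y, α, β) ↦ (x, y, α)`. -/
def proj (m : Config) : Pos := (m.1, m.2.1, m.2.2.1)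

/-- The differential of `proj`. -/
def dproj : E4 →ₗ[ℝ] E3 where
  toFun v := (v.1, v.2.1, v.2.2.1)
  map_add' _ _ := rfl
  map_smul' _ _ := rfl

/-- The distribution induced on `P`: at `p` it is spanned by the projections of the gas directions
at all the configurations over `p`. -/
def inducedDistribution (Dg : Config → Submodule ℝ E4) (p : Pos) : Submodule ℝ E3 :=
  ⨆ m ∈ proj ⁻¹' {p}, (Dg m).map dproj

/-- The family of curves induced on `P`: the projections of the leaves of the gas foliation. -/
def inducedCurves (Dg : Config → Submodule ℝ E4) : Set (Set Pos) :=
  {K | ∃ m, K = proj '' leaf Dg m}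

/-! ## Contact projective structures -/

/-- A linear map depending on the point, such as a differential `1`-form. -/
abbrev Form (F : Type) [AddCommGroup F] [Module ℝ F] : Type := Pos → E3 →ₗ[ℝ] F

/-- The real-valued form `lam` is smooth on `U`. -/
def SmoothForm (U : Set Pos) (lam : Form ℝ) : Prop := ∀ u, SmoothOn U fun p => lam p u

/-- The exterior derivative of a `1`-form. -/
def extD (lam : Form ℝ) (p : Pos) (u v : E3) : ℝ :=
  dirDeriv (fun q => lam q v) p u - dirDeriv (fun q => lam q u) p v

/-- `C` is a contact distribution: locally it is the kernel of a `1`-form `lam ≠ 0` such that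
`d lam` is nondegenerate on `C`. -/
def IsContact (C : Pos → Submodule ℝ E3) : Prop :=
  ∀ p, ∃ U : Set Pos, IsOpen U ∧ p ∈ U ∧ ∃ lam : Form ℝ, SmoothForm U lam ∧
    ∀ q ∈ U, lam q ≠ 0 ∧ LinearMap.ker (lam q) = C q ∧
      ∀ u ∈ C q, u ≠ 0 → ∃ v ∈ C q, extD lam q u v ≠ 0

/-- `c` gives the coordinates of a regular smooth parametrisation of the unparametrised curve
`K`. -/
def Parametrizes (c : ℝ → E3) (K : Set Pos) : Prop :=
  ContDiff ℝ ∞ c ∧ (∀ t, deriv c t ≠ 0) ∧ Set.range (fun t => (Coords.cov (c t) : Pos)) = K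

/-- The curve `K` passes through `p`, with a tangent vector in `L`. -/
def TangentAt (K : Set Pos) (p : Pos) (L : Submodule ℝ E3) : Prop :=
  ∃ c t, Parametrizes c K ∧ Coords.cov (c t) = p ∧ deriv c t ∈ L

/-- A torsion free linear connection on `P`, given by its Christoffel symbols with respect to the
coordinate vector fields. -/
structure Connection where
  Γ : Pos → E3 →ₗ[ℝ] E3 →ₗ[ℝ] E3
  smooth : ∀ u v, SmoothOn Set.univ fun p => Γ p u v
  symm : ∀ p u v, Γ p u v = Γ p v u

/-- The covariant derivative of the vector field `Y` along `X`. -/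
def Connection.cov (nabla : Connection) (X Y : Pos → E3) (p : Pos) : E3 :=
  dirDeriv Y p (X p) + nabla.Γ p (X p) (Y p)

/-- `K` is an unparametrised geodesic. -/
def Connection.IsGeodesic (nabla : Connection) (K : Set Pos) : Prop :=
  ∃ c, Parametrizes c K ∧ ∀ t,
    deriv (deriv c) t + nabla.Γ (Coords.cov (c t)) (deriv c t) (deriv c t) ∈
      Submodule.span ℝ {deriv c t}

/-- A contact distribution and a family of unparametrised curves form a contact projective
structure. -/
structure IsContactProjective (C : Pos → Submodule ℝ E3) (curves : Set (Set Pos)) : Prop where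
  contact : IsContact C
  /-- the curves are regular and everywhere tangent to `C` -/
  tangent : ∀ K ∈ curves, ∃ c, Parametrizes c K ∧ ∀ t, deriv c t ∈ C (Coords.cov (c t))
  /-- through each point, there is exactly one curve tangent to a given direction in `C` -/
  unique : ∀ p, ∀ L ≤ C p, Module.finrank ℝ L = 1 → ∃! K, K ∈ curves ∧ TangentAt K p L
  /-- the curves are among the unparametrised geodesics of a linear connection -/
  geodesic : ∃ nabla : Connection, ∀ K ∈ curves, nabla.IsGeodesic K

/-- The Lie derivative `(L_S ∇)(X, Y)` of a connection along the vector field `S`. -/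
def lieConnection (S : Pos → E3) (nabla : Connection) (X Y : Pos → E3) (p : Pos) : E3 :=
  bracket S (nabla.cov X Y) p - nabla.cov (bracket S X) Y p - nabla.cov X (bracket S Y) p

/-- The vector field `S` is an infinitesimal symmetry, over the open set `U`, of a contact
projective structure: it preserves the contact distribution, and it preserves the connections of
the structure up to terms that do not affect the unparametrised geodesics tangent to `C`. (It does
not matter which connection `∇` with the given geodesics is taken.) -/
def IsInfinitesimalSymmetry (C : Pos → Submodule ℝ E3) (curves : Set (Set Pos)) (U : Set Pos)
    (S : Pos → E3) : Prop :=
  SmoothOn U S ∧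
  (∀ X, SmoothOn U X → (∀ p ∈ U, X p ∈ C p) → ∀ p ∈ U, bracket S X p ∈ C p) ∧
  ∃ nabla : Connection, (∀ K ∈ curves, nabla.IsGeodesic K) ∧
    ∀ X, SmoothOn U X → (∀ p ∈ U, X p ∈ C p) →
      ∀ p ∈ U, lieConnection S nabla X X p ∈ Submodule.span ℝ {X p}

/-! ## Cartan connections with values in the symplectic Lie algebra

The homogeneous model is the space `Sp(2,ℝ)/P₂` of lines in the symplectic vector space `ℝ⁴`. -/

/-- Real `4 × 4` matrices, in the symplectic basis `e₁, e₂, f₁, f₂` of `ℝ⁴`. -/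
abbrev Mat : Type := Matrix (Fin 2 ⊕ Fin 2) (Fin 2 ⊕ Fin 2) ℝ

attribute [local instance 100] LieRing.ofAssociativeRing

/-- The Lie algebra `sp(2,ℝ)`. -/
abbrev sp4 : LieSubalgebra ℝ Mat := LieAlgebra.Symplectic.sp (Fin 2) ℝ

/-- The index of the basis vector `e₁`. -/
abbrev e₁ : Fin 2 ⊕ Fin 2 := Sum.inl 0
/-- The index of the basis vector `e₂`. -/
abbrev e₂ : Fin 2 ⊕ Fin 2 := Sum.inl 1
/-- The index of the basis vector `f₁`. -/
abbrev f₁ : Fin 2 ⊕ Fin 2 := Sum.inr 0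
/-- The index of the basis vector `f₂`. -/
abbrev f₂ : Fin 2 ⊕ Fin 2 := Sum.inr 1

/-- A matrix preserves the line spanned by `e₁`. -/
def PreservesLine (A : Mat) : Prop := ∀ i, i ≠ e₁ → A i e₁ = 0

/-- The parabolic subgroup `P₂ ⊂ Sp(2,ℝ)` that stabilises the line spanned by `e₁`.  Its Lie
algebra `𝔭` consists of the elements of `sp(2,ℝ)` that preserve this line. -/
def InParabolic (h : Mat) : Prop :=
  h ∈ Matrix.symplecticGroup (Fin 2) ℝ ∧ PreservesLine h

/-- A basis of `𝔤₋ = 𝔤₋₂ ⊕ 𝔤₋₁`, a complement of `𝔭` in `sp(2,ℝ)`. -/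
def negBasis : Fin 3 → Mat :=
  ![Matrix.single f₁ e₁ 1,
    Matrix.single e₂ e₁ 1 - Matrix.single f₁ f₂ 1,
    Matrix.single f₂ e₁ 1 + Matrix.single f₁ e₂ 1]

/-- The basis of the nilradical of `𝔭` dual to `negBasis` for the trace form, which is a multiple
of the Killing form. -/
def posBasis : Fin 3 → Mat :=
  ![(negBasis 0).transpose, (2⁻¹ : ℝ) • (negBasis 1).transpose,
    (2⁻¹ : ℝ) • (negBasis 2).transpose]

/-- The matrix-valued form `θ` is a Cartan gauge on the open set `U`: a smooth form with values in
`sp(2,ℝ)` that induces an isomorphism of each tangent space with `sp(2,ℝ)/𝔭`. -/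
structure IsCartanGauge (U : Set Pos) (θ : Form Mat) : Prop where
  isOpen : IsOpen U
  smooth : ∀ u i j, SmoothOn U fun p => θ p u i j
  mem : ∀ p ∈ U, ∀ u, θ p u ∈ sp4
  iso : ∀ p ∈ U, ∀ u, PreservesLine (θ p u) → u = 0

/-- Two Cartan gauges are compatible if on the intersection of their domains each is locally the
transform `h⁻¹ θ h + h⁻¹ dh` of the other by a smooth function `h` with values in `P₂`. -/
def Compatible (g g' : Set Pos × Form Mat) : Prop :=
  ∀ p ∈ g.1 ∩ g'.1, ∃ W : Set Pos, IsOpen W ∧ p ∈ W ∧ W ⊆ g.1 ∩ g'.1 ∧ ∃ h : Pos → Mat,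
    (∀ i j, SmoothOn W fun q => h q i j) ∧
    ∀ q ∈ W, InParabolic (h q) ∧ ∀ u, g'.2 q u =
      (h q)⁻¹ * g.2 q u * h q +
        (h q)⁻¹ * Matrix.of fun i j => dirDeriv (fun q => h q i j) q u

/-- A Cartan connection on `P` modelled on `Sp(2,ℝ)/P₂`, as a maximal atlas of compatible Cartan
gauges.  (The gauges are the pull-backs of the connection form by the local sections of the
principal bundle.) -/
@[ext]
structure CartanConnection where
  gauges : Set (Set Pos × Form Mat)
  isGauge : ∀ g ∈ gauges, IsCartanGauge g.1 g.2
  covers : ∀ p, ∃ g ∈ gauges, p ∈ g.1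
  compatible : ∀ g ∈ gauges, ∀ g' ∈ gauges, Compatible g g'
  maximal : ∀ g : Set Pos × Form Mat, IsCartanGauge g.1 g.2 →
    (∀ g' ∈ gauges, Compatible g g') → g ∈ gauges

/-- The curvature `dθ(u, v) + [θ(u), θ(v)]` of a Cartan gauge. -/
def curvature (θ : Form Mat) (p : Pos) (u v : E3) : Mat :=
  (Matrix.of fun i j =>
    dirDeriv (fun q => θ q v i j) p u - dirDeriv (fun q => θ q u i j) p v) + ⁅θ p u, θ p v⁆

/-- Normality: the Kostant codifferential
`(∂*κ)(X) = ∑ⱼ [Zⱼ, κ(X, Xⱼ)] - ½ ∑ᵢⱼ tr([Zᵢ, Zⱼ] X) κ(Xᵢ, Xⱼ)` of the curvature function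
`κ : Λ²(sp(2,ℝ)/𝔭) → sp(2,ℝ)` vanishes, where `(Xⱼ)` is a basis of `sp(2,ℝ)/𝔭`, and `(Zⱼ)` is the
dual basis of the nilradical of `𝔭`. -/
def IsNormal (U : Set Pos) (θ : Form Mat) : Prop :=
  ∀ p ∈ U, ∀ u : Fin 3 → E3, (∀ i, PreservesLine (θ p (u i) - negBasis i)) →
    ∀ k, ∑ j, ⁅posBasis j, curvature θ p (u k) (u j)⁆ -
      (2⁻¹ : ℝ) • ∑ i, ∑ j, Matrix.trace (⁅posBasis i, posBasis j⁆ * negBasis k) •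
        curvature θ p (u i) (u j) = 0

/-- The Cartan gauge `θ` on `U` induces the contact distribution `ker lam`, with the co-orientation
given by the contact form `lam`, and the given family of curves.

The filtration `sp(2,ℝ) ⊃ 𝔤⁻¹ ⊃ 𝔭` (where `𝔤⁻¹` is the kernel of the `(f₁, e₁)` entry) has to
induce the contact distribution; regularity means that the curvature maps its square into
`𝔤⁻¹`. The distinguished curves are those whose development into the space of lines in `ℝ⁴` lies
on a projective line: the plane spanned by `e₁` and its covariant derivative `θ(ċ) e₁` is parallel
along the curve for the covariant derivative `d/dt + θ(ċ)`. -/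
structure Induces (U : Set Pos) (θ : Form Mat) (lam : Form ℝ) (curves : Set (Set Pos)) :
    Prop where
  contact : ∀ p ∈ U, ∃ a : ℝ, 0 < a ∧ ∀ u, θ p u f₁ e₁ = a * lam p u
  regular : ∀ p ∈ U, ∀ u v, lam p u = 0 → lam p v = 0 → curvature θ p u v f₁ e₁ = 0
  curves : ∀ K ∈ curves, ∀ c, Parametrizes c K → ∀ t, Coords.cov (c t) ∈ U →
    ∃ a b : ℝ, ∀ i,
      deriv (fun s => θ (Coords.cov (c s)) (deriv c s) i e₁) t +
        (θ (Coords.cov (c t)) (deriv c t) * θ (Coords.cov (c t)) (deriv c t)) i e₁ =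
      a * (1 : Mat) i e₁ + b * θ (Coords.cov (c t)) (deriv c t) i e₁

/-- A regular normal Cartan connection that induces the given contact projective structure, with
the co-orientation of the contact distribution given by the contact form `lam`. -/
def IsNormalCartanConnection (lam : Form ℝ) (curves : Set (Set Pos)) (conn : CartanConnection) :
    Prop :=
  ∀ g ∈ conn.gauges, Induces g.1 g.2 lam curves ∧ IsNormal g.1 g.2

/-- The Cartan connection has vanishing curvature. -/
def CartanConnection.IsFlat (conn : CartanConnection) : Prop :=
  ∀ g ∈ conn.gauges, ∀ p ∈ g.1, ∀ u v, curvature g.2 p u v = 0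

/-! ## The first jet space -/

/-- The embedding of the first jet space `J¹ = ℝ³`, with coordinates `(x, y, p)`, in the space of
positions given by `p = tan α`; here `s = 0` gives the part `cos α > 0`, and `s = π` the part
`cos α < 0`. The coordinates in `P` of the point `(x, y, p)` are `(x, y, arctan p + s)`. -/
def jetCoords (s : ℝ) (j : ℝ × ℝ × ℝ) : E3 := (j.1, j.2.1, Real.arctan j.2.2 + s)

/-- See `jetCoords`. -/
def jet (s : ℝ) (j : ℝ × ℝ × ℝ) : Pos := Coords.cov (jetCoords s j)

/-- The inverse of `jet`. -/
def toJet (p : Pos) : ℝ × ℝ × ℝ := (p.1, p.2.1, p.2.2.tan)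

/-- On the interval `(a, b)` the function `y` solves the car's equation
`y''' = 3 y' (y'')² / (1 + (y')²)`. -/
def SolvesCarODE (a b : ℝ) (y : ℝ → ℝ) : Prop :=
  ∀ x ∈ Set.Ioo a b, iteratedDeriv 3 y x =
    3 * deriv y x * iteratedDeriv 2 y x ^ 2 / (1 + deriv y x ^ 2)

/-- `P` is identified with the first jet space of the car's equation: each of the two parts of
`{cos α ≠ 0}` is diffeomorphic to `J¹`, in such a way that `C` becomes the canonical contact
distribution `dy - p dx = 0`, and the curves of the family that are graphs over the `x`-axis become
the `1`-jets of the solutions of the equation. -/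
def IsFirstJetSpace (C : Pos → Submodule ℝ E3) (curves : Set (Set Pos)) : Prop :=
  ∀ s : ℝ, s = 0 ∨ s = Real.pi →
    ContDiff ℝ ∞ (jetCoords s) ∧ Set.range (jet s) = {p | 0 < (p.2.2 - (s : Real.Angle)).cos} ∧
    SmoothOn (Set.range (jet s)) toJet ∧ (∀ j, toJet (jet s j) = j) ∧
    (∀ j w, fderiv ℝ (jetCoords s) j w ∈ C (jet s j) ↔ w.2.1 - j.2.2 * w.1 = 0) ∧
    ∀ a b : ℝ, ∀ y : ℝ → ℝ, ContDiffOn ℝ ∞ y (Set.Ioo a b) →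
      (SolvesCarODE a b y ↔
        ∃ K ∈ curves, ∀ x ∈ Set.Ioo a b, jet s (x, y x, deriv y x) ∈ K)

end CarGeometry

end

open scoped ContDiff

noncomputable section

namespace CarGeometry

/-! ## Calculus on the space of positions -/

section PosCalculus

variable {F : Type} [NormedAddCommGroup F] [NormedSpace ℝ F]

/-! `Pos` is the group of oriented motions of the plane, and `along`, `turn`, `across` form a
left-invariant frame with brackets [along, turn] = -across, [turn, across] = -along, [along, across]
= 0. Over a position p the gas direction projects to ℓ cos β · along - sin β · turn, and β is
constant along the leaves of the gas foliation. The projected curves are therefore the orbits of the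
constant combinations a · along + b · turn, with every ratio [a : b] occurring: oriented circles and
lines in the plane, and the fibres over points. They are tangent to the contact distribution ker
`coAcross`, whose derived bracket is `across`. Among graphs they are characterised by constant
curvature y''/(1+y'²)^{3/2}, and differentiating this once is the car's equation.

Everything about symmetries and Cartan connections rests on one homomorphism from the Lie algebra of
the Euclidean group to sp(2,ℝ), given by `alongMat`, `turnMat`, `acrossMat`. It is complementary to
𝔭 and sends the contact distribution into 𝔤⁻¹, so `flatForm` is a Cartan gauge; the homomorphism
property is the Maurer-Cartan equation, hence `curvature_flatForm`. The curves of the car develop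
into projective lines in it (`acceleration_flatForm`), so the structure is locally that of RP³ with
its contact lines.

Symmetries: the developing map G of the flat gauge turns A ∈ sp(2,ℝ) into the parallel section G⁻¹AG
of the adjoint bundle (`parallel`), and its value modulo 𝔭 is a vector field (`symmetryField`).
Conversely, a symmetry is a contact field, determined by its potential f = coAcross(S). Preserving
the geodesics is a cubic condition on contact directions, whose four coefficients are four third
order equations for f (`IsPotential`). The system is of finite type: ten derivatives of f determine
all others, and arranged in a matrix (`prolong`) they form a section that is parallel along the
contact distribution, hence parallel. On a connected open set such a section is `parallel A` for
some A.

Uniqueness of the normal connection: the flat gauge, for the sign ε of the co-orientation, is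
transformed by a P₂-valued function so that it agrees with a given regular gauge modulo 𝔭 and in one
further component, which uses up the gauge freedom (`IsCartanGauge.exists_isTransform`). The
difference of the two gauges is then 𝔭-valued and is shown to vanish one homogeneity at a time, from
1 to 4 (`IsDeformation.eq`). Each stage is a linear system given by normality; in homogeneity 1 the
condition on the curves is needed as well. Every normal gauge is thus a transform of the flat one.
-/

theorem continuous_cov : Continuous (Coords.cov : E3 → Pos) := by
  have h : Continuous ((↑) : ℝ → Real.Angle) := Real.Angle.continuous_coe
  exact continuous_fst.prodMk ((continuous_fst.comp continuous_snd).prodMk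
    (h.comp (continuous_snd.comp continuous_snd)))

theorem isOpen_preimage_cov {U : Set Pos} (hU : IsOpen U) :
    IsOpen ((Coords.cov : E3 → Pos) ⁻¹' U) := hU.preimage continuous_cov

theorem cov_fst (c : E3) : (Coords.cov c : Pos).1 = c.1 := rfl
theorem cov_snd (c : E3) : (Coords.cov c : Pos).2.1 = c.2.1 := rfl
theorem cov_angle (c : E3) : (Coords.cov c : Pos).2.2 = (c.2.2 : Real.Angle) := rfl

theorem cov_eq_cov {c c' : E3} (h : (Coords.cov c : Pos) = Coords.cov c') :
    ∃ k : ℤ, c = c' + (0, 0, 2 * Real.pi * k) := by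
  obtain ⟨x, y, a⟩ := c
  obtain ⟨x', y', a'⟩ := c'
  simp only [Coords.cov, Prod.mk.injEq] at h
  obtain ⟨k, hk⟩ := Real.Angle.angle_eq_iff_two_pi_dvd_sub.1 h.2.2
  refine ⟨k, ?_⟩
  simp only [Prod.mk_add_mk, add_zero, Prod.mk.injEq]
  exact ⟨h.1, h.2.1, by linarith⟩

theorem cov_add_period (c : E3) (k : ℤ) :
    (Coords.cov (c + (0, 0, 2 * Real.pi * k)) : Pos) = Coords.cov c := by
  simp only [Coords.cov, Prod.fst_add, Prod.snd_add, add_zero, Prod.mk.injEq, true_and]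
  exact Real.Angle.angle_eq_iff_two_pi_dvd_sub.2 ⟨k, by ring⟩

/-- Two coordinate triples of the same point differ by a translation in the angle, and
differentiation commutes with translations. Hence the discontinuous choice `Coords.lift` made in
`dirDeriv` is immaterial. -/
theorem fderiv_cov_congr (f : Pos → F) {c c' : E3}
    (h : (Coords.cov c : Pos) = Coords.cov c') :
    fderiv ℝ (fun c : E3 => f (Coords.cov c)) c = fderiv ℝ (fun c : E3 => f (Coords.cov c)) c' := by
  obtain ⟨k, rfl⟩ := cov_eq_cov h
  rw [← fderiv_comp_add_right]
  simp only [cov_add_period]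

theorem dirDeriv_cov (f : Pos → F) (c u : E3) :
    dirDeriv f (Coords.cov c) u = fderiv ℝ (fun c : E3 => f (Coords.cov c)) c u := by
  rw [dirDeriv, fderiv_cov_congr f (Coords.cov_lift (Coords.cov c : Pos))]

/-- `f` is differentiable at `p`. -/
def DiffAt (f : Pos → F) (p : Pos) : Prop :=
  DifferentiableAt ℝ (fun c : E3 => f (Coords.cov c)) (Coords.lift p)

theorem SmoothOn.mono {U W : Set Pos} {f : Pos → F} (hf : SmoothOn U f) (h : W ⊆ U) :
    SmoothOn W f := ContDiffOn.mono hf (Set.preimage_mono h)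

theorem SmoothOn.congr {U : Set Pos} {f g : Pos → F} (hf : SmoothOn U f)
    (h : ∀ p ∈ U, g p = f p) : SmoothOn U g :=
  ContDiffOn.congr hf fun _ hc => h _ hc

theorem smoothOn_const (U : Set Pos) (a : F) : SmoothOn U (fun _ => a) := contDiffOn_const

theorem SmoothOn.contDiffAt {U : Set Pos} (hU : IsOpen U) {f : Pos → F} (hf : SmoothOn U f)
    {c : E3} (hc : (Coords.cov c : Pos) ∈ U) :
    ContDiffAt ℝ ∞ (fun c : E3 => f (Coords.cov c)) c :=
  ContDiffOn.contDiffAt hf ((isOpen_preimage_cov hU).mem_nhds hc)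

theorem lift_mem {U : Set Pos} {p : Pos} (hp : p ∈ U) :
    (Coords.cov (Coords.lift p : E3) : Pos) ∈ U := by rwa [Coords.cov_lift]

theorem SmoothOn.diffAt {U : Set Pos} (hU : IsOpen U) {f : Pos → F} (hf : SmoothOn U f)
    {p : Pos} (hp : p ∈ U) : DiffAt f p :=
  (hf.contDiffAt hU (lift_mem hp)).differentiableAt (by simp)

theorem SmoothOn.add {U : Set Pos} {f g : Pos → F} (hf : SmoothOn U f) (hg : SmoothOn U g) :
    SmoothOn U (fun p => f p + g p) := ContDiffOn.add hf hg

theorem SmoothOn.sub {U : Set Pos} {f g : Pos → F} (hf : SmoothOn U f) (hg : SmoothOn U g) :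
    SmoothOn U (fun p => f p - g p) := ContDiffOn.sub hf hg

theorem SmoothOn.neg {U : Set Pos} {f : Pos → F} (hf : SmoothOn U f) :
    SmoothOn U (fun p => - f p) := ContDiffOn.neg hf

theorem SmoothOn.smul {U : Set Pos} {a : Pos → ℝ} {f : Pos → F} (ha : SmoothOn U a)
    (hf : SmoothOn U f) : SmoothOn U (fun p => a p • f p) := ContDiffOn.smul ha hf

theorem SmoothOn.mul {U : Set Pos} {f g : Pos → ℝ} (hf : SmoothOn U f) (hg : SmoothOn U g) :
    SmoothOn U (fun p => f p * g p) := ContDiffOn.mul hf hg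

theorem SmoothOn.div {U : Set Pos} {f g : Pos → ℝ} (hf : SmoothOn U f) (hg : SmoothOn U g)
    (h : ∀ p ∈ U, g p ≠ 0) : SmoothOn U (fun p => f p / g p) :=
  ContDiffOn.div hf hg fun _ hc => h _ hc

theorem SmoothOn.sqrt {U : Set Pos} {f : Pos → ℝ} (hf : SmoothOn U f) (h : ∀ p ∈ U, f p ≠ 0) :
    SmoothOn U (fun p => √(f p)) := ContDiffOn.sqrt hf fun _ hc => h _ hc

theorem SmoothOn.sum {ι : Type} {U : Set Pos} {s : Finset ι} {f : ι → Pos → F}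
    (hf : ∀ i ∈ s, SmoothOn U (f i)) : SmoothOn U (fun p => ∑ i ∈ s, f i p) :=
  ContDiffOn.sum hf

theorem SmoothOn.comp_clm {G : Type} [NormedAddCommGroup G] [NormedSpace ℝ G] {U : Set Pos}
    {f : Pos → F} (hf : SmoothOn U f) (L : F →L[ℝ] G) : SmoothOn U (fun p => L (f p)) :=
  L.contDiff.comp_contDiffOn hf

theorem smoothOn_prodMk {G : Type} [NormedAddCommGroup G] [NormedSpace ℝ G] {U : Set Pos}
    {f : Pos → F} {g : Pos → G} (hf : SmoothOn U f) (hg : SmoothOn U g) :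
    SmoothOn U (fun p => (f p, g p)) := ContDiffOn.prodMk hf hg

theorem smoothOn_cos (U : Set Pos) : SmoothOn U (fun p => p.2.2.cos) := by
  have : ContDiff ℝ ∞ (fun c : E3 => Real.cos c.2.2) := by fun_prop
  exact this.contDiffOn

theorem smoothOn_sin (U : Set Pos) : SmoothOn U (fun p => p.2.2.sin) := by
  have : ContDiff ℝ ∞ (fun c : E3 => Real.sin c.2.2) := by fun_prop
  exact this.contDiffOn

theorem SmoothOn.dirDeriv {U : Set Pos} (hU : IsOpen U) {f : Pos → F} {V : Pos → E3}
    (hf : SmoothOn U f) (hV : SmoothOn U V) : SmoothOn U (fun p => dirDeriv f p (V p)) := by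
  have h : ContDiffOn ℝ ∞ (fun c : E3 =>
      fderiv ℝ (fun c : E3 => f (Coords.cov c)) c (V (Coords.cov c))) (Coords.cov ⁻¹' U) :=
    (ContDiffOn.fderiv_of_isOpen hf (isOpen_preimage_cov hU) (by simp)).clm_apply hV
  exact h.congr fun c _ => dirDeriv_cov f c _

theorem dirDeriv_congr {U : Set Pos} (hU : IsOpen U) {f g : Pos → F} (h : ∀ p ∈ U, f p = g p)
    {p : Pos} (hp : p ∈ U) (u : E3) : dirDeriv f p u = dirDeriv g p u := by
  have : (fun c : E3 => f (Coords.cov c)) =ᶠ[nhds (Coords.lift p)]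
      fun c : E3 => g (Coords.cov c) := by
    filter_upwards [(isOpen_preimage_cov hU).mem_nhds (lift_mem hp)] with c hc using h _ hc
  rw [CarGeometry.dirDeriv, CarGeometry.dirDeriv, this.fderiv_eq]

theorem dirDeriv_add_apply (f : Pos → F) (p : Pos) (u v : E3) :
    dirDeriv f p (u + v) = dirDeriv f p u + dirDeriv f p v := map_add _ _ _

theorem dirDeriv_smul_apply (f : Pos → F) (p : Pos) (a : ℝ) (u : E3) :
    dirDeriv f p (a • u) = a • dirDeriv f p u := map_smul _ _ _

theorem dirDeriv_const (a : F) (p : Pos) (u : E3) : dirDeriv (fun _ : Pos => a) p u = 0 := by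
  simp [CarGeometry.dirDeriv]

theorem dirDeriv_add {f g : Pos → F} {p : Pos} (hf : DiffAt f p) (hg : DiffAt g p) (u : E3) :
    dirDeriv (fun p => f p + g p) p u = dirDeriv f p u + dirDeriv g p u := by
  simp only [CarGeometry.dirDeriv]; rw [fderiv_fun_add hf hg]; rfl

theorem dirDeriv_sub {f g : Pos → F} {p : Pos} (hf : DiffAt f p) (hg : DiffAt g p) (u : E3) :
    dirDeriv (fun p => f p - g p) p u = dirDeriv f p u - dirDeriv g p u := by
  simp only [CarGeometry.dirDeriv]; rw [fderiv_fun_sub hf hg]; rfl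

theorem dirDeriv_neg (f : Pos → F) (p : Pos) (u : E3) :
    dirDeriv (fun p => - f p) p u = - dirDeriv f p u := by
  simp only [CarGeometry.dirDeriv]; rw [fderiv_fun_neg]; rfl

theorem dirDeriv_mul {f g : Pos → ℝ} {p : Pos} (hf : DiffAt f p) (hg : DiffAt g p) (u : E3) :
    dirDeriv (fun p => f p * g p) p u = f p * dirDeriv g p u + g p * dirDeriv f p u := by
  simp only [CarGeometry.dirDeriv]; rw [fderiv_fun_mul hf hg]; simp [Coords.cov_lift]

theorem dirDeriv_sum {ι : Type} {s : Finset ι} {f : ι → Pos → F} {p : Pos}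
    (hf : ∀ i ∈ s, DiffAt (f i) p) (u : E3) :
    dirDeriv (fun p => ∑ i ∈ s, f i p) p u = ∑ i ∈ s, dirDeriv (f i) p u := by
  simp only [CarGeometry.dirDeriv]; rw [fderiv_fun_sum hf]; simp

theorem dirDeriv_clm {G : Type} [NormedAddCommGroup G] [NormedSpace ℝ G] {f : Pos → F} {p : Pos}
    (hf : DiffAt f p) (L : F →L[ℝ] G) (u : E3) :
    dirDeriv (fun p => L (f p)) p u = L (dirDeriv f p u) := by
  have := (L.hasFDerivAt.comp (Coords.lift p) hf.hasFDerivAt).fderiv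
  simp only [CarGeometry.dirDeriv]
  exact congrArg (fun T => T u) this

theorem dirDeriv_cos (p : Pos) (u : E3) :
    dirDeriv (fun q : Pos => q.2.2.cos) p u = - p.2.2.sin * u.2.2 := by
  have h : HasFDerivAt (fun c : E3 => Real.cos c.2.2) (-Real.sin (Coords.lift p : E3).2.2 •
      ((ContinuousLinearMap.snd ℝ ℝ ℝ).comp (ContinuousLinearMap.snd ℝ ℝ (ℝ × ℝ))))
      (Coords.lift p) :=
    HasFDerivAt.cos ((ContinuousLinearMap.snd ℝ ℝ ℝ).comp
      (ContinuousLinearMap.snd ℝ ℝ (ℝ × ℝ))).hasFDerivAt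
  have h2 := h.fderiv
  simp only [CarGeometry.dirDeriv]
  refine (congrArg (fun T => T u) h2).trans ?_
  simp [Coords.lift]

theorem dirDeriv_sin (p : Pos) (u : E3) :
    dirDeriv (fun q : Pos => q.2.2.sin) p u = p.2.2.cos * u.2.2 := by
  have h : HasFDerivAt (fun c : E3 => Real.sin c.2.2) (Real.cos (Coords.lift p : E3).2.2 •
      ((ContinuousLinearMap.snd ℝ ℝ ℝ).comp (ContinuousLinearMap.snd ℝ ℝ (ℝ × ℝ))))
      (Coords.lift p) :=
    HasFDerivAt.sin ((ContinuousLinearMap.snd ℝ ℝ ℝ).comp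
      (ContinuousLinearMap.snd ℝ ℝ (ℝ × ℝ))).hasFDerivAt
  have h2 := h.fderiv
  simp only [CarGeometry.dirDeriv]
  refine (congrArg (fun T => T u) h2).trans ?_
  simp [Coords.lift]

theorem bracket_eq (V W : Pos → E3) (p : Pos) :
    bracket V W p = dirDeriv W p (V p) - dirDeriv V p (W p) := by
  simp only [bracket, VectorField.lieBracket, CarGeometry.dirDeriv, Coords.cov_lift]

/-- Symmetry of the second derivative in the covering space. All commutation relations between
derivatives come from here. -/
theorem dirDeriv_bracket {U : Set Pos} (hU : IsOpen U) {f : Pos → F} {V W : Pos → E3}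
    (hf : SmoothOn U f) (hV : SmoothOn U V) (hW : SmoothOn U W) {p : Pos} (hp : p ∈ U) :
    dirDeriv f p (bracket V W p) = dirDeriv (fun q => dirDeriv f q (W q)) p (V p) -
      dirDeriv (fun q => dirDeriv f q (V q)) p (W p) := by
  have h := VectorField.fderiv_apply_lieBracket (𝕜 := ℝ)
    (hf.contDiffAt hU (lift_mem hp))
    (by rw [minSmoothness_of_isRCLikeNormedField]; exact WithTop.coe_le_coe.2 (le_top : (2 : ℕ∞) ≤ ⊤))
    (hW.diffAt hU hp) (hV.diffAt hU hp)
  simp only [Coords.cov_lift] at h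
  simp only [bracket]
  rw [CarGeometry.dirDeriv, h]
  simp only [CarGeometry.dirDeriv, fderiv_cov_congr f (Coords.cov_lift (Coords.cov _ : Pos))]

end PosCalculus

/-! ## The Euclidean frame on the space of positions -/

/-- The unit vector in the direction of the chassis. -/
def along (p : Pos) : E3 := (p.2.2.cos, p.2.2.sin, 0)
/-- The vector field `∂_α`. -/
def turn (_ : Pos) : E3 := (0, 0, 1)
/-- The unit vector orthogonal to the chassis. -/
def across (p : Pos) : E3 := (-p.2.2.sin, p.2.2.cos, 0)

/-- The form dual to `along`. -/
def coAlong : Form ℝ := fun p =>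
  { toFun := fun u => p.2.2.cos * u.1 + p.2.2.sin * u.2.1
    map_add' := fun u v => by simp only [Prod.fst_add, Prod.snd_add]; ring
    map_smul' := fun a u => by
      simp only [Prod.smul_fst, Prod.smul_snd, smul_eq_mul, RingHom.id_apply]; ring }

/-- The form dual to `turn`. -/
def coTurn : Form ℝ := fun _ =>
  { toFun := fun u => u.2.2
    map_add' := fun _ _ => rfl
    map_smul' := fun _ _ => rfl }

/-- The form dual to `across`, a contact form. -/
def coAcross : Form ℝ := fun p =>
  { toFun := fun u => -p.2.2.sin * u.1 + p.2.2.cos * u.2.1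
    map_add' := fun u v => by simp only [Prod.fst_add, Prod.snd_add]; ring
    map_smul' := fun a u => by
      simp only [Prod.smul_fst, Prod.smul_snd, smul_eq_mul, RingHom.id_apply]; ring }

theorem coAlong_apply (p : Pos) (u : E3) :
    coAlong p u = p.2.2.cos * u.1 + p.2.2.sin * u.2.1 := rfl
theorem coTurn_apply (p : Pos) (u : E3) : coTurn p u = u.2.2 := rfl
theorem coAcross_apply (p : Pos) (u : E3) :
    coAcross p u = -p.2.2.sin * u.1 + p.2.2.cos * u.2.1 := rfl

theorem cos_sq_add_sin_sq' (a : Real.Angle) : a.cos * a.cos + a.sin * a.sin = 1 := by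
  have := Real.Angle.cos_sq_add_sin_sq a; nlinarith

@[simp] theorem coAlong_along (p : Pos) : coAlong p (along p) = 1 := by
  simp [coAlong_apply, along, cos_sq_add_sin_sq']
@[simp] theorem coAlong_turn (p : Pos) : coAlong p (turn p) = 0 := by simp [coAlong_apply, turn]
@[simp] theorem coAlong_across (p : Pos) : coAlong p (across p) = 0 := by
  simp only [coAlong_apply, across]; ring
@[simp] theorem coTurn_along (p : Pos) : coTurn p (along p) = 0 := rfl
@[simp] theorem coTurn_turn (p : Pos) : coTurn p (turn p) = 1 := rfl
@[simp] theorem coTurn_across (p : Pos) : coTurn p (across p) = 0 := rfl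
@[simp] theorem coAcross_along (p : Pos) : coAcross p (along p) = 0 := by
  simp only [coAcross_apply, along]; ring
@[simp] theorem coAcross_turn (p : Pos) : coAcross p (turn p) = 0 := by
  simp [coAcross_apply, turn]
@[simp] theorem coAcross_across (p : Pos) : coAcross p (across p) = 1 := by
  have := cos_sq_add_sin_sq' p.2.2
  simp only [coAcross_apply, across]; linarith

theorem frame_decomp (p : Pos) (u : E3) :
    u = coAlong p u • along p + coTurn p u • turn p + coAcross p u • across p := by
  have := cos_sq_add_sin_sq' p.2.2
  obtain ⟨x, y, a⟩ := u
  simp only [coAlong_apply, coTurn_apply, coAcross_apply, along, turn, across, Prod.smul_mk,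
    Prod.mk_add_mk, smul_eq_mul, Prod.mk.injEq]
  refine ⟨?_, ?_, by ring⟩
  · linear_combination (-x) * this
  · linear_combination (-y) * this

theorem frame_ext {p : Pos} {u v : E3} (h₁ : coAlong p u = coAlong p v)
    (h₂ : coTurn p u = coTurn p v) (h₃ : coAcross p u = coAcross p v) : u = v := by
  rw [frame_decomp p u, frame_decomp p v, h₁, h₂, h₃]

theorem smoothOn_along (U : Set Pos) : SmoothOn U along :=
  smoothOn_prodMk (smoothOn_cos U) (smoothOn_prodMk (smoothOn_sin U) (smoothOn_const U 0))
theorem smoothOn_turn (U : Set Pos) : SmoothOn U turn := smoothOn_const U _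
theorem smoothOn_across (U : Set Pos) : SmoothOn U across :=
  smoothOn_prodMk (smoothOn_sin U).neg (smoothOn_prodMk (smoothOn_cos U) (smoothOn_const U 0))

/-! ### Components of derivatives and brackets in the rotating frame -/

section Components

variable {U : Set Pos} {V : Pos → E3}

theorem SmoothOn.fst (hV : SmoothOn U V) : SmoothOn U fun p => (V p).1 :=
  hV.comp_clm (ContinuousLinearMap.fst ℝ ℝ (ℝ × ℝ))
theorem SmoothOn.snd (hV : SmoothOn U V) : SmoothOn U fun p => (V p).2.1 :=
  hV.comp_clm ((ContinuousLinearMap.fst ℝ ℝ ℝ).comp (ContinuousLinearMap.snd ℝ ℝ (ℝ × ℝ)))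
theorem SmoothOn.thd (hV : SmoothOn U V) : SmoothOn U fun p => (V p).2.2 :=
  hV.comp_clm ((ContinuousLinearMap.snd ℝ ℝ ℝ).comp (ContinuousLinearMap.snd ℝ ℝ (ℝ × ℝ)))

theorem SmoothOn.coAlong (hV : SmoothOn U V) : SmoothOn U fun p => coAlong p (V p) :=
  ((smoothOn_cos U).mul hV.fst).add ((smoothOn_sin U).mul hV.snd)
theorem SmoothOn.coTurn (hV : SmoothOn U V) : SmoothOn U fun p => coTurn p (V p) := hV.thd
theorem SmoothOn.coAcross (hV : SmoothOn U V) : SmoothOn U fun p => coAcross p (V p) :=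
  ((smoothOn_sin U).neg.mul hV.fst).add ((smoothOn_cos U).mul hV.snd)

theorem diffAt_cos (p : Pos) : DiffAt (fun q : Pos => q.2.2.cos) p :=
  (smoothOn_cos Set.univ).diffAt isOpen_univ trivial
theorem diffAt_sin (p : Pos) : DiffAt (fun q : Pos => q.2.2.sin) p :=
  (smoothOn_sin Set.univ).diffAt isOpen_univ trivial

theorem DiffAt.clm {F G : Type} [NormedAddCommGroup F] [NormedSpace ℝ F] [NormedAddCommGroup G]
    [NormedSpace ℝ G] {f : Pos → F} {p : Pos} (hf : DiffAt f p) (L : F →L[ℝ] G) :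
    DiffAt (fun q => L (f q)) p :=
  L.differentiableAt.comp _ hf

theorem DiffAt.mul {f g : Pos → ℝ} {p : Pos} (hf : DiffAt f p) (hg : DiffAt g p) :
    DiffAt (fun q => f q * g q) p := DifferentiableAt.mul hf hg

theorem DiffAt.add {f g : Pos → ℝ} {p : Pos} (hf : DiffAt f p) (hg : DiffAt g p) :
    DiffAt (fun q => f q + g q) p := DifferentiableAt.add hf hg

theorem DiffAt.sub {f g : Pos → ℝ} {p : Pos} (hf : DiffAt f p) (hg : DiffAt g p) :
    DiffAt (fun q => f q - g q) p := DifferentiableAt.sub hf hg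

theorem DiffAt.neg {f : Pos → ℝ} {p : Pos} (hf : DiffAt f p) :
    DiffAt (fun q => - f q) p := DifferentiableAt.neg hf

theorem DiffAt.fst {p : Pos} (hV : DiffAt V p) : DiffAt (fun q => (V q).1) p :=
  hV.clm (ContinuousLinearMap.fst ℝ ℝ (ℝ × ℝ))
theorem DiffAt.snd {p : Pos} (hV : DiffAt V p) : DiffAt (fun q => (V q).2.1) p :=
  hV.clm ((ContinuousLinearMap.fst ℝ ℝ ℝ).comp (ContinuousLinearMap.snd ℝ ℝ (ℝ × ℝ)))

theorem dirDeriv_fst {p : Pos} (hV : DiffAt V p) (u : E3) :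
    dirDeriv (fun q => (V q).1) p u = (dirDeriv V p u).1 :=
  dirDeriv_clm hV (ContinuousLinearMap.fst ℝ ℝ (ℝ × ℝ)) u
theorem dirDeriv_snd {p : Pos} (hV : DiffAt V p) (u : E3) :
    dirDeriv (fun q => (V q).2.1) p u = (dirDeriv V p u).2.1 :=
  dirDeriv_clm hV
    ((ContinuousLinearMap.fst ℝ ℝ ℝ).comp (ContinuousLinearMap.snd ℝ ℝ (ℝ × ℝ))) u

/-- The coefficients of `coAlong` depend on α, and their α-derivatives are the coefficients of
`coAcross`; the correction term is this rotation of the coframe. -/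
theorem coAlong_dirDeriv {p : Pos} (hV : DiffAt V p) (u : E3) :
    coAlong p (dirDeriv V p u) =
      dirDeriv (fun q => coAlong q (V q)) p u - coTurn p u * coAcross p (V p) := by
  simp only [coAlong_apply]
  rw [dirDeriv_add ((diffAt_cos p).mul hV.fst) ((diffAt_sin p).mul hV.snd),
    dirDeriv_mul (diffAt_cos p) hV.fst, dirDeriv_mul (diffAt_sin p) hV.snd, dirDeriv_fst hV,
    dirDeriv_snd hV, dirDeriv_cos, dirDeriv_sin, coTurn_apply, coAcross_apply]
  ring

theorem coTurn_dirDeriv {p : Pos} (hV : DiffAt V p) (u : E3) :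
    coTurn p (dirDeriv V p u) = dirDeriv (fun q => coTurn q (V q)) p u :=
  (dirDeriv_clm hV
    ((ContinuousLinearMap.snd ℝ ℝ ℝ).comp (ContinuousLinearMap.snd ℝ ℝ (ℝ × ℝ))) u).symm

theorem coAcross_dirDeriv {p : Pos} (hV : DiffAt V p) (u : E3) :
    coAcross p (dirDeriv V p u) =
      dirDeriv (fun q => coAcross q (V q)) p u + coTurn p u * coAlong p (V p) := by
  simp only [coAcross_apply]
  rw [dirDeriv_add ((diffAt_sin p).neg.mul hV.fst) ((diffAt_cos p).mul hV.snd),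
    dirDeriv_mul (diffAt_sin p).neg hV.fst, dirDeriv_mul (diffAt_cos p) hV.snd, dirDeriv_fst hV,
    dirDeriv_snd hV, dirDeriv_neg, dirDeriv_cos, dirDeriv_sin, coTurn_apply, coAlong_apply]
  ring

variable {W : Pos → E3} {p : Pos}

theorem coAlong_bracket (hV : DiffAt V p) (hW : DiffAt W p) :
    coAlong p (bracket V W p) =
      dirDeriv (fun q => coAlong q (W q)) p (V p) - dirDeriv (fun q => coAlong q (V q)) p (W p)
        - coTurn p (V p) * coAcross p (W p) + coTurn p (W p) * coAcross p (V p) := by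
  rw [bracket_eq, map_sub, coAlong_dirDeriv hV, coAlong_dirDeriv hW]; ring

theorem coTurn_bracket (hV : DiffAt V p) (hW : DiffAt W p) :
    coTurn p (bracket V W p) =
      dirDeriv (fun q => coTurn q (W q)) p (V p) - dirDeriv (fun q => coTurn q (V q)) p (W p) := by
  rw [bracket_eq, map_sub, coTurn_dirDeriv hV, coTurn_dirDeriv hW]

theorem coAcross_bracket (hV : DiffAt V p) (hW : DiffAt W p) :
    coAcross p (bracket V W p) =
      dirDeriv (fun q => coAcross q (W q)) p (V p) - dirDeriv (fun q => coAcross q (V q)) p (W p)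
        + coTurn p (V p) * coAlong p (W p) - coTurn p (W p) * coAlong p (V p) := by
  rw [bracket_eq, map_sub, coAcross_dirDeriv hV, coAcross_dirDeriv hW]; ring

end Components

/-! ### Derivatives along the frame -/

section FrameDerivatives

variable {F : Type} [NormedAddCommGroup F] [NormedSpace ℝ F]

/-- The derivative along `along`. -/
def dAlong (f : Pos → F) (p : Pos) : F := dirDeriv f p (along p)
/-- The derivative along `turn`. -/
def dTurn (f : Pos → F) (p : Pos) : F := dirDeriv f p (turn p)
/-- The derivative along `across`. -/
def dAcross (f : Pos → F) (p : Pos) : F := dirDeriv f p (across p)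

theorem dirDeriv_frame (f : Pos → ℝ) (p : Pos) (u : E3) :
    dirDeriv f p u =
      coAlong p u * dAlong f p + coTurn p u * dTurn f p + coAcross p u * dAcross f p := by
  conv_lhs => rw [frame_decomp p u]
  simp only [dirDeriv_add_apply, dirDeriv_smul_apply, smul_eq_mul]
  rfl

variable {U : Set Pos} {f : Pos → F}

theorem SmoothOn.dAlong (hU : IsOpen U) (hf : SmoothOn U f) : SmoothOn U (dAlong f) :=
  hf.dirDeriv hU (smoothOn_along U)
theorem SmoothOn.dTurn (hU : IsOpen U) (hf : SmoothOn U f) : SmoothOn U (dTurn f) :=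
  hf.dirDeriv hU (smoothOn_turn U)
theorem SmoothOn.dAcross (hU : IsOpen U) (hf : SmoothOn U f) : SmoothOn U (dAcross f) :=
  hf.dirDeriv hU (smoothOn_across U)

theorem diffAt_frame (p : Pos) : DiffAt along p ∧ DiffAt turn p ∧ DiffAt across p :=
  ⟨(smoothOn_along _).diffAt isOpen_univ trivial, (smoothOn_turn _).diffAt isOpen_univ trivial,
    (smoothOn_across _).diffAt isOpen_univ trivial⟩

/-- Together with the next two brackets, these are the structure equations of the Lie algebra of the
Euclidean group. -/
theorem bracket_along_turn (p : Pos) : bracket along turn p = - across p := by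
  obtain ⟨h₁, h₂, -⟩ := diffAt_frame p
  apply frame_ext (p := p)
  · rw [coAlong_bracket h₁ h₂]; simp [dirDeriv_const]
  · rw [coTurn_bracket h₁ h₂]; simp [dirDeriv_const]
  · rw [coAcross_bracket h₁ h₂]; simp [dirDeriv_const]

theorem bracket_turn_across (p : Pos) : bracket turn across p = - along p := by
  obtain ⟨-, h₁, h₂⟩ := diffAt_frame p
  apply frame_ext (p := p)
  · rw [coAlong_bracket h₁ h₂]; simp [dirDeriv_const]
  · rw [coTurn_bracket h₁ h₂]; simp [dirDeriv_const]
  · rw [coAcross_bracket h₁ h₂]; simp [dirDeriv_const]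

theorem bracket_along_across (p : Pos) : bracket along across p = 0 := by
  obtain ⟨h₁, -, h₂⟩ := diffAt_frame p
  apply frame_ext (p := p)
  · rw [coAlong_bracket h₁ h₂]; simp [dirDeriv_const]
  · rw [coTurn_bracket h₁ h₂]; simp [dirDeriv_const]
  · rw [coAcross_bracket h₁ h₂]; simp [dirDeriv_const]

variable {p : Pos}

/-- The bracket as an identity of operators. It expresses `dAcross` through the two contact
directions, so that information along the contact distribution extends to all directions. -/
theorem dTurn_dAlong (hU : IsOpen U) (hf : SmoothOn U f) (hp : p ∈ U) :
    dTurn (dAlong f) p = dAlong (dTurn f) p + dAcross f p := by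
  have h := dirDeriv_bracket hU hf (smoothOn_along U) (smoothOn_turn U) hp
  rw [bracket_along_turn, CarGeometry.dirDeriv, map_neg] at h
  change - CarGeometry.dAcross f p =
    CarGeometry.dAlong (CarGeometry.dTurn f) p - CarGeometry.dTurn (CarGeometry.dAlong f) p at h
  rw [eq_sub_iff_add_eq] at h
  rw [← h]; abel

theorem dTurn_dAcross (hU : IsOpen U) (hf : SmoothOn U f) (hp : p ∈ U) :
    dTurn (dAcross f) p = dAcross (dTurn f) p - dAlong f p := by
  have h := dirDeriv_bracket hU hf (smoothOn_turn U) (smoothOn_across U) hp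
  rw [bracket_turn_across, CarGeometry.dirDeriv, map_neg] at h
  change - CarGeometry.dAlong f p = CarGeometry.dTurn (CarGeometry.dAcross f) p -
    CarGeometry.dAcross (CarGeometry.dTurn f) p at h
  rw [sub_eq_add_neg, h]; abel

theorem dAlong_dAcross (hU : IsOpen U) (hf : SmoothOn U f) (hp : p ∈ U) :
    dAlong (dAcross f) p = dAcross (dAlong f) p := by
  have h := dirDeriv_bracket hU hf (smoothOn_along U) (smoothOn_across U) hp
  rw [bracket_along_across, CarGeometry.dirDeriv, map_zero] at h
  exact (sub_eq_zero.1 h.symm)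

end FrameDerivatives

/-! ## The curves of the car -/

/-- The oriented circle (or line, or fibre) through `p` with tangent vector
`a • along p + b • turn p`. -/
def carCurve (a b : ℝ) (p : Pos) : Set Pos :=
  -- Circles (a, b ≠ 0), lines (b = 0) and fibres (a = 0) share one division-free description. For b
  -- = 0 the first two equations leave the position free, and the third clause supplies the line.
  {q | b * (q.1 - p.1) = a * (q.2.2.sin - p.2.2.sin) ∧
    b * (q.2.1 - p.2.1) = -a * (q.2.2.cos - p.2.2.cos) ∧
    (b = 0 → q.2.2 = p.2.2 ∧ -p.2.2.sin * (q.1 - p.1) + p.2.2.cos * (q.2.1 - p.2.1) = 0)}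

theorem self_mem_carCurve (a b : ℝ) (p : Pos) : p ∈ carCurve a b p := by
  simp [carCurve]

theorem carCurve_eq_of_mem {a b : ℝ} {p q : Pos} (h : q ∈ carCurve a b p) :
    carCurve a b q = carCurve a b p := by
  obtain ⟨h₁, h₂, h₃⟩ := h
  ext r
  constructor
  · rintro ⟨g₁, g₂, g₃⟩
    refine ⟨by linarith, by linarith, fun hb => ?_⟩
    obtain ⟨hq, hq'⟩ := h₃ hb
    obtain ⟨hr, hr'⟩ := g₃ hb
    rw [hq] at hr hr'
    exact ⟨hr, by linarith⟩
  · rintro ⟨g₁, g₂, g₃⟩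
    refine ⟨by linarith, by linarith, fun hb => ?_⟩
    obtain ⟨hq, hq'⟩ := h₃ hb
    obtain ⟨hr, hr'⟩ := g₃ hb
    rw [hq]
    exact ⟨hr, by linarith⟩

theorem carCurve_smul {k : ℝ} (hk : k ≠ 0) (a b : ℝ) (p : Pos) :
    carCurve (k * a) (k * b) p = carCurve a b p := by
  ext q
  simp only [carCurve, Set.mem_ofPred_eq, mul_eq_zero, hk, false_or]
  refine and_congr ?_ (and_congr ?_ Iff.rfl)
  · rw [mul_assoc, mul_assoc]; exact mul_right_inj' hk
  · rw [← mul_neg, mul_assoc, mul_assoc]; exact mul_right_inj' hk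

/-- Only the direction [a : b] matters; rescaling the pair just changes the speed of the
parametrisation. -/
theorem carCurve_eq_of_parallel {a b a' b' : ℝ} (h : a ≠ 0 ∨ b ≠ 0) (h' : a' ≠ 0 ∨ b' ≠ 0)
    (hp : a * b' = a' * b) (p : Pos) : carCurve a b p = carCurve a' b' p := by
  rcases h with h | h
  · have ha' : a' ≠ 0 := by
      rintro rfl
      have : b' = 0 := by simpa [h] using hp
      simp [this] at h'
    rw [← carCurve_smul (k := a / a') (by positivity) a' b']
    congr 1 <;> field_simp; linarith
  · have hb' : b' ≠ 0 := by
      rintro rfl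
      have : a' = 0 := by simpa [h] using hp.symm
      simp [this] at h'
    rw [← carCurve_smul (k := b / b') (by positivity) a' b']
    congr 1 <;> field_simp; linarith

/-- The coordinates of a parametrisation of a curve of the car. -/
def carPath (a b : ℝ) (c : E3) (t : ℝ) : E3 :=
  if b = 0 then (c.1 + a * Real.cos c.2.2 * t, c.2.1 + a * Real.sin c.2.2 * t, c.2.2)
  else (c.1 + a / b * (Real.sin (c.2.2 + b * t) - Real.sin c.2.2),
    c.2.1 - a / b * (Real.cos (c.2.2 + b * t) - Real.cos c.2.2), c.2.2 + b * t)

theorem carPath_zero (a b : ℝ) (c : E3) : carPath a b c 0 = c := by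
  unfold carPath; split_ifs <;> simp

theorem contDiff_carPath (a b : ℝ) (c : E3) : ContDiff ℝ ∞ (carPath a b c) := by
  unfold carPath; split_ifs <;> fun_prop

theorem carPath_angle (a b : ℝ) (c : E3) (t : ℝ) : (carPath a b c t).2.2 = c.2.2 + b * t := by
  unfold carPath; split_ifs with h <;> simp [h]

theorem hasDerivAt_carPath (a b : ℝ) (c : E3) (t : ℝ) :
    HasDerivAt (carPath a b c)
      (a * Real.cos (c.2.2 + b * t), a * Real.sin (c.2.2 + b * t), b) t := by
  have h0 : HasDerivAt (fun t : ℝ => c.2.2 + b * t) b t := by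
    simpa using ((hasDerivAt_id t).const_mul b).const_add c.2.2
  unfold carPath
  split_ifs with h
  · subst h
    refine HasDerivAt.prodMk ?_ (HasDerivAt.prodMk ?_ ?_)
    · simpa using ((hasDerivAt_id t).const_mul (a * Real.cos c.2.2)).const_add c.1
    · simpa using ((hasDerivAt_id t).const_mul (a * Real.sin c.2.2)).const_add c.2.1
    · exact hasDerivAt_const _ _
  · refine HasDerivAt.prodMk ?_ (HasDerivAt.prodMk ?_ h0)
    · have := ((h0.sin.sub_const (Real.sin c.2.2)).const_mul (a / b)).const_add c.1
      convert this using 1; field_simp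
    · have := ((h0.cos.sub_const (Real.cos c.2.2)).const_mul (a / b)).const_sub c.2.1
      convert this using 1; field_simp

theorem deriv_carPath (a b : ℝ) (c : E3) (t : ℝ) :
    deriv (carPath a b c) t = a • along (Coords.cov (carPath a b c t)) +
      b • turn (Coords.cov (carPath a b c t)) := by
  rw [(hasDerivAt_carPath a b c t).deriv]
  simp [along, turn, cov_angle, carPath_angle, Real.Angle.cos_coe, Real.Angle.sin_coe,
    -Real.Angle.coe_add]

/-- For the converse inclusion a time is needed at each point of the curve. If b ≠ 0 the angle
itself is a parameter, and any real representative of it gives a time; if b = 0 the time is the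
signed distance along the line, divided by a. -/
theorem range_carPath {a b : ℝ} (h : a ≠ 0 ∨ b ≠ 0) (c : E3) :
    (Set.range fun t => (Coords.cov (carPath a b c t) : Pos)) = carCurve a b (Coords.cov c) := by
  ext q
  constructor
  · rintro ⟨t, rfl⟩
    simp only [carCurve, Set.mem_ofPred_eq, cov_fst, cov_snd, cov_angle, carPath_angle,
      Real.Angle.cos_coe, Real.Angle.sin_coe]
    by_cases hb : b = 0
    · subst hb
      simp only [carPath, if_true]
      refine ⟨by simp, by simp, fun _ => ⟨by simp, by ring⟩⟩
    · simp only [carPath, hb, if_false, false_implies, and_true]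
      constructor <;> field_simp <;> ring
  · rintro ⟨h₁, h₂, h₃⟩
    obtain ⟨x, y, α⟩ := q
    simp only [cov_fst, cov_snd, cov_angle, Real.Angle.cos_coe, Real.Angle.sin_coe] at h₁ h₂ h₃
    by_cases hb : b = 0
    · obtain ⟨hα, h₄⟩ := h₃ hb
      have ha : a ≠ 0 := h.resolve_right (not_not.2 hb)
      refine ⟨(Real.cos c.2.2 * (x - c.1) + Real.sin c.2.2 * (y - c.2.1)) / a, ?_⟩
      have hs := Real.sin_sq_add_cos_sq c.2.2
      simp only [carPath, hb, if_true, Coords.cov, Prod.mk.injEq]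
      refine ⟨?_, ?_, hα.symm⟩
      · field_simp
        linear_combination (x - c.1) * hs + Real.sin c.2.2 * h₄
      · field_simp
        linear_combination (y - c.2.1) * hs - Real.cos c.2.2 * h₄
    · refine ⟨(α.toReal - c.2.2) / b, ?_⟩
      have e : c.2.2 + b * ((α.toReal - c.2.2) / b) = α.toReal := by field_simp; ring
      simp only [carPath, hb, if_false, Coords.cov, Prod.mk.injEq, e, Real.Angle.sin_toReal,
        Real.Angle.cos_toReal, Real.Angle.coe_toReal, and_true]
      constructor
      · field_simp; linarith
      · field_simp; linarith

theorem parametrizes_carPath {a b : ℝ} (h : a ≠ 0 ∨ b ≠ 0) (c : E3) :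
    Parametrizes (carPath a b c) (carCurve a b (Coords.cov c)) := by
  refine ⟨contDiff_carPath a b c, fun t h0 => ?_, range_carPath h c⟩
  rw [deriv_carPath] at h0
  have h1 := congrArg (coAlong (Coords.cov (carPath a b c t))) h0
  have h2 := congrArg (coTurn (Coords.cov (carPath a b c t))) h0
  simp at h1 h2
  simp [h1, h2] at h

/-- A differentiable curve that stays on a curve of the car is tangent to it. -/
theorem tangent_of_mem_carCurve {a b : ℝ} (h : a ≠ 0 ∨ b ≠ 0) {p : Pos} {c : ℝ → E3} {t : ℝ}
    {v : E3} (hc : HasDerivAt c v t)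
    (hK : ∀ᶠ s in nhds t, (Coords.cov (c s) : Pos) ∈ carCurve a b p) :
    a * coTurn (Coords.cov (c t)) v = b * coAlong (Coords.cov (c t)) v ∧
      coAcross (Coords.cov (c t)) v = 0 := by
  have hx : HasDerivAt (fun s => (c s).1) v.1 t :=
    (ContinuousLinearMap.fst ℝ ℝ (ℝ × ℝ)).hasFDerivAt.comp_hasDerivAt t hc
  have hy : HasDerivAt (fun s => (c s).2.1) v.2.1 t :=
    ((ContinuousLinearMap.fst ℝ ℝ ℝ).comp
      (ContinuousLinearMap.snd ℝ ℝ (ℝ × ℝ))).hasFDerivAt.comp_hasDerivAt t hc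
  have hα : HasDerivAt (fun s => (c s).2.2) v.2.2 t :=
    ((ContinuousLinearMap.snd ℝ ℝ ℝ).comp
      (ContinuousLinearMap.snd ℝ ℝ (ℝ × ℝ))).hasFDerivAt.comp_hasDerivAt t hc
  have hz : ∀ {f g : ℝ → ℝ} {f' g' : ℝ}, HasDerivAt f f' t → HasDerivAt g g' t →
      (∀ᶠ s in nhds t, f s = g s) → f' = g' := fun hf hg hfg =>
    (hf.congr_of_eventuallyEq (Filter.EventuallyEq.symm hfg)).unique hg
  have hK' := hK.self_of_nhds
  simp only [coAlong_apply, coTurn_apply, coAcross_apply, cov_angle, Real.Angle.cos_coe,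
    Real.Angle.sin_coe]
  have hs := Real.sin_sq_add_cos_sq (c t).2.2
  by_cases hb : b = 0
  · have ha : a ≠ 0 := h.resolve_right (not_not.2 hb)
    -- The angle is constant only modulo 2π, so the equation is differentiated through sine and
    -- cosine; sin² + cos² = 1 recombines the two results into a vanishing derivative of the angle.
    have e0 : ∀ᶠ s in nhds t, (((c s).2.2 : ℝ) : Real.Angle) = p.2.2 :=
      hK.mono fun s hs => (hs.2.2 hb).1
    have e1 := hz hα.sin (hasDerivAt_const t p.2.2.sin)
      (e0.mono fun s hs => by rw [← hs, Real.Angle.sin_coe])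
    have e2 := hz hα.cos (hasDerivAt_const t p.2.2.cos)
      (e0.mono fun s hs => by rw [← hs, Real.Angle.cos_coe])
    have e3 := hz ((((hx.sub_const p.1).const_mul (-p.2.2.sin)).add
      ((hy.sub_const p.2.1).const_mul p.2.2.cos))) (hasDerivAt_const t 0)
      (hK.mono fun s hs => (hs.2.2 hb).2)
    have e4 : v.2.2 = 0 := by
      linear_combination Real.cos (c t).2.2 * e1 - Real.sin (c t).2.2 * e2 - v.2.2 * hs
    rw [← e0.self_of_nhds, Real.Angle.sin_coe, Real.Angle.cos_coe] at e3
    exact ⟨by rw [e4, hb]; ring, e3⟩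
  · have e1 := hz ((hx.sub_const p.1).const_mul b) ((hα.sin.sub_const p.2.2.sin).const_mul a)
      (hK.mono fun s hs => by
        have := hs.1; simpa only [cov_fst, cov_angle, Real.Angle.sin_coe] using this)
    have e2 := hz ((hy.sub_const p.2.1).const_mul b) ((hα.cos.sub_const p.2.2.cos).const_mul (-a))
      (hK.mono fun s hs => by
        have := hs.2.1; simpa only [cov_snd, cov_angle, Real.Angle.cos_coe] using this)
    constructor
    · linear_combination -Real.cos (c t).2.2 * e1 - Real.sin (c t).2.2 * e2 - a * v.2.2 * hs
    · apply mul_left_cancel₀ hb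
      linear_combination -Real.sin (c t).2.2 * e1 + Real.cos (c t).2.2 * e2

theorem velocity_of_parametrizes {a b : ℝ} (h : a ≠ 0 ∨ b ≠ 0) {p : Pos} {c : ℝ → E3}
    (hc : Parametrizes c (carCurve a b p)) (t : ℝ) :
    a * coTurn (Coords.cov (c t)) (deriv c t) = b * coAlong (Coords.cov (c t)) (deriv c t) ∧
      coAcross (Coords.cov (c t)) (deriv c t) = 0 :=
  tangent_of_mem_carCurve h ((hc.1.differentiable (by simp)) t).hasDerivAt
    (Filter.Eventually.of_forall fun s => hc.2.2 ▸ Set.mem_range_self s)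

/-! ## Projecting the gas foliation -/

theorem dproj_gasField (ℓ : ℝ) (m : Config) :
    dproj (gasField ℓ m) =
      (ℓ * m.2.2.2.cos) • along (proj m) + (- m.2.2.2.sin) • turn (proj m) := by
  simp [dproj, gasField, along, turn, proj]

theorem gas_ne_zero {ℓ : ℝ} (hℓ : 0 < ℓ) (β : Real.Angle) : ℓ * β.cos ≠ 0 ∨ -β.sin ≠ 0 := by
  by_contra! h
  have := cos_sq_add_sin_sq' β
  have h1 : β.cos = 0 := by simpa [hℓ.ne'] using h.1
  have h2 : β.sin = 0 := by simpa using h.2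
  simp [h1, h2] at this

/-- The gas field has no β-component, so β is constant on a leaf, and the projected curve moves
along a fixed combination of `along` and `turn`, up to a factor depending on time. -/
theorem image_leaf_gas {ℓ : ℝ} (hℓ : 0 < ℓ) (m : Config) :
    proj '' leaf (gas ℓ) m = carCurve (ℓ * m.2.2.2.cos) (- m.2.2.2.sin) (proj m) := by
  have hne := gas_ne_zero hℓ m.2.2.2
  apply Set.Subset.antisymm
  · rintro _ ⟨m', ⟨c, hc, htan, h0, h1⟩, rfl⟩
    have hd : ∀ t, HasDerivAt c (deriv c t) t := fun t =>
      ((hc.differentiable (by simp)) t).hasDerivAt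
    choose k hk using fun t => Submodule.mem_span_singleton.1 (htan t)
    have hx : ∀ t, HasDerivAt (fun s => (c s).1) (deriv c t).1 t := fun t =>
      (ContinuousLinearMap.fst ℝ ℝ (ℝ × ℝ × ℝ)).hasFDerivAt.comp_hasDerivAt t (hd t)
    have hy : ∀ t, HasDerivAt (fun s => (c s).2.1) (deriv c t).2.1 t := fun t =>
      ((ContinuousLinearMap.fst ℝ ℝ (ℝ × ℝ)).comp
        (ContinuousLinearMap.snd ℝ ℝ (ℝ × ℝ × ℝ))).hasFDerivAt.comp_hasDerivAt t (hd t)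
    have hα : ∀ t, HasDerivAt (fun s => (c s).2.2.1) (deriv c t).2.2.1 t := fun t =>
      (((ContinuousLinearMap.fst ℝ ℝ ℝ).comp (ContinuousLinearMap.snd ℝ ℝ (ℝ × ℝ))).comp
        (ContinuousLinearMap.snd ℝ ℝ (ℝ × ℝ × ℝ))).hasFDerivAt.comp_hasDerivAt t (hd t)
    have hβ : ∀ t, HasDerivAt (fun s => (c s).2.2.2) (deriv c t).2.2.2 t := fun t =>
      (((ContinuousLinearMap.snd ℝ ℝ ℝ).comp (ContinuousLinearMap.snd ℝ ℝ (ℝ × ℝ))).comp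
        (ContinuousLinearMap.snd ℝ ℝ (ℝ × ℝ × ℝ))).hasFDerivAt.comp_hasDerivAt t (hd t)
    have hconst : ∀ {f f' : ℝ → ℝ}, (∀ t, HasDerivAt f (f' t) t) → (∀ t, f' t = 0) →
        ∀ t, f t = f 0 := fun {f f'} hf hf' t =>
      is_const_of_deriv_eq_zero (fun s => (hf s).differentiableAt)
        (fun s => (hf s).deriv.trans (hf' s)) t 0
    have hββ : ∀ t, (c t).2.2.2 = (c 0).2.2.2 := hconst hβ fun t => by
      rw [← hk t]; simp [gasField]
    have e : ∀ t, ((c t).2.2.2 : Real.Angle) = m.2.2.2 := fun t => by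
      rw [hββ t, ← h0]; rfl
    have hk' : ∀ t, deriv c t = k t •
        (ℓ * m.2.2.2.cos * Real.cos (c t).2.2.1, ℓ * m.2.2.2.cos * Real.sin (c t).2.2.1,
          - m.2.2.2.sin, 0) := fun t => by
      rw [← hk t, gasField]
      simp only [Coords.cov, e, Real.Angle.cos_coe, Real.Angle.sin_coe]
    have hm : m = Coords.cov (c 0) := h0.symm
    have hp0 : proj m = ((c 0).1, (c 0).2.1, ((c 0).2.2.1 : Real.Angle)) := by rw [hm]; rfl
    have hp1 : proj m' = ((c 1).1, (c 1).2.1, ((c 1).2.2.1 : Real.Angle)) := by rw [← h1]; rfl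
    rw [hp0, hp1]
    generalize m.2.2.2 = β at *
    generalize ℓ * β.cos = a at *
    generalize -β.sin = b at *
    simp only [carCurve, Set.mem_ofPred_eq, Real.Angle.cos_coe, Real.Angle.sin_coe]
    -- The first integrals are b x - a sin α and b y + a cos α, and for b = 0 also α and the
    -- distance from the line. Their values at times 0 and 1 are compared.
    refine ⟨?_, ?_, fun hb => ?_⟩
    · have := hconst (fun t => ((hx t).const_mul b).sub ((hα t).sin.const_mul a))
        (fun t => by rw [hk' t]; simp; ring) 1
      simp only [Pi.sub_apply] at this
      linarith
    · have := hconst (fun t => ((hy t).const_mul b).add ((hα t).cos.const_mul a))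
        (fun t => by rw [hk' t]; simp; ring) 1
      simp only [Pi.add_apply] at this
      linarith
    · have hαα := hconst hα fun t => by rw [hk' t]; simp [hb]
      refine ⟨by rw [hαα 1], ?_⟩
      have := hconst (fun t => ((hx t).const_mul (-Real.sin (c 0).2.2.1)).add
        ((hy t).const_mul (Real.cos (c 0).2.2.1)))
        (fun t => by rw [hk' t, hαα t]; simp; ring) 1
      simp only [Pi.add_apply] at this
      linarith
  · intro q hq
    rw [← Coords.cov_lift (proj m), ← range_carPath hne] at hq
    obtain ⟨T, rfl⟩ := hq
    generalize hβ : m.2.2.2.toReal = β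
    have hβ' : m.2.2.2 = (β : Real.Angle) := by rw [← hβ, Real.Angle.coe_toReal]

    set P := carPath (ℓ * m.2.2.2.cos) (- m.2.2.2.sin) (Coords.lift (proj m)) with hP
    have hd : ∀ t, HasDerivAt P (ℓ * m.2.2.2.cos * Real.cos (P t).2.2,
        ℓ * m.2.2.2.cos * Real.sin (P t).2.2, - m.2.2.2.sin) t := fun t => by
      have := hasDerivAt_carPath (ℓ * m.2.2.2.cos) (- m.2.2.2.sin) (Coords.lift (proj m)) t
      rwa [← carPath_angle] at this
    refine ⟨(Coords.cov ((P T).1, (P T).2.1, (P T).2.2, β) : Config), ?_, rfl⟩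
    have hcd : ContDiff ℝ ∞ P := contDiff_carPath _ _ _
    -- A leaf is defined by points reached at time 1, so the path is rescaled by T; T = 0 or T < 0
    -- is harmless because the leaf curves need not be regular.
    refine ⟨fun s => ((P (T * s)).1, (P (T * s)).2.1, (P (T * s)).2.2, β), ?_, fun t => ?_,
      ?_, by simp⟩
    · have : ContDiff ℝ ∞ fun s => P (T * s) := by fun_prop
      fun_prop
    · have h1 : HasDerivAt (fun s => P (T * s)) _ t :=
        HasDerivAt.scomp t (hd (T * t)) (((hasDerivAt_id t).const_mul T))
      let L : E3 →L[ℝ] E4 := (ContinuousLinearMap.fst ℝ ℝ (ℝ × ℝ)).prod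
        (((ContinuousLinearMap.fst ℝ ℝ ℝ).comp (ContinuousLinearMap.snd ℝ ℝ (ℝ × ℝ))).prod
        (((ContinuousLinearMap.snd ℝ ℝ ℝ).comp (ContinuousLinearMap.snd ℝ ℝ (ℝ × ℝ))).prod 0))
      have h2 := (L.hasFDerivAt.comp_hasDerivAt t h1).add_const ((0, 0, 0, β) : E4)
      have h3 : (fun s => L (P (T * s)) + ((0, 0, 0, β) : E4)) =
          fun s => ((P (T * s)).1, (P (T * s)).2.1, (P (T * s)).2.2, β) := by
        funext s; simp [L]
      have h4 : HasDerivAt (fun s => ((P (T * s)).1, (P (T * s)).2.1, (P (T * s)).2.2, β)) _ t :=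
        h3 ▸ h2
      rw [h4.deriv]
      refine Submodule.mem_span_singleton.2 ⟨T, ?_⟩
      simp [gasField, L, Coords.cov, ← hβ']
    · simp only [mul_zero, hP, carPath_zero]
      simp [Coords.cov, Coords.lift, proj, ← hβ']

theorem inducedDistribution_gas {ℓ : ℝ} (hℓ : 0 < ℓ) (p : Pos) :
    inducedDistribution (gas ℓ) p = LinearMap.ker (coAcross p) := by
  apply le_antisymm
  · refine iSup₂_le fun m hm => ?_
    rw [gas, Submodule.map_span_le]
    rintro _ rfl
    rw [dproj_gasField, show proj m = p from hm]
    simp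
  · intro u hu
    have hu' : coAcross p u = 0 := hu
    have hmem : ∀ β : Real.Angle, (ℓ * β.cos) • along p + (-β.sin) • turn p ∈
        inducedDistribution (gas ℓ) p := fun β => by
      have h1 := dproj_gasField ℓ (p.1, p.2.1, p.2.2, β)
      refine Submodule.mem_iSup_of_mem (p.1, p.2.1, p.2.2, β) (Submodule.mem_iSup_of_mem rfl ?_)
      exact Submodule.mem_map.2 ⟨_, Submodule.mem_span_singleton_self _, h1⟩
    -- The wheels straight ahead (β = 0) and turned sideways (β = π/2) already span the contact
    -- plane.
    have h1 : ℓ • along p ∈ inducedDistribution (gas ℓ) p := by simpa using hmem 0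
    have h2 : -turn p ∈ inducedDistribution (gas ℓ) p := by
      simpa using hmem ((Real.pi / 2 : ℝ) : Real.Angle)
    rw [frame_decomp p u, hu', zero_smul, add_zero]
    refine Submodule.add_mem _ ?_ (Submodule.smul_mem _ _ (by simpa using Submodule.neg_mem _ h2))
    have h3 := Submodule.smul_mem _ (ℓ⁻¹) h1
    rw [smul_smul, inv_mul_cancel₀ hℓ.ne', one_smul] at h3
    exact Submodule.smul_mem _ _ h3

theorem mem_inducedCurves {ℓ : ℝ} (hℓ : 0 < ℓ) {K : Set Pos} (hK : K ∈ inducedCurves (gas ℓ)) :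
    ∃ a b : ℝ, ∃ p, (a ≠ 0 ∨ b ≠ 0) ∧ K = carCurve a b p := by
  obtain ⟨m, rfl⟩ := hK
  exact ⟨_, _, _, gas_ne_zero hℓ m.2.2.2, image_leaf_gas hℓ m⟩

/-- The wheel angle has to make (ℓ cos β, -sin β) proportional to (a, b), so β is the argument of
a/ℓ - ib. -/
theorem carCurve_mem_inducedCurves {ℓ : ℝ} (hℓ : 0 < ℓ) {a b : ℝ} (h : a ≠ 0 ∨ b ≠ 0) (p : Pos) :
    carCurve a b p ∈ inducedCurves (gas ℓ) := by
  set z : ℂ := ⟨a / ℓ, -b⟩ with hz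
  have hz0 : z ≠ 0 := by
    intro h0
    have h1 := congrArg Complex.re h0
    have h2 := congrArg Complex.im h0
    simp [hz, hℓ.ne'] at h1 h2
    simp [h1, h2] at h
  have hn : 0 < ‖z‖ := norm_pos_iff.2 hz0
  refine ⟨(p.1, p.2.1, p.2.2, (z.arg : Real.Angle)), ?_⟩
  rw [image_leaf_gas hℓ]
  have hc : ((z.arg : ℝ) : Real.Angle).cos = a / ℓ / ‖z‖ := by
    rw [Real.Angle.cos_coe, Complex.cos_arg hz0]
  have hs : ((z.arg : ℝ) : Real.Angle).sin = -b / ‖z‖ := by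
    rw [Real.Angle.sin_coe, Complex.sin_arg]
  refine carCurve_eq_of_parallel h (gas_ne_zero hℓ _) ?_ p
  simp only [hc, hs]
  field_simp

/-! ## The contact projective structure -/

/-- The structure equation d coAcross = coAlong ∧ coTurn, which is nondegenerate on ker `coAcross`.
-/
theorem extD_coAcross (p : Pos) (u v : E3) :
    extD coAcross p u v = coAlong p u * coTurn p v - coAlong p v * coTurn p u := by
  have h : ∀ v : E3, ∀ u, dirDeriv (fun q => coAcross q v) p u =
      -(p.2.2.cos * u.2.2 * v.1) - p.2.2.sin * u.2.2 * v.2.1 := fun v u => by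
    simp only [coAcross_apply]
    have hc : ∀ a : ℝ, DiffAt (fun _ : Pos => a) p := fun a => differentiableAt_const _
    rw [dirDeriv_add ((diffAt_sin p).neg.mul (hc _)) ((diffAt_cos p).mul (hc _)),
      dirDeriv_mul (diffAt_sin p).neg (hc _), dirDeriv_mul (diffAt_cos p) (hc _),
      dirDeriv_neg, dirDeriv_cos, dirDeriv_sin, dirDeriv_const, dirDeriv_const]
    ring
  rw [extD, h, h]
  simp only [coAlong_apply, coTurn_apply]
  ring

theorem smoothForm_coAcross (U : Set Pos) : SmoothForm U coAcross := fun u =>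
  SmoothOn.coAcross (V := fun _ => u) (smoothOn_const U u)

theorem exists_coAcross_ne (p : Pos) : coAcross p ≠ 0 := fun h => by
  have := coAcross_across p
  rw [h] at this
  simp at this

theorem isContact_induced {ℓ : ℝ} (hℓ : 0 < ℓ) : IsContact (inducedDistribution (gas ℓ)) := by
  refine fun p => ⟨Set.univ, isOpen_univ, trivial, coAcross, smoothForm_coAcross _, fun q _ =>
    ⟨exists_coAcross_ne q, (inducedDistribution_gas hℓ q).symm, fun u hu hne => ?_⟩⟩
  rw [inducedDistribution_gas hℓ] at hu ⊢
  by_cases h : coAlong q u = 0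
  · refine ⟨along q, coAcross_along q, ?_⟩
    rw [extD_coAcross]
    simp only [coTurn_along, mul_zero, coAlong_along, one_mul, zero_sub, ne_eq, neg_eq_zero]
    intro h'
    exact hne (by rw [frame_decomp q u, h, h', LinearMap.mem_ker.1 hu]; simp)
  · refine ⟨turn q, coAcross_turn q, ?_⟩
    rw [extD_coAcross]
    simpa using h

/-- The torsion free connection whose geodesics tangent to the contact distribution are the curves
of the car. -/
def carConnection : Connection where
  Γ p := LinearMap.mk₂ ℝ
    (fun u v => (-(coAlong p u * coTurn p v + coTurn p u * coAlong p v) / 2) • across p)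
    (fun u u' v => by simp only [map_add, ← add_smul]; congr 1; ring)
    (fun a u v => by simp only [map_smul, smul_eq_mul, smul_smul]; congr 1; ring)
    (fun u v v' => by simp only [map_add, ← add_smul]; congr 1; ring)
    (fun a u v => by simp only [map_smul, smul_eq_mul, smul_smul]; congr 1; ring)
  smooth u v := by
    have hu : SmoothOn Set.univ fun _ : Pos => u := smoothOn_const _ u
    have hv : SmoothOn Set.univ fun _ : Pos => v := smoothOn_const _ v
    exact ((((hu.coAlong.mul hv.coTurn).add (hu.coTurn.mul hv.coAlong)).neg).div
      (smoothOn_const _ 2) (by simp)).smul (smoothOn_across _)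
  symm p u v := by simp only [LinearMap.mk₂_apply]; congr 1; ring

theorem carConnection_Γ (p : Pos) (u v : E3) : carConnection.Γ p u v =
    (-(coAlong p u * coTurn p v + coTurn p u * coAlong p v) / 2) • across p := rfl

theorem deriv_deriv_carPath (a b : ℝ) (c : E3) (t : ℝ) :
    deriv (deriv (carPath a b c)) t = (a * b) • across (Coords.cov (carPath a b c t)) := by
  have h : deriv (carPath a b c) =
      fun t => (a * Real.cos (c.2.2 + b * t), a * Real.sin (c.2.2 + b * t), b) :=
    funext fun t => (hasDerivAt_carPath a b c t).deriv
  have h0 : HasDerivAt (fun t : ℝ => c.2.2 + b * t) b t := by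
    simpa using ((hasDerivAt_id t).const_mul b).const_add c.2.2
  rw [h, ((h0.cos.const_mul a).prodMk ((h0.sin.const_mul a).prodMk
    (hasDerivAt_const t b))).deriv]
  simp only [across, cov_angle, carPath_angle, Real.Angle.cos_coe, Real.Angle.sin_coe,
    Prod.smul_mk, smul_eq_mul, Prod.mk.injEq]
  refine ⟨by ring, by ring, by ring⟩

theorem isGeodesic_carConnection {ℓ : ℝ} (hℓ : 0 < ℓ) {K : Set Pos}
    (hK : K ∈ inducedCurves (gas ℓ)) : carConnection.IsGeodesic K := by
  obtain ⟨a, b, p, h, rfl⟩ := mem_inducedCurves hℓ hK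
  refine ⟨carPath a b (Coords.lift p), ?_, fun t => ?_⟩
  · have := parametrizes_carPath h (Coords.lift p)
    rwa [Coords.cov_lift] at this
  -- The acceleration ab · across of the standard parametrisation is cancelled exactly by the
  -- Christoffel term, so these are affinely parametrised geodesics.
  · convert Submodule.zero_mem _
    rw [deriv_deriv_carPath, carConnection_Γ, deriv_carPath, ← add_smul]
    simp only [map_add, map_smul, coAlong_along, coAlong_turn, coTurn_along, coTurn_turn,
      smul_eq_mul]
    convert zero_smul ℝ _
    ring

theorem contact_ne_zero {p : Pos} {v : E3} (hv : coAcross p v = 0) (hne : v ≠ 0) :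
    coAlong p v ≠ 0 ∨ coTurn p v ≠ 0 := by
  by_contra! h
  exact hne (by rw [frame_decomp p v, hv, h.1, h.2]; simp)

theorem isContactProjective_induced {ℓ : ℝ} (hℓ : 0 < ℓ) :
    IsContactProjective (inducedDistribution (gas ℓ)) (inducedCurves (gas ℓ)) where
  contact := isContact_induced hℓ
  tangent K hK := by
    obtain ⟨a, b, p, h, rfl⟩ := mem_inducedCurves hℓ hK
    refine ⟨carPath a b (Coords.lift p), ?_, fun t => ?_⟩
    · have := parametrizes_carPath h (Coords.lift p)
      rwa [Coords.cov_lift] at this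
    · rw [inducedDistribution_gas hℓ, deriv_carPath]
      simp
  geodesic := ⟨carConnection, fun K hK => isGeodesic_carConnection hℓ hK⟩
  unique p L hL hL1 := by
    obtain ⟨⟨v, hvL⟩, hv0, hv⟩ := finrank_eq_one_iff'.1 hL1
    have hne : v ≠ 0 := fun h => hv0 (by simp [h])
    have hvc : coAcross p v = 0 := by
      have := hL hvL
      rwa [inducedDistribution_gas hℓ] at this
    have hab := contact_ne_zero hvc hne
    refine ⟨carCurve (coAlong p v) (coTurn p v) p,
      ⟨carCurve_mem_inducedCurves hℓ hab p, carPath (coAlong p v) (coTurn p v) (Coords.lift p), 0,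
        ?_, ?_, ?_⟩, ?_⟩
    · have := parametrizes_carPath hab (Coords.lift p)
      rwa [Coords.cov_lift] at this
    · rw [carPath_zero, Coords.cov_lift]
    · rw [deriv_carPath, carPath_zero, Coords.cov_lift]
      have := frame_decomp p v
      rw [hvc, zero_smul, add_zero] at this
      rwa [← this]
    -- Any parametrisation of a curve of the family has its velocity in the ratio [a : b]; since it
    -- lies in the line L, this ratio is that of v, and a curve is determined by one point and its
    -- ratio.
    · rintro K ⟨hK, c, t, hc, hcp, hcL⟩
      obtain ⟨a, b, q, h, rfl⟩ := mem_inducedCurves hℓ hK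
      have hmem : p ∈ carCurve a b q := by
        rw [← hcp, ← hc.2.2]; exact Set.mem_range_self t
      obtain ⟨h1, -⟩ := velocity_of_parametrizes h hc t
      obtain ⟨s, hs⟩ := hv ⟨_, hcL⟩
      have hs' : s • v = deriv c t := congrArg Subtype.val hs
      have hs0 : s ≠ 0 := fun h0 => hc.2.1 t (by rw [← hs', h0, zero_smul])
      rw [← hs', hcp, map_smul, map_smul, smul_eq_mul, smul_eq_mul] at h1
      rw [← carCurve_eq_of_mem hmem]
      refine carCurve_eq_of_parallel h hab ?_ p
      apply mul_left_cancel₀ hs0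
      linarith

/-! ## The Engel structure on the configuration space -/

/-- The pull-back of the contact form to the configuration space. -/
def configForm (m : Config) : E4 →ₗ[ℝ] ℝ := (coAcross (proj m)).comp dproj

theorem configForm_apply (m : Config) (v : E4) :
    configForm m v = -m.2.2.1.sin * v.1 + m.2.2.1.cos * v.2.1 := rfl

/-- For the pulled back contact form ω this is ω([V, W]) = -dω(V, W). Differentiating the identity
ω(V) = 0 trades the unknown derivatives of V for those of the coefficients of ω. -/
theorem configForm_bracket {V W : Config → E4} (hV : SmoothOn Set.univ V)
    (hW : SmoothOn Set.univ W) (hV0 : ∀ m, configForm m (V m) = 0)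
    (hW0 : ∀ m, configForm m (W m) = 0) (m : Config) :
    configForm m (bracket V W m) = (V m).2.2.1 * coAlong (proj m) (dproj (W m)) -
      (W m).2.2.1 * coAlong (proj m) (dproj (V m)) := by
  have key : ∀ {V : Config → E4}, SmoothOn Set.univ V → (∀ m, configForm m (V m) = 0) →
      ∀ u : E4, configForm m (fderiv ℝ (fun c => V (Coords.cov c)) (Coords.lift m) u) =
        u.2.2.1 * coAlong (proj m) (dproj (V m)) := by
    intro V hV hV0 u
    have hd : HasFDerivAt (fun c : E4 => V (Coords.cov c)) _ (Coords.lift m) :=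
      (((contDiffOn_univ.1 hV).differentiable (by simp)) _).hasFDerivAt
    have hline : HasDerivAt (fun t : ℝ => (Coords.lift m : E4) + t • u) u 0 := by
      simpa using ((hasDerivAt_id (0 : ℝ)).smul_const u).const_add (Coords.lift m : E4)
    have hd' : HasFDerivAt (fun c : E4 => V (Coords.cov c))
        (fderiv ℝ (fun c => V (Coords.cov c)) (Coords.lift m))
        ((Coords.lift m : E4) + (0 : ℝ) • u) := by simpa using hd
    have h := hd'.comp_hasDerivAt (0 : ℝ) hline
    have h1 : HasDerivAt (fun t : ℝ => (V (Coords.cov ((Coords.lift m : E4) + t • u))).1) _ 0 :=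
      (ContinuousLinearMap.fst ℝ ℝ (ℝ × ℝ × ℝ)).hasFDerivAt.comp_hasDerivAt (0 : ℝ) h
    have h2 : HasDerivAt (fun t : ℝ => (V (Coords.cov ((Coords.lift m : E4) + t • u))).2.1) _ 0 :=
      ((ContinuousLinearMap.fst ℝ ℝ (ℝ × ℝ)).comp
        (ContinuousLinearMap.snd ℝ ℝ (ℝ × ℝ × ℝ))).hasFDerivAt.comp_hasDerivAt (0 : ℝ) h
    have h3 : HasDerivAt (fun t : ℝ => ((Coords.lift m : E4) + t • u).2.2.1) u.2.2.1 0 :=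
      (((ContinuousLinearMap.fst ℝ ℝ ℝ).comp (ContinuousLinearMap.snd ℝ ℝ (ℝ × ℝ))).comp
        (ContinuousLinearMap.snd ℝ ℝ (ℝ × ℝ × ℝ))).hasFDerivAt.comp_hasDerivAt (0 : ℝ) hline
    have h4 := ((h3.sin.neg.mul h1).add (h3.cos.mul h2)).congr_of_eventuallyEq
      (f₁ := fun _ => (0 : ℝ)) (Filter.Eventually.of_forall fun t =>
        (hV0 (Coords.cov ((Coords.lift m : E4) + t • u))).symm)
    have h5 := h4.unique (hasDerivAt_const (0 : ℝ) (0 : ℝ))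
    simp only [zero_smul, add_zero, Coords.cov_lift, Pi.neg_apply] at h5
    simp only [configForm_apply, coAlong_apply]
    simp only [Coords.lift, Real.Angle.sin_toReal, Real.Angle.cos_toReal,
      ContinuousLinearMap.comp_apply, ContinuousLinearMap.coe_fst', ContinuousLinearMap.coe_snd']
      at h5 ⊢
    simp only [proj, dproj, LinearMap.coe_mk, AddHom.coe_mk]
    linarith
  rw [bracket, VectorField.lieBracket, map_sub, key hW hW0, key hV hV0, Coords.cov_lift]

theorem smoothOn_steeringField : SmoothOn Set.univ steeringField := contDiffOn_const

theorem smoothOn_gasField (ℓ : ℝ) : SmoothOn Set.univ (gasField ℓ) := by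
  have : ContDiff ℝ ∞ (fun c : E4 => ((ℓ * Real.cos c.2.2.2 * Real.cos c.2.2.1,
    ℓ * Real.cos c.2.2.2 * Real.sin c.2.2.1, - Real.sin c.2.2.2, 0) : E4)) := by fun_prop
  exact this.contDiffOn

/-- The bracket of the steering wheel and the gas vector fields. -/
def wriggleField (ℓ : ℝ) (m : Config) : E4 :=
  (-(ℓ * m.2.2.2.sin * m.2.2.1.cos), -(ℓ * m.2.2.2.sin * m.2.2.1.sin), - m.2.2.2.cos, 0)

theorem smoothOn_wriggleField (ℓ : ℝ) : SmoothOn Set.univ (wriggleField ℓ) := by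
  have : ContDiff ℝ ∞ (fun c : E4 => ((-(ℓ * Real.sin c.2.2.2 * Real.cos c.2.2.1),
    -(ℓ * Real.sin c.2.2.2 * Real.sin c.2.2.1), - Real.cos c.2.2.2, 0) : E4)) := by fun_prop
  exact this.contDiffOn

theorem bracket_steeringField_gasField (ℓ : ℝ) (m : Config) :
    bracket steeringField (gasField ℓ) m = wriggleField ℓ m := by
  have hd : HasFDerivAt (fun c : E4 => gasField ℓ (Coords.cov c)) _ (Coords.lift m) :=
    (((contDiffOn_univ.1 (smoothOn_gasField ℓ)).differentiable (by simp)) _).hasFDerivAt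
  have hline : HasDerivAt (fun t : ℝ => (Coords.lift m : E4) + t • ((0, 0, 0, 1) : E4))
      (0, 0, 0, 1) 0 := by
    simpa using ((hasDerivAt_id (0 : ℝ)).smul_const ((0, 0, 0, 1) : E4)).const_add
      (Coords.lift m : E4)
  have hd' : HasFDerivAt (fun c : E4 => gasField ℓ (Coords.cov c))
      (fderiv ℝ (fun c => gasField ℓ (Coords.cov c)) (Coords.lift m))
      ((Coords.lift m : E4) + (0 : ℝ) • ((0, 0, 0, 1) : E4)) := by simpa using hd
  have h := hd'.comp_hasDerivAt (0 : ℝ) hline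
  have hβ : HasDerivAt (fun t : ℝ => m.2.2.2.toReal + t) 1 0 :=
    (hasDerivAt_id (0 : ℝ)).const_add _
  have h' : HasDerivAt (fun t : ℝ => ((ℓ * Real.cos (m.2.2.2.toReal + t) * m.2.2.1.cos,
      ℓ * Real.cos (m.2.2.2.toReal + t) * m.2.2.1.sin, - Real.sin (m.2.2.2.toReal + t), 0) : E4))
      _ 0 :=
    ((hβ.cos.const_mul ℓ).mul_const _).prodMk (((hβ.cos.const_mul ℓ).mul_const _).prodMk
      (hβ.sin.neg.prodMk (hasDerivAt_const _ _)))
  have hfun : (fun c : E4 => gasField ℓ (Coords.cov c)) ∘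
      (fun t : ℝ => (Coords.lift m : E4) + t • ((0, 0, 0, 1) : E4)) =
      fun t : ℝ => ((ℓ * Real.cos (m.2.2.2.toReal + t) * m.2.2.1.cos,
      ℓ * Real.cos (m.2.2.2.toReal + t) * m.2.2.1.sin, - Real.sin (m.2.2.2.toReal + t), 0) : E4) := by
    funext t
    simp [gasField, Coords.cov, Coords.lift, ← Real.Angle.cos_coe, ← Real.Angle.sin_coe]
  rw [hfun] at h
  have h2 := h.unique h'
  rw [bracket, VectorField.lieBracket]
  simp only [steeringField]
  rw [fderiv_fun_const, h2]
  simp [wriggleField]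

variable {ℓ : ℝ}

theorem steering_sup_gas_le (ℓ : ℝ) (m : Config) :
    (steering ⊔ gas ℓ) m ≤ LinearMap.ker (configForm m) := by
  refine sup_le ?_ ?_
  · rw [steering, Submodule.span_singleton_le_iff_mem]
    simp [configForm_apply, steeringField]
  · rw [gas, Submodule.span_singleton_le_iff_mem]
    simp only [LinearMap.mem_ker, configForm_apply, gasField]
    ring

theorem isSection_steeringField (ℓ : ℝ) : IsSection (steering ⊔ gas ℓ) steeringField :=
  ⟨smoothOn_steeringField, fun p =>
    (le_sup_left : steering p ≤ steering p ⊔ gas ℓ p) (Submodule.mem_span_singleton_self _)⟩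

theorem isSection_gasField (ℓ : ℝ) : IsSection (steering ⊔ gas ℓ) (gasField ℓ) :=
  ⟨smoothOn_gasField ℓ, fun p =>
    (le_sup_right : gas ℓ p ≤ steering p ⊔ gas ℓ p) (Submodule.mem_span_singleton_self _)⟩

/-- Sections of the distribution have their (coAlong, ∂_α)-components on the line spanned by (ℓ cos
β, -sin β), so the contact component of their brackets vanishes. The line turns with β, which is why
steering and gas produce the missing direction. -/
theorem firstDerived (hℓ : 0 < ℓ) (m : Config) :
    bracketDistribution (steering ⊔ gas ℓ) (steering ⊔ gas ℓ) m =
      LinearMap.ker (configForm m) := by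
  apply le_antisymm
  · refine sup_le (steering_sup_gas_le ℓ m) (Submodule.span_le.2 ?_)
    rintro _ ⟨V, W, hV, hW, rfl⟩
    rw [SetLike.mem_coe, LinearMap.mem_ker,
      configForm_bracket hV.1 hW.1 (fun q => steering_sup_gas_le ℓ q (hV.2 q))
      (fun q => steering_sup_gas_le ℓ q (hW.2 q))]
    have key : ∀ v ∈ (steering ⊔ gas ℓ) m, ∃ t : ℝ, v.2.2.1 = t * -m.2.2.2.sin ∧
        coAlong (proj m) (dproj v) = t * (ℓ * m.2.2.2.cos) := by
      intro v hv
      obtain ⟨v₁, h₁, v₂, h₂, rfl⟩ := Submodule.mem_sup.1 hv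
      obtain ⟨s, rfl⟩ := Submodule.mem_span_singleton.1 h₁
      obtain ⟨t, rfl⟩ := Submodule.mem_span_singleton.1 h₂
      refine ⟨t, by simp [steeringField, gasField], ?_⟩
      have h0 : dproj (steeringField m) = 0 := by simp [steeringField, dproj]
      rw [map_add, map_smul, map_smul, dproj_gasField, h0]
      simp
    obtain ⟨s, h₁, h₂⟩ := key _ (hV.2 m)
    obtain ⟨t, h₃, h₄⟩ := key _ (hW.2 m)
    rw [h₁, h₂, h₃, h₄]
    ring
  · intro v hv
    rw [LinearMap.mem_ker, configForm_apply] at hv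
    obtain ⟨x, y, a, b⟩ := v
    have hα := cos_sq_add_sin_sq' m.2.2.1
    have hβ := cos_sq_add_sin_sq' m.2.2.2
    set A := m.2.2.1.cos * x + m.2.2.1.sin * y with hA
    have hx : x = m.2.2.1.cos * A := by
      simp only at hv
      linear_combination (-x) * hα - m.2.2.1.sin * hv
    have hy : y = m.2.2.1.sin * A := by
      simp only at hv
      linear_combination (-y) * hα + m.2.2.1.cos * hv
    obtain ⟨q, hq⟩ : ∃ q, A = ℓ * q := ⟨A / ℓ, by field_simp⟩
    clear_value A
    -- The coefficients invert the rotation by β that takes (along, turn), scaled by ℓ and up to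
    -- signs, to the gas and wriggle fields.
    have e : ((x, y, a, b) : E4) = (b • steeringField m +
        (q * m.2.2.2.cos - a * m.2.2.2.sin) • gasField ℓ m) +
        (-q * m.2.2.2.sin - a * m.2.2.2.cos) • wriggleField ℓ m := by
      simp only [steeringField, gasField, wriggleField, Prod.smul_mk, Prod.mk_add_mk, smul_eq_mul,
        Prod.mk.injEq]
      refine ⟨?_, ?_, ?_, by ring⟩
      · linear_combination hx + m.2.2.1.cos * hq - m.2.2.1.cos * ℓ * q * hβ
      · linear_combination hy + m.2.2.1.sin * hq - m.2.2.1.sin * ℓ * q * hβ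
      · linear_combination (-a) * hβ
    rw [e]
    refine Submodule.add_mem_sup (Submodule.add_mem _ (Submodule.smul_mem _ _
      ((isSection_steeringField ℓ).2 m)) (Submodule.smul_mem _ _ ((isSection_gasField ℓ).2 m)))
      (Submodule.smul_mem _ _ (Submodule.subset_span ?_))
    exact ⟨_, _, isSection_steeringField ℓ, isSection_gasField ℓ,
      (bracket_steeringField_gasField ℓ m).symm⟩

/-- The bracket of `gasField` and `wriggleField` has contact component ℓ ≠ 0, so it completes the
corank one distribution of `firstDerived` to the whole tangent space. -/
theorem secondDerived (hℓ : 0 < ℓ) (m : Config) :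
    bracketDistribution (steering ⊔ gas ℓ)
      (bracketDistribution (steering ⊔ gas ℓ) (steering ⊔ gas ℓ)) m = ⊤ := by
  have hW0 : ∀ m, configForm m (wriggleField ℓ m) = 0 := fun m => by
    simp only [configForm_apply, wriggleField]; ring
  have hg0 : ∀ m, configForm m (gasField ℓ m) = 0 := fun m => by
    simp only [configForm_apply, gasField]; ring
  have hW : IsSection (bracketDistribution (steering ⊔ gas ℓ) (steering ⊔ gas ℓ))
      (wriggleField ℓ) := ⟨smoothOn_wriggleField ℓ, fun p => by
    rw [firstDerived hℓ]; exact hW0 p⟩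
  have hb : configForm m (bracket (gasField ℓ) (wriggleField ℓ) m) = ℓ := by
    rw [configForm_bracket (smoothOn_gasField ℓ) (smoothOn_wriggleField ℓ) hg0 hW0]
    simp only [gasField, wriggleField, coAlong_apply, dproj, proj, LinearMap.coe_mk, AddHom.coe_mk]
    linear_combination ℓ * (m.2.2.2.cos * m.2.2.2.cos + m.2.2.2.sin * m.2.2.2.sin) *
      cos_sq_add_sin_sq' m.2.2.1 + ℓ * cos_sq_add_sin_sq' m.2.2.2
  rw [eq_top_iff]
  intro v _
  rw [show v = (v - (configForm m v / ℓ) • bracket (gasField ℓ) (wriggleField ℓ) m) +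
    (configForm m v / ℓ) • bracket (gasField ℓ) (wriggleField ℓ) m by abel]
  refine Submodule.add_mem_sup ?_ (Submodule.smul_mem _ _ (Submodule.subset_span
    ⟨_, _, isSection_gasField ℓ, hW, rfl⟩))
  rw [firstDerived hℓ, LinearMap.mem_ker, map_sub, map_smul, hb, smul_eq_mul, div_mul_cancel₀ _ hℓ.ne',
    sub_self]

theorem isSmoothDistribution_span {V : Config → E4} (hV : SmoothOn Set.univ V) :
    IsSmoothDistribution fun m => Submodule.span ℝ {V m} := by
  intro p v hv
  obtain ⟨t, rfl⟩ := Submodule.mem_span_singleton.1 hv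
  exact ⟨fun m => t • V m, ⟨ContDiffOn.const_smul t hV, fun q =>
    Submodule.smul_mem _ _ (Submodule.mem_span_singleton_self _)⟩, rfl⟩

theorem gasField_ne_zero (hℓ : 0 < ℓ) (m : Config) : gasField ℓ m ≠ 0 := by
  intro h
  have h' := dproj_gasField ℓ m
  rw [h, map_zero] at h'
  have h1 := congrArg (coAlong (proj m)) h'
  have h2 := congrArg (coTurn (proj m)) h'
  simp at h1 h2
  have := gas_ne_zero hℓ m.2.2.2
  rcases h1 with h1 | h1 <;> simp_all

theorem isEngelWithSplit_car (hℓ : 0 < ℓ) : IsEngelWithSplit steering (gas ℓ) := by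
  refine ⟨isSmoothDistribution_span smoothOn_steeringField,
    isSmoothDistribution_span (smoothOn_gasField ℓ), fun m => ?_⟩
  have hs : steeringField m ≠ 0 := by simp [steeringField]
  refine ⟨finrank_span_singleton hs, finrank_span_singleton (gasField_ne_zero hℓ m), ?_, ?_, ?_⟩
  · have hli : LinearIndependent ℝ ![steeringField m, gasField ℓ m] := by
      rw [LinearIndependent.pair_iff]
      intro s t hst
      have h1 : s = 0 := by
        have := congrArg (fun v : E4 => v.2.2.2) hst
        simpa [steeringField, gasField] using this
      refine ⟨h1, ?_⟩
      rw [h1, zero_smul, zero_add] at hst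
      exact (smul_eq_zero.1 hst).resolve_right (gasField_ne_zero hℓ m)
    have e : steering m ⊔ gas ℓ m =
        Submodule.span ℝ (Set.range ![steeringField m, gasField ℓ m]) := by
      rw [Matrix.range_cons, Matrix.range_cons, Matrix.range_empty, Set.union_empty,
        Submodule.span_union, steering, gas]
    rw [e, finrank_span_eq_card hli]
    rfl
  · rw [firstDerived hℓ]
    have h := LinearMap.finrank_range_add_finrank_ker (configForm m)
    have hsurj : LinearMap.range (configForm m) = ⊤ := by
      rw [LinearMap.range_eq_top]
      intro t
      refine ⟨(-m.2.2.1.sin * t, m.2.2.1.cos * t, 0, 0), ?_⟩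
      rw [configForm_apply]
      linear_combination t * cos_sq_add_sin_sq' m.2.2.1
    rw [hsurj, finrank_top] at h
    simp at h
    omega
  · rw [secondDerived hℓ, finrank_top]
    simp

/-! ## The leaf space of the steering wheel foliation -/

theorem mem_leaf_steering {m m' : Config} : m' ∈ leaf steering m ↔ proj m' = proj m := by
  constructor
  · rintro ⟨c, hc, htan, rfl, rfl⟩
    have hd : ∀ t, HasDerivAt c (deriv c t) t := fun t =>
      ((hc.differentiable (by simp)) t).hasDerivAt
    let L : E4 →L[ℝ] E3 := (ContinuousLinearMap.fst ℝ ℝ (ℝ × ℝ × ℝ)).prod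
      ((((ContinuousLinearMap.fst ℝ ℝ (ℝ × ℝ)).prod
        ((ContinuousLinearMap.fst ℝ ℝ ℝ).comp (ContinuousLinearMap.snd ℝ ℝ (ℝ × ℝ))))).comp
        (ContinuousLinearMap.snd ℝ ℝ (ℝ × ℝ × ℝ)))
    have hL : ∀ t, HasDerivAt (fun s => L (c s)) (L (deriv c t)) t := fun t =>
      L.hasFDerivAt.comp_hasDerivAt t (hd t)
    have h := is_const_of_deriv_eq_zero (fun t => (hL t).differentiableAt) (fun t => by
      obtain ⟨k, hk⟩ := Submodule.mem_span_singleton.1 (htan t)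
      rw [(hL t).deriv, ← hk]
      simp [L, steeringField]) 1 0
    simp only [L, ContinuousLinearMap.prod_apply, ContinuousLinearMap.comp_apply,
      ContinuousLinearMap.coe_fst', ContinuousLinearMap.coe_snd', Prod.mk.injEq] at h
    simp only [proj, Coords.cov, h]
  · intro h
    obtain ⟨x, y, α, β⟩ := m
    obtain ⟨x', y', α', β'⟩ := m'
    simp only [proj, Prod.mk.injEq] at h
    obtain ⟨rfl, rfl, rfl⟩ := h
    refine ⟨fun t => (x', y', α'.toReal, β.toReal + t * (β'.toReal - β.toReal)), by fun_prop,
      fun t => ?_, by simp [Coords.cov], by simp [Coords.cov]⟩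
    have h1 : HasDerivAt (fun t : ℝ => β.toReal + t * (β'.toReal - β.toReal))
        (β'.toReal - β.toReal) t := by
      simpa using ((hasDerivAt_id t).mul_const (β'.toReal - β.toReal)).const_add β.toReal
    have h2 : HasDerivAt (fun t : ℝ => ((x', y', α'.toReal,
        β.toReal + t * (β'.toReal - β.toReal)) : E4)) (0, 0, 0, β'.toReal - β.toReal) t :=
      (hasDerivAt_const _ _).prodMk ((hasDerivAt_const _ _).prodMk
        ((hasDerivAt_const _ _).prodMk h1))
    rw [h2.deriv]
    exact Submodule.mem_span_singleton.2 ⟨β'.toReal - β.toReal, by simp [steeringField]⟩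

/-- The identification of the leaf space with the space of positions. -/
def leafSpaceHomeomorph : LeafSpace ≃ₜ Pos where
  toFun := Quot.lift proj fun _ _ h => (mem_leaf_steering.1 h).symm
  -- Keeping the wheels at β = 0 is a continuous section of the projection, so the inverse is
  -- continuous.
  invFun p := Quot.mk _ (p.1, p.2.1, p.2.2, 0)
  left_inv := by
    rintro ⟨m⟩
    exact Quot.sound (mem_leaf_steering.2 rfl)
  right_inv _ := rfl
  continuous_toFun := continuous_quot_lift _ (by unfold proj; fun_prop)
  continuous_invFun := continuous_quot_mk.comp (by fun_prop)

/-! ## The first jet space -/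

theorem contDiff_jetCoords (s : ℝ) : ContDiff ℝ ∞ (jetCoords s) := by
  have h : ContDiff ℝ ∞ fun j : ℝ × ℝ × ℝ => Real.arctan j.2.2 :=
    (Real.contDiff_arctan).comp (contDiff_snd.comp contDiff_snd)
  unfold jetCoords
  fun_prop

theorem jet_angle (s : ℝ) (j : ℝ × ℝ × ℝ) :
    (jet s j).2.2 = ((Real.arctan j.2.2 : ℝ) : Real.Angle) + (s : Real.Angle) := by
  rw [← Real.Angle.coe_add]; rfl

theorem range_jet (s : ℝ) :
    Set.range (jet s) = {p | 0 < (p.2.2 - (s : Real.Angle)).cos} := by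
  ext p
  constructor
  · rintro ⟨j, rfl⟩
    change 0 < ((jet s j).2.2 - (s : Real.Angle)).cos
    rw [jet_angle, add_sub_cancel_right, Real.Angle.cos_coe]
    exact Real.cos_arctan_pos _
  · intro h
    have h' : |(p.2.2 - (s : Real.Angle)).toReal| < Real.pi / 2 :=
      Real.Angle.cos_pos_iff_abs_toReal_lt_pi_div_two.1 h
    refine ⟨(p.1, p.2.1, Real.tan (p.2.2 - (s : Real.Angle)).toReal), ?_⟩
    simp only [jet, jetCoords, Coords.cov]
    rw [Real.arctan_tan (abs_lt.1 h').1 (abs_lt.1 h').2, Real.Angle.coe_add,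
      Real.Angle.coe_toReal, sub_add_cancel]

/-- The sign of `cos α` on the part of the space of positions parametrised by `jet s`. -/
theorem jet_sign {s : ℝ} (hs : s = 0 ∨ s = Real.pi) :
    ∃ σ : ℝ, σ ^ 2 = 1 ∧ Real.sin s = 0 ∧ Real.cos s = σ := by
  rcases hs with rfl | rfl
  · exact ⟨1, by simp⟩
  · exact ⟨-1, by simp⟩

/-- The sign σ = cos s distinguishes the two halves of `Pos`: whether the chassis points towards
increasing or decreasing x. -/
theorem jet_trig {s : ℝ} (hs : s = 0 ∨ s = Real.pi) :
    ∃ σ : ℝ, σ ^ 2 = 1 ∧ ∀ q : ℝ, Real.cos (Real.arctan q + s) = σ / √(1 + q ^ 2) ∧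
      Real.sin (Real.arctan q + s) = σ * q / √(1 + q ^ 2) := by
  obtain ⟨σ, hσ, h1, h2⟩ := jet_sign hs
  refine ⟨σ, hσ, fun q => ?_⟩
  rw [Real.cos_add, Real.sin_add, h1, h2, Real.cos_arctan, Real.sin_arctan]
  constructor <;> ring

theorem toJet_jet {s : ℝ} (hs : s = 0 ∨ s = Real.pi) (j : ℝ × ℝ × ℝ) : toJet (jet s j) = j := by
  obtain ⟨σ, hσ, h⟩ := jet_trig hs
  obtain ⟨x, y, q⟩ := j
  have hσ0 : σ ≠ 0 := by rintro rfl; norm_num at hσ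
  have hq : √(1 + q ^ 2) ≠ 0 := by positivity
  simp only [toJet, jet, jetCoords, Coords.cov, Real.Angle.tan_coe, Real.tan_eq_sin_div_cos, h]
  simp only [Prod.mk.injEq, true_and]
  field_simp

theorem smoothOn_toJet {s : ℝ} (hs : s = 0 ∨ s = Real.pi) :
    SmoothOn (Set.range (jet s)) toJet := by
  obtain ⟨σ, hσ, h⟩ := jet_trig hs
  intro c hc
  obtain ⟨j, hj⟩ := hc
  have hσ0 : σ ≠ 0 := by rintro rfl; norm_num at hσ
  have hcos : Real.cos c.2.2 ≠ 0 := by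
    have h1 := congrArg (fun p : Pos => p.2.2.cos) hj
    simp only [jet, jetCoords, cov_angle, Real.Angle.cos_coe, h] at h1
    rw [← h1]
    positivity
  have h2 : ContDiffAt ℝ ∞ (fun c : E3 => Real.tan c.2.2) c :=
    ContDiffAt.comp (g := Real.tan) c (Real.contDiffAt_tan.2 hcos) (by fun_prop)
  have h3 : ContDiffAt ℝ ∞ (fun c : E3 => ((c.1, c.2.1, Real.tan c.2.2) : ℝ × ℝ × ℝ)) c := by
    fun_prop
  refine ContDiffAt.contDiffWithinAt (h3.congr_of_eventuallyEq (Filter.Eventually.of_forall ?_))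
  intro d
  simp [toJet, Coords.cov, Real.Angle.tan_coe]

theorem hasFDerivAt_line {E F : Type} [NormedAddCommGroup E] [NormedSpace ℝ E]
    [NormedAddCommGroup F] [NormedSpace ℝ F] {f : E → F} {c : E} (hf : DifferentiableAt ℝ f c)
    (w : E) {v : F} (h : HasDerivAt (fun t : ℝ => f (c + t • w)) v 0) : fderiv ℝ f c w = v :=
  (hf.lineDeriv_eq_fderiv (v := w)).symm.trans (HasLineDerivAt.lineDeriv h)

theorem fderiv_jetCoords (s : ℝ) (j w : ℝ × ℝ × ℝ) :
    fderiv ℝ (jetCoords s) j w = (w.1, w.2.1, w.2.2 / (1 + j.2.2 ^ 2)) := by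
  refine hasFDerivAt_line (((contDiff_jetCoords s).differentiable (by simp)) j) w ?_
  have h : ∀ a b : ℝ, HasDerivAt (fun t : ℝ => a + t * b) b 0 := fun a b => by
    simpa using ((hasDerivAt_id (0 : ℝ)).mul_const b).const_add a
  have h3 := (h j.2.2 w.2.2).arctan.add_const s
  simp only [zero_mul, add_zero] at h3
  refine (h j.1 w.1).prodMk ((h j.2.1 w.2.1).prodMk ?_)
  exact h3.congr_deriv (by ring)

/-! ### The third order equation as constancy of the curvature of a graph -/

section Equation

variable {a b : ℝ} {y : ℝ → ℝ}

theorem hasDerivAt_jet {s x q q' : ℝ} {y u : ℝ → ℝ} (hy : HasDerivAt y (u x) x) (hq : q = u x)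
    (hu : HasDerivAt u q' x) :
    HasDerivAt (fun x => jetCoords s (x, y x, u x)) (1, q, q' / (1 + q ^ 2)) x := by
  subst hq
  refine (hasDerivAt_id x).prodMk (hy.prodMk ?_)
  have := hu.arctan.add_const s
  exact this.congr_deriv (by ring)

theorem const_of_hasDerivAt_zero {f f' : ℝ → ℝ} (hf : ∀ x ∈ Set.Ioo a b, HasDerivAt f (f' x) x)
    (h : ∀ x ∈ Set.Ioo a b, f' x = 0) {x x₀ : ℝ} (hx : x ∈ Set.Ioo a b)
    (hx₀ : x₀ ∈ Set.Ioo a b) : f x = f x₀ :=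
  isOpen_Ioo.is_const_of_deriv_eq_zero isPreconnected_Ioo
    (fun z hz => (hf z hz).differentiableAt.differentiableWithinAt)
    (fun z hz => (hf z hz).deriv.trans (h z hz)) hx hx₀

theorem hasDerivAt_iterate (hy : ContDiffOn ℝ ∞ y (Set.Ioo a b)) {x : ℝ} (hx : x ∈ Set.Ioo a b) :
    HasDerivAt y (deriv y x) x ∧ HasDerivAt (deriv y) (iteratedDeriv 2 y x) x ∧
      HasDerivAt (iteratedDeriv 2 y) (iteratedDeriv 3 y x) x := by
  have hs : ∀ {f : ℝ → ℝ}, ContDiffOn ℝ ∞ f (Set.Ioo a b) →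
      ContDiffOn ℝ ∞ (deriv f) (Set.Ioo a b) := fun hf =>
    hf.deriv_of_isOpen isOpen_Ioo (by simp)
  have hd : ∀ {f : ℝ → ℝ}, ContDiffOn ℝ ∞ f (Set.Ioo a b) → HasDerivAt f (deriv f x) x :=
    fun hf => ((hf.contDiffAt (isOpen_Ioo.mem_nhds hx)).differentiableAt (by simp)).hasDerivAt
  have e2 : iteratedDeriv 2 y = deriv (deriv y) := by
    rw [iteratedDeriv_succ, iteratedDeriv_one]
  have e3 : iteratedDeriv 3 y = deriv (deriv (deriv y)) := by
    rw [iteratedDeriv_succ, e2]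
  rw [e2, e3]
  exact ⟨hd hy, hd (hs hy), hd (hs (hs hy))⟩

/-- The function is (1 + u²)^{3/2}, the denominator of the curvature of a graph with slope u. -/
theorem hasDerivAt_one_add_sq_pow {u : ℝ → ℝ} {u' x : ℝ} (hu : HasDerivAt u u' x) :
    HasDerivAt (fun x => (1 + u x ^ 2) * √(1 + u x ^ 2)) (3 * u x * u' * √(1 + u x ^ 2)) x := by
  have h1 : HasDerivAt (fun x => 1 + u x ^ 2) (2 * u x * u') x := by
    simpa using (hu.pow 2).const_add 1
  have h2 := h1.mul (h1.sqrt (by positivity))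
  refine h2.congr_deriv ?_
  have h3 : √(1 + u x ^ 2) * √(1 + u x ^ 2) = 1 + u x ^ 2 := Real.mul_self_sqrt (by positivity)
  have h4 : √(1 + u x ^ 2) ≠ 0 := by positivity
  field_simp
  linear_combination (-(u x * u')) * h3

/-- Tangency to the curve says that k y'' = l σ (1 + y'²)^{3/2}, that is, that the curvature is
constant. One more derivative eliminates the constant and gives the equation. -/
theorem solvesCarODE_of_jet_mem {s : ℝ} (hs : s = 0 ∨ s = Real.pi)
    (hy : ContDiffOn ℝ ∞ y (Set.Ioo a b)) {k l : ℝ} {p : Pos} (hkl : k ≠ 0 ∨ l ≠ 0)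
    (h : ∀ x ∈ Set.Ioo a b, jet s (x, y x, deriv y x) ∈ carCurve k l p) : SolvesCarODE a b y := by
  obtain ⟨σ, hσ, hjet⟩ := jet_trig hs
  have h2 : ∀ x ∈ Set.Ioo a b, k * iteratedDeriv 2 y x =
      l * σ * ((1 + deriv y x ^ 2) * √(1 + deriv y x ^ 2)) := fun x hx => by
    obtain ⟨d1, d2, -⟩ := hasDerivAt_iterate hy hx
    have ht := (tangent_of_mem_carCurve hkl (hasDerivAt_jet (s := s) d1 rfl d2)
      (Filter.eventually_of_mem (isOpen_Ioo.mem_nhds hx) h)).1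
    simp only [coTurn_apply, coAlong_apply, jetCoords, cov_angle, Real.Angle.cos_coe,
      Real.Angle.sin_coe, hjet] at ht
    have h3 : √(1 + deriv y x ^ 2) * √(1 + deriv y x ^ 2) = 1 + deriv y x ^ 2 :=
      Real.mul_self_sqrt (by positivity)
    have h4 : √(1 + deriv y x ^ 2) ≠ 0 := by positivity
    field_simp at ht
    apply mul_left_cancel₀ h4
    linear_combination ht - l * σ * (1 + deriv y x ^ 2) * h3
  intro x hx
  -- The fibres (k = 0) are excluded: the previous relation would make a nonzero multiple of (1 +
  -- y'²)^{3/2} vanish.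
  have hk : k ≠ 0 := by
    rintro rfl
    have hl : l ≠ 0 := by simpa using hkl
    have hσ0 : σ ≠ 0 := by rintro rfl; norm_num at hσ
    have := h2 x hx
    rw [zero_mul] at this
    have h5 : 0 < (1 + deriv y x ^ 2) * √(1 + deriv y x ^ 2) := by positivity
    exact (mul_ne_zero (mul_ne_zero hl hσ0) h5.ne') this.symm
  obtain ⟨-, d2, d3⟩ := hasDerivAt_iterate hy hx
  have e := ((d3.const_mul k).congr_of_eventuallyEq (f₁ := fun x =>
    l * σ * ((1 + deriv y x ^ 2) * √(1 + deriv y x ^ 2)))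
    (Filter.eventually_of_mem (isOpen_Ioo.mem_nhds hx) fun z hz => (h2 z hz).symm)).unique
    ((hasDerivAt_one_add_sq_pow d2).const_mul (l * σ))
  have h4 : 1 + deriv y x ^ 2 ≠ 0 := by positivity
  rw [eq_div_iff h4]
  apply mul_left_cancel₀ hk
  linear_combination (1 + deriv y x ^ 2) * e - 3 * deriv y x * iteratedDeriv 2 y x * h2 x hx

/-- The equation is the vanishing of the derivative of the curvature κ. Once κ is constant, the
defining functions of the curve through one of the jets have zero derivative along the others. -/
theorem jet_mem_of_solvesCarODE {s : ℝ} (hs : s = 0 ∨ s = Real.pi)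
    (hy : ContDiffOn ℝ ∞ y (Set.Ioo a b)) (h : SolvesCarODE a b y) :
    ∃ l : ℝ, ∃ p, ∀ x ∈ Set.Ioo a b, jet s (x, y x, deriv y x) ∈ carCurve 1 l p := by
  obtain ⟨σ, hσ, hjet⟩ := jet_trig hs
  rcases (Set.Ioo a b).eq_empty_or_nonempty with he | ⟨x₀, hx₀⟩
  -- On an empty interval any curve will do.
  · exact ⟨0, 0, by simp [he]⟩
  have hpos : ∀ x, (1 + deriv y x ^ 2) * √(1 + deriv y x ^ 2) ≠ 0 := fun x => by positivity
  have hκ : ∀ x ∈ Set.Ioo a b, iteratedDeriv 2 y x /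
      ((1 + deriv y x ^ 2) * √(1 + deriv y x ^ 2)) =
      iteratedDeriv 2 y x₀ / ((1 + deriv y x₀ ^ 2) * √(1 + deriv y x₀ ^ 2)) := fun x hx =>
    const_of_hasDerivAt_zero (fun z hz => ((hasDerivAt_iterate hy hz).2.2).div
      (hasDerivAt_one_add_sq_pow (hasDerivAt_iterate hy hz).2.1) (hpos z)) (fun z hz => by
        have h5 : 1 + deriv y z ^ 2 ≠ 0 := by positivity
        rw [h z hz, div_eq_zero_iff]
        left
        field_simp
        ring) hx hx₀
  set κ := iteratedDeriv 2 y x₀ / ((1 + deriv y x₀ ^ 2) * √(1 + deriv y x₀ ^ 2)) with hκ0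
  have h2 : ∀ x ∈ Set.Ioo a b, iteratedDeriv 2 y x =
      κ * ((1 + deriv y x ^ 2) * √(1 + deriv y x ^ 2)) := fun x hx => by
    rw [← hκ x hx, div_mul_cancel₀ _ (hpos x)]
  have hang : ∀ x ∈ Set.Ioo a b, HasDerivAt (fun x => Real.arctan (deriv y x) + s)
      (κ * √(1 + deriv y x ^ 2)) x := fun x hx => by
    have := (hasDerivAt_iterate hy hx).2.1.arctan.add_const s
    refine this.congr_deriv ?_
    rw [h2 x hx]
    field_simp
  have hsq : ∀ x, √(1 + deriv y x ^ 2) ≠ 0 := fun x => by positivity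
  -- The factor σ is needed because on the half cos α < 0 the chassis points against increasing x,
  -- which reverses the sign of the oriented curvature.
  refine ⟨σ * κ, jet s (x₀, y x₀, deriv y x₀), fun x hx => ?_⟩
  simp only [carCurve, Set.mem_ofPred_eq, jet, jetCoords, Coords.cov, Real.Angle.cos_coe,
    Real.Angle.sin_coe]
  refine ⟨?_, ?_, fun hl => ?_⟩
  · have := const_of_hasDerivAt_zero (fun z hz => ((hasDerivAt_id z).const_mul (σ * κ)).sub
      (hang z hz).sin) (fun z hz => by
        rw [(hjet _).1]; have := hsq z; field_simp; ring) hx hx₀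
    simp only [Pi.sub_apply, id] at this
    linarith
  · have := const_of_hasDerivAt_zero (fun z hz => ((hasDerivAt_iterate hy hz).1.const_mul
      (σ * κ)).add (hang z hz).cos) (fun z hz => by
        rw [(hjet _).2]; have := hsq z; field_simp; ring) hx hx₀
    simp only [Pi.add_apply] at this
    linarith
  · have hσ0 : σ ≠ 0 := by rintro rfl; norm_num at hσ
    have hκz : κ = 0 := by simpa [hσ0] using hl
    have hq : ∀ z ∈ Set.Ioo a b, deriv y z = deriv y x₀ := fun z hz =>
      const_of_hasDerivAt_zero (fun z hz => (hasDerivAt_iterate hy hz).2.1)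
        (fun z hz => by rw [h2 z hz, hκz, zero_mul]) hz hx₀
    refine ⟨by rw [hq x hx], ?_⟩
    have := const_of_hasDerivAt_zero (fun z hz => ((hasDerivAt_id z).const_mul
      (-Real.sin (Real.arctan (deriv y x₀) + s))).add ((hasDerivAt_iterate hy hz).1.const_mul
      (Real.cos (Real.arctan (deriv y x₀) + s)))) (fun z hz => by
        rw [hq z hz, (hjet _).1, (hjet _).2]; ring) hx hx₀
    simp only [Pi.add_apply, id] at this
    linarith

end Equation

theorem isFirstJetSpace_car {ℓ : ℝ} (hℓ : 0 < ℓ) :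
    IsFirstJetSpace (inducedDistribution (gas ℓ)) (inducedCurves (gas ℓ)) := by
  intro s hs
  refine ⟨contDiff_jetCoords s, range_jet s, smoothOn_toJet hs, toJet_jet hs, fun j w => ?_,
    fun a b y hy => ⟨fun h => ?_, ?_⟩⟩
  · obtain ⟨σ, hσ, hjet⟩ := jet_trig hs
    have hσ0 : σ ≠ 0 := by rintro rfl; norm_num at hσ
    have h4 : √(1 + j.2.2 ^ 2) ≠ 0 := by positivity
    rw [inducedDistribution_gas hℓ, fderiv_jetCoords, LinearMap.mem_ker, coAcross_apply]
    simp only [jet, jetCoords, cov_angle, Real.Angle.cos_coe, Real.Angle.sin_coe, hjet]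
    have e : -(σ * j.2.2 / √(1 + j.2.2 ^ 2)) * w.1 + σ / √(1 + j.2.2 ^ 2) * w.2.1 =
        σ / √(1 + j.2.2 ^ 2) * (w.2.1 - j.2.2 * w.1) := by ring
    rw [e, mul_eq_zero, or_iff_right (div_ne_zero hσ0 h4)]
  · obtain ⟨l, p, hlp⟩ := jet_mem_of_solvesCarODE hs hy h
    exact ⟨_, carCurve_mem_inducedCurves hℓ (Or.inl one_ne_zero) p, hlp⟩
  · rintro ⟨K, hK, hmem⟩
    obtain ⟨k, l, p, hkl, rfl⟩ := mem_inducedCurves hℓ hK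
    exact solvesCarODE_of_jet_mem hs hy hkl hmem

attribute [local instance 100] LieRing.ofAssociativeRing

/-! ## The symplectic Lie algebra in coordinates -/

theorem mat_mul_apply (A B : Mat) (i j : Fin 2 ⊕ Fin 2) :
    (A * B) i j = A i e₁ * B e₁ j + A i e₂ * B e₂ j + A i f₁ * B f₁ j + A i f₂ * B f₂ j := by
  rw [Matrix.mul_apply, Fintype.sum_sum_type, Fin.sum_univ_two, Fin.sum_univ_two]
  ring

theorem mat_trace (A : Mat) : A.trace = A e₁ e₁ + A e₂ e₂ + A f₁ f₁ + A f₂ f₂ := by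
  rw [Matrix.trace, Fintype.sum_sum_type, Fin.sum_univ_two, Fin.sum_univ_two]
  simp only [Matrix.diag_apply]
  ring

theorem mat_lie (A B : Mat) : ⁅A, B⁆ = A * B - B * A := rfl

theorem mat_lie_apply (A B : Mat) (i j : Fin 2 ⊕ Fin 2) : ⁅A, B⁆ i j =
    A i e₁ * B e₁ j + A i e₂ * B e₂ j + A i f₁ * B f₁ j + A i f₂ * B f₂ j -
    (B i e₁ * A e₁ j + B i e₂ * A e₂ j + B i f₁ * A f₁ j + B i f₂ * A f₂ j) := by
  rw [mat_lie, Matrix.sub_apply, mat_mul_apply, mat_mul_apply]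

theorem forall_index {P : Fin 2 ⊕ Fin 2 → Prop} (h₁ : P e₁) (h₂ : P e₂) (h₃ : P f₁) (h₄ : P f₂) :
    ∀ i, P i := by
  rintro (i | i) <;> fin_cases i <;> assumption

theorem mat_ext_index {A B : Mat} (h : ∀ i, A i e₁ = B i e₁ ∧ A i e₂ = B i e₂ ∧ A i f₁ = B i f₁ ∧
    A i f₂ = B i f₂) : A = B := by
  ext i j
  exact forall_index (P := fun j => A i j = B i j) (h i).1 (h i).2.1 (h i).2.2.1 (h i).2.2.2 j

/-- The element of `sp(2,ℝ)` with the given entries. -/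
def spMat (m p q a s t u b c z : ℝ) : Mat :=
  -- In the grading defined by the line of e₁, m has degree -2, p and q degree -1, a, s, t, u degree
  -- 0, b and c degree 1, z degree 2.
  Matrix.fromBlocks !![a, b; p, s] !![z, c; c, t] !![m, q; q, u] !![-a, -p; -b, -s]

theorem mem_sp4_iff (A : Mat) :
    A ∈ sp4 ↔ A.transpose * Matrix.J (Fin 2) ℝ = -(Matrix.J (Fin 2) ℝ * A) := by
  rw [sp4, LieAlgebra.Symplectic.sp, mem_skewAdjointMatricesLieSubalgebra,
    mem_skewAdjointMatricesSubmodule, Matrix.IsSkewAdjoint, Matrix.IsAdjointPair, mul_neg]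

theorem J_entries : Matrix.J (Fin 2) ℝ = Matrix.fromBlocks !![0, 0; 0, 0] !![-1, 0; 0, -1]
    !![1, 0; 0, 1] !![0, 0; 0, 0] := by
  rw [Matrix.J]
  congr 1 <;> ext i j <;> fin_cases i <;> fin_cases j <;> simp

theorem spMat_mem (m p q a s t u b c z : ℝ) : spMat m p q a s t u b c z ∈ sp4 := by
  rw [mem_sp4_iff, J_entries]
  refine mat_ext_index (forall_index ?_ ?_ ?_ ?_) <;>
    simp [mat_mul_apply, spMat]

theorem sp4_entries {A : Mat} (hA : A ∈ sp4) :
    A f₁ f₁ = - A e₁ e₁ ∧ A f₂ f₂ = - A e₂ e₂ ∧ A f₁ f₂ = - A e₂ e₁ ∧ A f₂ f₁ = - A e₁ e₂ ∧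
      A f₁ e₂ = A f₂ e₁ ∧ A e₂ f₁ = A e₁ f₂ := by
  rw [mem_sp4_iff, J_entries] at hA
  have h : ∀ i j, (A.transpose * Matrix.fromBlocks !![(0 : ℝ), 0; 0, 0] !![-1, 0; 0, -1]
    !![1, 0; 0, 1] !![0, 0; 0, 0]) i j = (-(Matrix.fromBlocks !![(0 : ℝ), 0; 0, 0] !![-1, 0; 0, -1]
    !![1, 0; 0, 1] !![0, 0; 0, 0] * A)) i j := fun i j => by rw [hA]
  simp only [mat_mul_apply, Matrix.neg_apply, Matrix.transpose_apply] at h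
  have h1 := h f₁ e₁
  have h2 := h f₂ e₂
  have h3 := h f₂ e₁
  have h4 := h f₁ e₂
  have h5 := h e₁ e₂
  have h6 := h f₁ f₂
  simp at h1 h2 h3 h4 h5 h6
  refine ⟨?_, ?_, ?_, ?_, ?_, ?_⟩ <;> linarith

theorem eq_spMat {A : Mat} (hA : A ∈ sp4) : A = spMat (A f₁ e₁) (A e₂ e₁) (A f₂ e₁) (A e₁ e₁)
    (A e₂ e₂) (A e₂ f₂) (A f₂ e₂) (A e₁ e₂) (A e₁ f₂) (A e₁ f₁) := by
  obtain ⟨h1, h2, h3, h4, h5, h6⟩ := sp4_entries hA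
  refine mat_ext_index (forall_index ?_ ?_ ?_ ?_) <;> simp [spMat, h1, h2, h3, h4, h5, h6]

theorem sp4_ext {A B : Mat} (hA : A ∈ sp4) (hB : B ∈ sp4) (h1 : A f₁ e₁ = B f₁ e₁)
    (h2 : A e₂ e₁ = B e₂ e₁) (h3 : A f₂ e₁ = B f₂ e₁) (h4 : A e₁ e₁ = B e₁ e₁)
    (h5 : A e₂ e₂ = B e₂ e₂) (h6 : A e₂ f₂ = B e₂ f₂) (h7 : A f₂ e₂ = B f₂ e₂)
    (h8 : A e₁ e₂ = B e₁ e₂) (h9 : A e₁ f₂ = B e₁ f₂) (h10 : A e₁ f₁ = B e₁ f₁) : A = B := by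
  rw [eq_spMat hA, eq_spMat hB, h1, h2, h3, h4, h5, h6, h7, h8, h9, h10]

/-- Coordinates on `sp(2,ℝ)`. -/
def sp4Equiv : sp4 ≃ₗ[ℝ] (Fin 10 → ℝ) where
  toFun A := ![A.1 f₁ e₁, A.1 e₂ e₁, A.1 f₂ e₁, A.1 e₁ e₁, A.1 e₂ e₂, A.1 e₂ f₂, A.1 f₂ e₂,
    A.1 e₁ e₂, A.1 e₁ f₂, A.1 e₁ f₁]
  map_add' A B := by
    ext i; fin_cases i <;> rfl
  map_smul' a A := by
    ext i; fin_cases i <;> rfl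
  invFun v := ⟨spMat (v 0) (v 1) (v 2) (v 3) (v 4) (v 5) (v 6) (v 7) (v 8) (v 9), spMat_mem ..⟩
  left_inv A := Subtype.ext (eq_spMat A.2).symm
  right_inv v := by
    ext i; fin_cases i <;> simp [spMat]

theorem finrank_sp4 : Module.finrank ℝ sp4 = 10 := by
  rw [sp4Equiv.finrank_eq, Module.finrank_fin_fun]

theorem lie_mem_sp4 {A B : Mat} (hA : A ∈ sp4) (hB : B ∈ sp4) : ⁅A, B⁆ ∈ sp4 :=
  LieSubalgebra.lie_mem _ hA hB

/-- The inverse of a symplectic matrix. -/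
def sympInv (h : Mat) : Mat := -(Matrix.J (Fin 2) ℝ * h.transpose * Matrix.J (Fin 2) ℝ)

theorem sympInv_mul {h : Mat} (hh : h ∈ Matrix.symplecticGroup (Fin 2) ℝ) :
    sympInv h * h = 1 := by
  have h1 := SymplecticGroup.mem_iff'.1 hh
  rw [sympInv, neg_mul, mul_assoc, mul_assoc, ← mul_assoc h.transpose, h1, Matrix.J_squared,
    neg_neg]

theorem mul_sympInv {h : Mat} (hh : h ∈ Matrix.symplecticGroup (Fin 2) ℝ) :
    h * sympInv h = 1 := mul_eq_one_comm.1 (sympInv_mul hh)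

theorem inv_eq_sympInv {h : Mat} (hh : h ∈ Matrix.symplecticGroup (Fin 2) ℝ) :
    h⁻¹ = sympInv h := Matrix.inv_eq_left_inv (sympInv_mul hh)

theorem conj_mem_sp4 {h A : Mat} (hh : h ∈ Matrix.symplecticGroup (Fin 2) ℝ) (hA : A ∈ sp4) :
    h⁻¹ * A * h ∈ sp4 := by
  rw [mem_sp4_iff] at hA ⊢
  have h1 := SymplecticGroup.mem_iff'.1 hh
  have h2 : h * h⁻¹ = 1 := by rw [inv_eq_sympInv hh]; exact mul_sympInv hh
  have h3 : h⁻¹.transpose * h.transpose = 1 := by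
    rw [← Matrix.transpose_mul, h2, Matrix.transpose_one]
  have h4 : h.transpose * Matrix.J (Fin 2) ℝ = Matrix.J (Fin 2) ℝ * h⁻¹ := by
    calc h.transpose * Matrix.J (Fin 2) ℝ
        = h.transpose * Matrix.J (Fin 2) ℝ * (h * h⁻¹) := by rw [h2, mul_one]
      _ = (h.transpose * Matrix.J (Fin 2) ℝ * h) * h⁻¹ := by simp only [mul_assoc]
      _ = _ := by rw [h1]
  have h5 : h⁻¹.transpose * Matrix.J (Fin 2) ℝ = Matrix.J (Fin 2) ℝ * h := by
    calc h⁻¹.transpose * Matrix.J (Fin 2) ℝ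
        = h⁻¹.transpose * (h.transpose * Matrix.J (Fin 2) ℝ * h) := by rw [h1]
      _ = (h⁻¹.transpose * h.transpose) * (Matrix.J (Fin 2) ℝ * h) := by simp only [mul_assoc]
      _ = _ := by rw [h3, one_mul]
  rw [Matrix.transpose_mul, Matrix.transpose_mul, mul_assoc, mul_assoc, h5,
    ← mul_assoc A.transpose, hA, neg_mul, mul_neg, ← mul_assoc, ← mul_assoc, h4]
  simp only [mul_assoc]

/-! ## Matrix-valued functions -/

/-- The matrix-valued function `M` is smooth on `U`. -/
def SmoothMat (U : Set Pos) (M : Pos → Mat) : Prop := ∀ i j, SmoothOn U fun p => M p i j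

/-- The derivative of a matrix-valued function. -/
def dMat (M : Pos → Mat) (p : Pos) (u : E3) : Mat :=
  Matrix.of fun i j => dirDeriv (fun q => M q i j) p u

theorem dMat_apply (M : Pos → Mat) (p : Pos) (u : E3) (i j : Fin 2 ⊕ Fin 2) :
    dMat M p u i j = dirDeriv (fun q => M q i j) p u := rfl

section MatCalculus

variable {U : Set Pos} {M N : Pos → Mat} {p : Pos}

theorem smoothMat_const (U : Set Pos) (A : Mat) : SmoothMat U fun _ => A := fun i j =>
  smoothOn_const U (A i j)

theorem SmoothMat.mul (hM : SmoothMat U M) (hN : SmoothMat U N) :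
    SmoothMat U fun p => M p * N p := fun i j => by
  simp only [Matrix.mul_apply]
  exact SmoothOn.sum fun k _ => (hM i k).mul (hN k j)

theorem SmoothMat.add (hM : SmoothMat U M) (hN : SmoothMat U N) :
    SmoothMat U fun p => M p + N p := fun i j => (hM i j).add (hN i j)

theorem SmoothMat.sub (hM : SmoothMat U M) (hN : SmoothMat U N) :
    SmoothMat U fun p => M p - N p := fun i j => (hM i j).sub (hN i j)

theorem SmoothMat.neg (hM : SmoothMat U M) : SmoothMat U fun p => - M p := fun i j => (hM i j).neg

theorem SmoothMat.smul {f : Pos → ℝ} (hf : SmoothOn U f) (hM : SmoothMat U M) :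
    SmoothMat U fun p => f p • M p := fun i j => hf.mul (hM i j)

theorem SmoothMat.transpose (hM : SmoothMat U M) : SmoothMat U fun p => (M p).transpose :=
  fun i j => hM j i

theorem SmoothMat.trace (hM : SmoothMat U M) : SmoothOn U fun p => (M p).trace :=
  SmoothOn.sum fun i _ => hM i i

theorem SmoothMat.congr (hM : SmoothMat U M) (h : ∀ p ∈ U, N p = M p) : SmoothMat U N :=
  fun i j => (hM i j).congr fun p hp => by rw [h p hp]

theorem SmoothMat.mono {W : Set Pos} (hM : SmoothMat U M) (h : W ⊆ U) : SmoothMat W M :=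
  fun i j => (hM i j).mono h

theorem dMat_const (A : Mat) (p : Pos) (u : E3) : dMat (fun _ => A) p u = 0 := by
  ext i j; exact dirDeriv_const _ _ _

theorem dMat_mul (hM : ∀ i j, DiffAt (fun q => M q i j) p) (hN : ∀ i j, DiffAt (fun q => N q i j) p)
    (u : E3) : dMat (fun q => M q * N q) p u = dMat M p u * N p + M p * dMat N p u := by
  ext i j
  simp only [dMat_apply, Matrix.add_apply, Matrix.mul_apply]
  rw [dirDeriv_sum fun k _ => (hM i k).mul (hN k j), ← Finset.sum_add_distrib]
  exact Finset.sum_congr rfl fun k _ => by rw [dirDeriv_mul (hM i k) (hN k j)]; ring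

theorem dMat_add (hM : ∀ i j, DiffAt (fun q => M q i j) p) (hN : ∀ i j, DiffAt (fun q => N q i j) p)
    (u : E3) : dMat (fun q => M q + N q) p u = dMat M p u + dMat N p u := by
  ext i j; exact dirDeriv_add (hM i j) (hN i j) u

theorem dMat_sub (hM : ∀ i j, DiffAt (fun q => M q i j) p) (hN : ∀ i j, DiffAt (fun q => N q i j) p)
    (u : E3) : dMat (fun q => M q - N q) p u = dMat M p u - dMat N p u := by
  ext i j; exact dirDeriv_sub (hM i j) (hN i j) u

theorem dMat_congr (hU : IsOpen U) (h : ∀ q ∈ U, M q = N q) (hp : p ∈ U) (u : E3) :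
    dMat M p u = dMat N p u := by
  ext i j
  exact dirDeriv_congr (f := fun q => M q i j) (g := fun q => N q i j) hU
    (fun q hq => by rw [h q hq]) hp u

theorem dMat_smul {f : Pos → ℝ} (hf : DiffAt f p) (hM : ∀ i j, DiffAt (fun q => M q i j) p)
    (u : E3) : dMat (fun q => f q • M q) p u = dirDeriv f p u • M p + f p • dMat M p u := by
  ext i j
  simp only [dMat_apply, Matrix.add_apply, Matrix.smul_apply, smul_eq_mul]
  rw [dirDeriv_mul hf (hM i j)]; ring

theorem dirDeriv_trace (hM : ∀ i j, DiffAt (fun q => M q i j) p) (u : E3) :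
    dirDeriv (fun q => (M q).trace) p u = (dMat M p u).trace :=
  dirDeriv_sum (fun i _ => hM i i) u

theorem SmoothMat.diffAt (hU : IsOpen U) (hM : SmoothMat U M) (hp : p ∈ U)
    (i j : Fin 2 ⊕ Fin 2) : DiffAt (fun q => M q i j) p := (hM i j).diffAt hU hp

end MatCalculus

/-! ## Locally constant functions -/

theorem isOpenMap_cov : IsOpenMap (Coords.cov : E3 → Pos) :=
  IsOpenMap.id.prodMap (IsOpenMap.id.prodMap QuotientAddGroup.isOpenMap_coe)

/-- The function is constant on the images of small balls of the covering space, and these are open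
because the covering map is; connectedness does the rest. -/
theorem eq_of_dirDeriv_eq_zero {U : Set Pos} (hU : IsOpen U) (hc : IsPreconnected U) {f : Pos → ℝ}
    (hf : SmoothOn U f) (h : ∀ p ∈ U, ∀ u, dirDeriv f p u = 0) {p q : Pos} (hp : p ∈ U)
    (hq : q ∈ U) : f p = f q := by
  refine hc.induction₂ (fun p q => f p = f q) (fun p hp => ?_) (fun _ _ _ _ _ _ h h' => h.trans h')
    (fun _ _ _ _ h => h.symm) hp hq
  refine mem_nhdsWithin_of_mem_nhds ?_
  obtain ⟨r, hr, hball⟩ := Metric.isOpen_iff.1 (isOpen_preimage_cov hU) _ (lift_mem hp)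
  have himg := isOpenMap_cov _ (Metric.isOpen_ball (x := (Coords.lift p : E3)) (ε := r))
  refine Filter.mem_of_superset (himg.mem_nhds ⟨Coords.lift p, Metric.mem_ball_self hr,
    Coords.cov_lift p⟩) ?_
  rintro _ ⟨c, hcb, rfl⟩
  have key := Metric.isOpen_ball.is_const_of_fderiv_eq_zero (𝕜 := ℝ)
    (f := fun c : E3 => f (Coords.cov c)) (convex_ball (Coords.lift p : E3) r).isPreconnected
    (fun d hd => ((hf.contDiffAt hU (hball hd)).differentiableAt (by simp)).differentiableWithinAt)
    (fun d hd => by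
      refine ContinuousLinearMap.ext fun u => ?_
      rw [← dirDeriv_cov]
      exact h _ (hball hd) u) (Metric.mem_ball_self hr) hcb
  simp only [Coords.cov_lift] at key
  exact key

/-! ## The flat Cartan gauge -/

/-- The value of the flat gauge on `along`. -/
def alongMat (ε : ℝ) : Mat := spMat 0 0 (-ε) 0 0 0 0 0 0 0
/-- The value of the flat gauge on `turn`. -/
def turnMat : Mat := spMat 0 (1 / 2) 0 0 0 0 0 (-1 / 2) 0 0
/-- The value of the flat gauge on `across`. -/
def acrossMat (ε : ℝ) : Mat := spMat ε 0 0 0 0 0 (-ε) 0 0 0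

/-- The flat Cartan gauge, for the co-orientation `ε = ± 1`: a homomorphism from the Lie algebra of
the Euclidean group to `sp(2,ℝ)`. -/
def flatForm (ε : ℝ) : Form Mat := fun p =>
  (coAlong p).smulRight (alongMat ε) + (coTurn p).smulRight turnMat +
    (coAcross p).smulRight (acrossMat ε)

theorem flatForm_eq (ε : ℝ) (p : Pos) (u : E3) : flatForm ε p u =
    coAlong p u • alongMat ε + coTurn p u • turnMat + coAcross p u • acrossMat ε := rfl

theorem flatForm_apply (ε : ℝ) (p : Pos) (u : E3) : flatForm ε p u =
    spMat (ε * coAcross p u) (coTurn p u / 2) (-(ε * coAlong p u)) 0 0 0 (-(ε * coAcross p u))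
      (-(coTurn p u / 2)) 0 0 := by
  rw [flatForm_eq]
  refine mat_ext_index (forall_index ?_ ?_ ?_ ?_) <;>
    simp [spMat, alongMat, turnMat, acrossMat] <;>
    (repeat' apply And.intro) <;> ring

theorem flatForm_mem (ε : ℝ) (p : Pos) (u : E3) : flatForm ε p u ∈ sp4 := by
  rw [flatForm_apply]; exact spMat_mem ..

section Relations

variable (ε : ℝ)

/-- With the next six products: `alongMat` and `acrossMat` span an algebra with zero products on
which `turnMat` acts as an infinitesimal rotation, so the commutators are those of the frame. Since
turnMat² = -1/4, exp(α turnMat) = cos(α/2) + 2 sin(α/2) turnMat. -/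
theorem mul_alongMat_alongMat : alongMat ε * alongMat ε = 0 := by
  refine mat_ext_index (forall_index ?_ ?_ ?_ ?_) <;> simp [mat_mul_apply, alongMat, spMat]
theorem mul_alongMat_acrossMat : alongMat ε * acrossMat ε = 0 := by
  refine mat_ext_index (forall_index ?_ ?_ ?_ ?_) <;>
    simp [mat_mul_apply, alongMat, acrossMat, spMat]
theorem mul_acrossMat_alongMat : acrossMat ε * alongMat ε = 0 := by
  refine mat_ext_index (forall_index ?_ ?_ ?_ ?_) <;>
    simp [mat_mul_apply, alongMat, acrossMat, spMat]
theorem mul_acrossMat_acrossMat : acrossMat ε * acrossMat ε = 0 := by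
  refine mat_ext_index (forall_index ?_ ?_ ?_ ?_) <;> simp [mat_mul_apply, acrossMat, spMat]
theorem mul_alongMat_turnMat : alongMat ε * turnMat = turnMat * alongMat ε - acrossMat ε := by
  refine mat_ext_index (forall_index ?_ ?_ ?_ ?_) <;>
    simp [mat_mul_apply, alongMat, acrossMat, turnMat, spMat] <;> ring
theorem mul_acrossMat_turnMat : acrossMat ε * turnMat = turnMat * acrossMat ε + alongMat ε := by
  refine mat_ext_index (forall_index ?_ ?_ ?_ ?_) <;>
    simp [mat_mul_apply, alongMat, acrossMat, turnMat, spMat] <;> ring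
theorem mul_turnMat_turnMat : turnMat * turnMat = (-1 / 4 : ℝ) • (1 : Mat) := by
  refine mat_ext_index (forall_index ?_ ?_ ?_ ?_) <;>
    simp [mat_mul_apply, turnMat, spMat] <;> norm_num

end Relations

theorem dirDeriv_coframe (v : E3) (p : Pos) (u : E3) :
    dirDeriv (fun q => coAlong q v) p u = coTurn p u * coAcross p v ∧
    dirDeriv (fun q => coTurn q v) p u = 0 ∧
    dirDeriv (fun q => coAcross q v) p u = -(coTurn p u * coAlong p v) := by
  have hv : DiffAt (fun _ : Pos => v) p := differentiableAt_const _
  have h1 := coAlong_dirDeriv hv u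
  have h3 := coAcross_dirDeriv hv u
  rw [dirDeriv_const, map_zero] at h1 h3
  exact ⟨by linarith, dirDeriv_const _ _ _, by linarith⟩

theorem smoothOn_coframe (U : Set Pos) (v : E3) : SmoothOn U (fun q => coAlong q v) ∧
    SmoothOn U (fun q => coTurn q v) ∧ SmoothOn U (fun q => coAcross q v) :=
  ⟨(smoothOn_const U v).coAlong, (smoothOn_const U v).coTurn, (smoothOn_const U v).coAcross⟩

theorem smoothMat_flatForm (ε : ℝ) (U : Set Pos) (u : E3) : SmoothMat U fun p => flatForm ε p u := by
  obtain ⟨h1, h2, h3⟩ := smoothOn_coframe U u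
  exact ((SmoothMat.smul h1 (smoothMat_const U _)).add (SmoothMat.smul h2
    (smoothMat_const U _))).add (SmoothMat.smul h3 (smoothMat_const U _))

theorem dMat_flatForm (ε : ℝ) (p : Pos) (u v : E3) : dMat (fun q => flatForm ε q v) p u =
    (coTurn p u * coAcross p v) • alongMat ε - (coTurn p u * coAlong p v) • acrossMat ε := by
  obtain ⟨h1, h2, h3⟩ := smoothOn_coframe Set.univ v
  obtain ⟨d1, d2, d3⟩ := dirDeriv_coframe v p u
  have hc : ∀ A : Mat, ∀ i j, DiffAt (fun _ : Pos => A i j) p := fun A i j =>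
    differentiableAt_const _
  have g1 := h1.diffAt isOpen_univ (Set.mem_univ p)
  have g2 := h2.diffAt isOpen_univ (Set.mem_univ p)
  have g3 := h3.diffAt isOpen_univ (Set.mem_univ p)
  ext i j
  simp only [dMat_apply, flatForm_eq, Matrix.add_apply, Matrix.smul_apply, smul_eq_mul,
    Matrix.sub_apply]
  rw [dirDeriv_add (DiffAt.add (g1.mul (hc _ i j)) (g2.mul (hc _ i j)))
    (g3.mul (hc _ i j)), dirDeriv_add (g1.mul (hc _ i j)) (g2.mul (hc _ i j)),
    dirDeriv_mul g1 (hc _ i j), dirDeriv_mul g2 (hc _ i j), dirDeriv_mul g3 (hc _ i j), d1, d2, d3]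
  simp only [dirDeriv_const]
  ring

theorem curvature_eq (θ : Form Mat) (p : Pos) (u v : E3) : curvature θ p u v =
    dMat (fun q => θ q v) p u - dMat (fun q => θ q u) p v + ⁅θ p u, θ p v⁆ := rfl

/-- The Maurer-Cartan equation: the coframe satisfies the structure equations of the Euclidean
group, and the three matrices have the matching commutators. -/
theorem curvature_flatForm (ε : ℝ) (p : Pos) (u v : E3) : curvature (flatForm ε) p u v = 0 := by
  rw [curvature_eq, dMat_flatForm, dMat_flatForm, flatForm_eq, flatForm_eq, mat_lie]
  simp only [add_mul, mul_add, smul_mul_assoc, mul_smul_comm, mul_alongMat_alongMat,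
    mul_alongMat_acrossMat, mul_acrossMat_alongMat, mul_acrossMat_acrossMat,
    mul_alongMat_turnMat, mul_acrossMat_turnMat]
  module

/-! ## Parallel sections of the adjoint bundle -/

/-- The coefficient of `alongMat` in the developing map. -/
def coordU (p : Pos) : ℝ := p.1 * p.2.2.cos + p.2.1 * p.2.2.sin
/-- The coefficient of `acrossMat` in the developing map. -/
def coordV (p : Pos) : ℝ := -p.1 * p.2.2.sin + p.2.1 * p.2.2.cos

theorem smoothOn_fst (U : Set Pos) : SmoothOn U fun p => p.1 :=
  (contDiff_fst (𝕜 := ℝ) (E := ℝ) (F := ℝ × ℝ)).contDiffOn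
theorem smoothOn_snd (U : Set Pos) : SmoothOn U fun p => p.2.1 :=
  ((contDiff_fst (𝕜 := ℝ) (E := ℝ) (F := ℝ)).comp
    (contDiff_snd (𝕜 := ℝ) (E := ℝ) (F := ℝ × ℝ))).contDiffOn

theorem smoothOn_coordU (U : Set Pos) : SmoothOn U coordU :=
  ((smoothOn_fst U).mul (smoothOn_cos U)).add ((smoothOn_snd U).mul (smoothOn_sin U))
theorem smoothOn_coordV (U : Set Pos) : SmoothOn U coordV :=
  ((smoothOn_fst U).neg.mul (smoothOn_sin U)).add ((smoothOn_snd U).mul (smoothOn_cos U))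

theorem dirDeriv_posFst (p : Pos) (u : E3) : dirDeriv (fun q : Pos => q.1) p u = u.1 := by
  have h : HasFDerivAt (fun c : E3 => c.1) (ContinuousLinearMap.fst ℝ ℝ (ℝ × ℝ))
    (Coords.lift p) := hasFDerivAt_fst
  exact congrArg (fun T => T u) h.fderiv

theorem dirDeriv_posSnd (p : Pos) (u : E3) : dirDeriv (fun q : Pos => q.2.1) p u = u.2.1 := by
  have h : HasFDerivAt (fun c : E3 => c.2.1) ((ContinuousLinearMap.fst ℝ ℝ ℝ).comp
    (ContinuousLinearMap.snd ℝ ℝ (ℝ × ℝ))) (Coords.lift p) :=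
    ((ContinuousLinearMap.fst ℝ ℝ ℝ).comp (ContinuousLinearMap.snd ℝ ℝ (ℝ × ℝ))).hasFDerivAt
  exact congrArg (fun T => T u) h.fderiv

theorem dirDeriv_coordU (p : Pos) (u : E3) :
    dirDeriv coordU p u = coAlong p u + coTurn p u * coordV p := by
  have hx := (smoothOn_fst Set.univ).diffAt isOpen_univ (Set.mem_univ p)
  have hy := (smoothOn_snd Set.univ).diffAt isOpen_univ (Set.mem_univ p)
  have e : coordU = fun p => p.1 * p.2.2.cos + p.2.1 * p.2.2.sin := rfl
  rw [e, dirDeriv_add (hx.mul (diffAt_cos p)) (hy.mul (diffAt_sin p)),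
    dirDeriv_mul hx (diffAt_cos p), dirDeriv_mul hy (diffAt_sin p), dirDeriv_cos, dirDeriv_sin,
    dirDeriv_posFst, dirDeriv_posSnd, coAlong_apply, coTurn_apply, coordV]
  ring

theorem dirDeriv_coordV (p : Pos) (u : E3) :
    dirDeriv coordV p u = coAcross p u - coTurn p u * coordU p := by
  have hx := (smoothOn_fst Set.univ).diffAt isOpen_univ (Set.mem_univ p)
  have hy := (smoothOn_snd Set.univ).diffAt isOpen_univ (Set.mem_univ p)
  have e : coordV = fun p => -p.1 * p.2.2.sin + p.2.1 * p.2.2.cos := rfl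
  rw [e, dirDeriv_add (hx.neg.mul (diffAt_sin p)) (hy.mul (diffAt_cos p)),
    dirDeriv_mul hx.neg (diffAt_sin p), dirDeriv_mul hy (diffAt_cos p), dirDeriv_cos, dirDeriv_sin,
    dirDeriv_neg, dirDeriv_posFst, dirDeriv_posSnd, coAcross_apply, coTurn_apply, coordU]
  ring

/-- The translation part of the developing map, in the moving frame. -/
def shift (p : Pos) : Mat := coordU p • alongMat 1 + coordV p • acrossMat 1

/-- The matrix `A`, rotated to the moving frame. -/
def rotated (A : Mat) (p : Pos) : Mat := ((1 + p.2.2.cos) / 2) • A +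
  -- This is R⁻¹AR for R = exp(α turnMat), expanded by the half-angle formulas. R changes sign under
  -- α ↦ α + 2π, but the conjugation does not and descends to the circle.
  p.2.2.sin • (A * turnMat - turnMat * A) - (2 * (1 - p.2.2.cos)) • (turnMat * A * turnMat)

/-- The parallel section of the adjoint bundle that is defined by `A`. -/
def parallel (A : Mat) (p : Pos) : Mat := (1 - shift p) * rotated A p * (1 + shift p)

theorem smoothMat_shift (U : Set Pos) : SmoothMat U shift :=
  (SmoothMat.smul (smoothOn_coordU U) (smoothMat_const U _)).add
    (SmoothMat.smul (smoothOn_coordV U) (smoothMat_const U _))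

theorem smoothMat_rotated (A : Mat) (U : Set Pos) : SmoothMat U (rotated A) := by
  have hc := smoothOn_cos U
  have h1 := smoothOn_const U (1 : ℝ)
  have h2 := smoothOn_const U (2 : ℝ)
  exact ((SmoothMat.smul ((h1.add hc).div h2 (by simp)) (smoothMat_const U A)).add
    (SmoothMat.smul (smoothOn_sin U) (smoothMat_const U _))).sub
    (SmoothMat.smul (h2.mul (h1.sub hc)) (smoothMat_const U _))

theorem smoothMat_parallel (A : Mat) (U : Set Pos) : SmoothMat U (parallel A) :=
  (((smoothMat_const U 1).sub (smoothMat_shift U)).mul (smoothMat_rotated A U)).mul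
    ((smoothMat_const U 1).add (smoothMat_shift U))

theorem dMat_shift (p : Pos) (u : E3) : dMat shift p u =
    (coAlong p u + coTurn p u * coordV p) • alongMat 1 +
      (coAcross p u - coTurn p u * coordU p) • acrossMat 1 := by
  have hu := (smoothOn_coordU Set.univ).diffAt isOpen_univ (Set.mem_univ p)
  have hv := (smoothOn_coordV Set.univ).diffAt isOpen_univ (Set.mem_univ p)
  have hc : ∀ A : Mat, ∀ i j, DiffAt (fun _ : Pos => A i j) p := fun A i j =>
    differentiableAt_const _
  have e : shift = fun p => coordU p • alongMat 1 + coordV p • acrossMat 1 := rfl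
  rw [e, dMat_add (M := fun p => coordU p • alongMat 1) (N := fun p => coordV p • acrossMat 1)
    (fun i j => hu.mul (hc _ i j)) (fun i j => hv.mul (hc _ i j)),
    dMat_smul hu (hc _), dMat_smul hv (hc _), dMat_const, dMat_const, dirDeriv_coordU,
    dirDeriv_coordV, smul_zero, smul_zero, add_zero, add_zero]

theorem dMat_rotated (A : Mat) (p : Pos) (u : E3) : dMat (rotated A) p u =
    coTurn p u • (rotated A p * turnMat - turnMat * rotated A p) := by
  have hcos := diffAt_cos p
  have hsin := diffAt_sin p
  have hk : ∀ a : ℝ, DiffAt (fun _ : Pos => a) p := fun a => differentiableAt_const _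
  have hc : ∀ A : Mat, ∀ i j, DiffAt (fun _ : Pos => A i j) p := fun A i j => hk _
  have h1 : DiffAt (fun p : Pos => (1 + p.2.2.cos) / 2) p :=
    ((smoothOn_const Set.univ (1 : ℝ)).add (smoothOn_cos _)).div (smoothOn_const _ (2 : ℝ))
      (by simp) |>.diffAt isOpen_univ trivial
  have h2 : DiffAt (fun p : Pos => 2 * (1 - p.2.2.cos)) p :=
    (smoothOn_const Set.univ (2 : ℝ)).mul ((smoothOn_const _ (1 : ℝ)).sub (smoothOn_cos _))
      |>.diffAt isOpen_univ trivial
  have d1 : dirDeriv (fun p : Pos => (1 + p.2.2.cos) / 2) p u = -p.2.2.sin * u.2.2 / 2 := by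
    have e : (fun p : Pos => (1 + p.2.2.cos) / 2) = fun p => 1 / 2 + 1 / 2 * p.2.2.cos := by
      funext p; ring
    rw [e, dirDeriv_add (hk _) ((hk _).mul hcos), dirDeriv_mul (hk _) hcos]
    simp only [dirDeriv_const, dirDeriv_cos]
    ring
  have d2 : dirDeriv (fun p : Pos => 2 * (1 - p.2.2.cos)) p u = 2 * p.2.2.sin * u.2.2 := by
    rw [dirDeriv_mul (hk _) (DiffAt.sub (hk 1) hcos), dirDeriv_sub (hk 1) hcos]
    simp only [dirDeriv_const, dirDeriv_cos]
    ring
  have e : rotated A = fun p => ((1 + p.2.2.cos) / 2) • A +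
    p.2.2.sin • (A * turnMat - turnMat * A) - (2 * (1 - p.2.2.cos)) • (turnMat * A * turnMat) := rfl
  rw [e, dMat_sub (M := fun p : Pos => ((1 + p.2.2.cos) / 2) • A +
      p.2.2.sin • (A * turnMat - turnMat * A))
      (N := fun p : Pos => (2 * (1 - p.2.2.cos)) • (turnMat * A * turnMat))
      (fun i j => DiffAt.add (h1.mul (hc _ i j)) (hsin.mul (hc _ i j)))
      (fun i j => h2.mul (hc _ i j)),
    dMat_add (M := fun p : Pos => ((1 + p.2.2.cos) / 2) • A)
      (N := fun p : Pos => p.2.2.sin • (A * turnMat - turnMat * A)) (fun i j => h1.mul (hc _ i j))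
      (fun i j => hsin.mul (hc _ i j)),
    dMat_smul h1 (hc _), dMat_smul hsin (hc _), dMat_smul h2 (hc _), dMat_const, dMat_const,
    dMat_const, d1, d2, dirDeriv_sin, coTurn_apply]
  have hJ := mul_turnMat_turnMat
  have e1 : A * turnMat * turnMat = (-1 / 4 : ℝ) • A := by rw [mul_assoc, hJ, mul_smul_comm, mul_one]
  have e2 : turnMat * (turnMat * A) = (-1 / 4 : ℝ) • A := by
    rw [← mul_assoc, hJ, smul_mul_assoc, one_mul]
  have e3 : turnMat * A * turnMat * turnMat = (-1 / 4 : ℝ) • (turnMat * A) := by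
    rw [mul_assoc, hJ, mul_smul_comm, mul_one]
  have e4 : turnMat * (turnMat * A * turnMat) = (-1 / 4 : ℝ) • (A * turnMat) := by
    rw [← mul_assoc, e2, smul_mul_assoc]
  have e5 : turnMat * (A * turnMat) = turnMat * A * turnMat := (mul_assoc _ _ _).symm
  simp only [add_mul, mul_add, sub_mul, mul_sub, smul_mul_assoc, mul_smul_comm, e1, e2, e3, e4, e5]
  module

/-- The map G = exp(α turnMat)(1 + shift) satisfies G⁻¹ dG = `flatForm 1`, so the derivative of
G⁻¹AG is its commutator with the gauge form. The proof carries this out without G, which is only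
defined up to sign on `Pos`. -/
theorem dMat_parallel (A : Mat) (p : Pos) (u : E3) : dMat (parallel A) p u =
    parallel A p * flatForm 1 p u - flatForm 1 p u * parallel A p := by
  have hs := (smoothMat_shift Set.univ).diffAt isOpen_univ (Set.mem_univ p)
  have hr := (smoothMat_rotated A Set.univ).diffAt isOpen_univ (Set.mem_univ p)
  have hc : ∀ A : Mat, ∀ i j, DiffAt (fun _ : Pos => A i j) p := fun A i j =>
    differentiableAt_const _
  have hm : ∀ i j, DiffAt (fun q => (1 - shift q) i j) p := fun i j =>
    DiffAt.sub (hc _ i j) (hs i j)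
  have hp : ∀ i j, DiffAt (fun q => (1 + shift q) i j) p := fun i j =>
    DiffAt.add (hc _ i j) (hs i j)
  have hmr : ∀ i j, DiffAt (fun q => ((1 - shift q) * rotated A q) i j) p :=
    (((smoothMat_const Set.univ 1).sub (smoothMat_shift _)).mul
      (smoothMat_rotated A _)).diffAt isOpen_univ trivial
  have e : parallel A = fun p => (1 - shift p) * rotated A p * (1 + shift p) := rfl
  rw [e, dMat_mul hmr hp, dMat_mul hm hr, dMat_sub (hc 1) hs, dMat_add (hc 1) hs, dMat_const,
    dMat_rotated, zero_sub, zero_add]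
  -- The translation factor alone: moving the gauge form across 1 + shift leaves the rotation term,
  -- which is absorbed by the derivative of `rotated`, and the derivative of the shift.
  have h1 : (1 + shift p) * flatForm 1 p u =
      coTurn p u • (turnMat * (1 + shift p)) + dMat shift p u := by
    rw [dMat_shift, shift, flatForm_eq]
    simp only [add_mul, mul_add, smul_mul_assoc, mul_smul_comm, mul_alongMat_alongMat,
      mul_alongMat_acrossMat, mul_acrossMat_alongMat, mul_acrossMat_acrossMat,
      mul_alongMat_turnMat, mul_acrossMat_turnMat, one_mul, mul_one]
    module
  have h2 : flatForm 1 p u * (1 - shift p) =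
      coTurn p u • ((1 - shift p) * turnMat) + dMat shift p u := by
    rw [dMat_shift, shift, flatForm_eq]
    simp only [add_mul, mul_add, sub_mul, mul_sub, smul_mul_assoc, mul_smul_comm,
      mul_alongMat_alongMat,
      mul_alongMat_acrossMat, mul_acrossMat_alongMat, mul_acrossMat_acrossMat,
      mul_alongMat_turnMat, mul_acrossMat_turnMat, one_mul, mul_one]
    module
  have h3 : (1 - shift p) * rotated A p * (1 + shift p) * flatForm 1 p u =
      (1 - shift p) * rotated A p * ((1 + shift p) * flatForm 1 p u) := mul_assoc _ _ _
  have h4 : flatForm 1 p u * ((1 - shift p) * rotated A p * (1 + shift p)) =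
      (flatForm 1 p u * (1 - shift p)) * (rotated A p * (1 + shift p)) := by
    simp only [mul_assoc]
  simp only [h3, h4, h1, h2]
  simp only [add_mul, mul_add, sub_mul, mul_sub, smul_mul_assoc, mul_smul_comm, one_mul, mul_one,
    smul_add, smul_sub, mul_assoc, neg_mul]
  abel

/-- At a single point the developing map exists, by choosing a half-angle. Consequently A ↦
`parallel A p` is an automorphism of the matrix algebra that preserves sp(2,ℝ). -/
theorem exists_parallel_eq_conj (p : Pos) : ∃ G Gi : Mat, G * Gi = 1 ∧ Gi * G = 1 ∧
    (∀ A, parallel A p = Gi * A * G) ∧ (∀ A ∈ sp4, Gi * A * G ∈ sp4) ∧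
      ∀ A ∈ sp4, G * A * Gi ∈ sp4 := by
  set C := Real.cos (p.2.2.toReal / 2) with hC
  set S := Real.sin (p.2.2.toReal / 2) with hS
  have hCS : C ^ 2 + S ^ 2 = 1 := Real.cos_sq_add_sin_sq _
  have hcos : p.2.2.cos = C ^ 2 - S ^ 2 := by
    rw [← Real.Angle.cos_toReal, show p.2.2.toReal = 2 * (p.2.2.toReal / 2) by ring, Real.cos_two_mul']
  have hsin : p.2.2.sin = 2 * S * C := by
    rw [← Real.Angle.sin_toReal, show p.2.2.toReal = 2 * (p.2.2.toReal / 2) by ring, Real.sin_two_mul]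
  have hz : shift p * shift p = 0 := by
    rw [shift]
    simp only [add_mul, mul_add, smul_mul_assoc, mul_smul_comm, mul_alongMat_alongMat,
      mul_alongMat_acrossMat, mul_acrossMat_alongMat, mul_acrossMat_acrossMat, smul_zero, add_zero]
  have hzmem : shift p ∈ sp4 :=
    add_mem (SMulMemClass.smul_mem _ (spMat_mem ..)) (SMulMemClass.smul_mem _ (spMat_mem ..))
  set Z := shift p with hZ
  set R : Mat := C • 1 + (2 * S) • turnMat with hR
  set Ri : Mat := C • 1 - (2 * S) • turnMat with hRi
  have hRR : R * Ri = 1 := by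
    rw [hR, hRi]
    simp only [add_mul, mul_sub, smul_mul_assoc, mul_smul_comm, mul_turnMat_turnMat, one_mul,
      mul_one, smul_smul]
    have h : (1 : ℝ) • (1 : Mat) = (C ^ 2 + S ^ 2) • (1 : Mat) := by rw [hCS]
    rw [one_smul] at h
    conv_rhs => rw [h]
    module
  have h1 : R * (1 + Z) * ((1 - Z) * Ri) = 1 := by
    have : (1 + Z) * (1 - Z) = 1 := by rw [add_mul, mul_sub, mul_sub, hz]; simp
    rw [mul_assoc, ← mul_assoc (1 + Z), this, one_mul, hRR]
  have hsymp : R * (1 + Z) ∈ Matrix.symplecticGroup (Fin 2) ℝ := by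
    have hJ : turnMat ∈ sp4 := spMat_mem ..
    rw [mem_sp4_iff] at hJ hzmem
    apply mul_mem
    · rw [SymplecticGroup.mem_iff', hR, Matrix.transpose_add, Matrix.transpose_smul,
        Matrix.transpose_smul, Matrix.transpose_one]
      simp only [add_mul, mul_add, smul_mul_assoc, mul_smul_comm, one_mul, mul_one, hJ, neg_mul,
        mul_assoc, mul_turnMat_turnMat]
      have h : (1 : ℝ) • Matrix.J (Fin 2) ℝ = (C ^ 2 + S ^ 2) • Matrix.J (Fin 2) ℝ := by rw [hCS]
      rw [one_smul] at h
      conv_rhs => rw [h]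
      module
    · rw [SymplecticGroup.mem_iff', Matrix.transpose_add, Matrix.transpose_one]
      simp only [add_mul, mul_add, one_mul, mul_one, hzmem, neg_mul, mul_assoc, hz, mul_zero]
      abel
  have hinv : (R * (1 + Z))⁻¹ = (1 - Z) * Ri := Matrix.inv_eq_right_inv h1
  refine ⟨R * (1 + Z), (1 - Z) * Ri, h1, mul_eq_one_comm.1 h1, fun A => ?_, fun A hA => ?_,
    fun A hA => ?_⟩
  · have h2 : rotated A p = Ri * A * R := by
      have h5 : (1 + (C ^ 2 - S ^ 2)) / 2 = C ^ 2 := by linarith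
      have h6 : 2 * (1 - (C ^ 2 - S ^ 2)) = 4 * S ^ 2 := by linarith
      rw [rotated, hcos, hsin, h5, h6, hR, hRi]
      simp only [mul_add, sub_mul, smul_mul_assoc, mul_smul_comm, one_mul, mul_one]
      module
    rw [parallel, h2]
    simp only [mul_assoc, ← hZ]
  · have h7 := conj_mem_sp4 hsymp hA
    rwa [hinv] at h7
  · have hsymp' : (1 - Z) * Ri ∈ Matrix.symplecticGroup (Fin 2) ℝ := by
      rw [← hinv, inv_eq_sympInv hsymp]
      exact SymplecticGroup.neg_mem (mul_mem (mul_mem (SymplecticGroup.J_mem _ _)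
        (SymplecticGroup.transpose_mem hsymp)) (SymplecticGroup.J_mem _ _))
    have h7 := conj_mem_sp4 hsymp' hA
    rwa [Matrix.inv_eq_left_inv h1] at h7

/-! ## The infinitesimal symmetries defined by `sp(2,ℝ)` -/

theorem parallel_mem {A : Mat} (hA : A ∈ sp4) (p : Pos) : parallel A p ∈ sp4 := by
  obtain ⟨G, Gi, -, -, h, hmem, -⟩ := exists_parallel_eq_conj p
  rw [h]; exact hmem A hA

theorem parallel_add (A B : Mat) (p : Pos) : parallel (A + B) p = parallel A p + parallel B p := by
  obtain ⟨G, Gi, -, -, h, -⟩ := exists_parallel_eq_conj p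
  simp only [h, mul_add, add_mul]

theorem parallel_smul (a : ℝ) (A : Mat) (p : Pos) : parallel (a • A) p = a • parallel A p := by
  obtain ⟨G, Gi, -, -, h, -⟩ := exists_parallel_eq_conj p
  simp only [h, mul_smul_comm, smul_mul_assoc]

theorem parallel_lie (A B : Mat) (p : Pos) : parallel ⁅A, B⁆ p = ⁅parallel A p, parallel B p⁆ := by
  obtain ⟨G, Gi, hG, -, h, -⟩ := exists_parallel_eq_conj p
  have key : ∀ A B : Mat, Gi * A * G * (Gi * B * G) = Gi * (A * B) * G := fun A B => by
    rw [show Gi * A * G * (Gi * B * G) = Gi * A * (G * Gi) * B * G by simp only [mul_assoc], hG,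
      mul_one]
    simp only [mul_assoc]
  rw [h, h, h, mat_lie, mat_lie, key, key, mul_sub, sub_mul]

theorem parallel_eq_zero {A : Mat} {p : Pos} (hA : parallel A p = 0) : A = 0 := by
  obtain ⟨G, Gi, hG, -, h, -⟩ := exists_parallel_eq_conj p
  rw [h] at hA
  calc A = (G * Gi) * A * (G * Gi) := by rw [hG, one_mul, mul_one]
    _ = G * (Gi * A * G) * Gi := by simp only [mul_assoc]
    _ = 0 := by rw [hA, mul_zero, zero_mul]

/-- The entries of the derivative of a parallel section. -/
theorem parallel_entries {Ψ : Pos → Mat} {p : Pos} {u : E3} (hmem : Ψ p ∈ sp4)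
    (hd : dMat Ψ p u = Ψ p * flatForm 1 p u - flatForm 1 p u * Ψ p) :
    dirDeriv (fun q => Ψ q f₁ e₁) p u = 2 * Ψ p e₂ e₁ * coAlong p u + Ψ p f₂ e₁ * coTurn p u
      - 2 * Ψ p e₁ e₁ * coAcross p u ∧
    dirDeriv (fun q => Ψ q e₂ e₁) p u = - Ψ p e₂ f₂ * coAlong p u
      + (Ψ p e₂ e₂ - Ψ p e₁ e₁) / 2 * coTurn p u + Ψ p e₁ f₂ * coAcross p u ∧
    dirDeriv (fun q => Ψ q f₂ e₁) p u = (Ψ p e₁ e₁ + Ψ p e₂ e₂) * coAlong p u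
      + (Ψ p f₂ e₂ - Ψ p f₁ e₁) / 2 * coTurn p u + (Ψ p e₂ e₁ - Ψ p e₁ e₂) * coAcross p u ∧
    dirDeriv (fun q => Ψ q e₁ e₁) p u = - Ψ p e₁ f₂ * coAlong p u
      + (Ψ p e₁ e₂ + Ψ p e₂ e₁) / 2 * coTurn p u + Ψ p e₁ f₁ * coAcross p u ∧
    dirDeriv (fun q => Ψ q e₂ e₂) p u = - Ψ p e₁ f₂ * coAlong p u
      - (Ψ p e₁ e₂ + Ψ p e₂ e₁) / 2 * coTurn p u - Ψ p e₂ f₂ * coAcross p u ∧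
    dirDeriv (fun q => Ψ q e₂ f₂) p u = - Ψ p e₁ f₂ * coTurn p u ∧
    dirDeriv (fun q => Ψ q f₂ e₂) p u = 2 * Ψ p e₁ e₂ * coAlong p u - Ψ p f₂ e₁ * coTurn p u
      + 2 * Ψ p e₂ e₂ * coAcross p u ∧
    dirDeriv (fun q => Ψ q e₁ e₂) p u = - Ψ p e₁ f₁ * coAlong p u
      + (Ψ p e₂ e₂ - Ψ p e₁ e₁) / 2 * coTurn p u - Ψ p e₁ f₂ * coAcross p u ∧
    dirDeriv (fun q => Ψ q e₁ f₂) p u = (Ψ p e₂ f₂ - Ψ p e₁ f₁) / 2 * coTurn p u ∧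
    dirDeriv (fun q => Ψ q e₁ f₁) p u = Ψ p e₁ f₂ * coTurn p u := by
  obtain ⟨h1, h2, h3, h4, h5, h6⟩ := sp4_entries hmem
  have h : ∀ i j, dirDeriv (fun q => Ψ q i j) p u =
      (Ψ p * flatForm 1 p u - flatForm 1 p u * Ψ p) i j := fun i j => by rw [← hd]; rfl
  simp only [h, flatForm_apply, Matrix.sub_apply, mat_mul_apply, spMat]
  simp [h1, h2, h3, h4, h5, h6]
  refine ⟨?_, ?_, ?_, ?_, ?_, ?_, ?_, ?_, ?_, ?_⟩ <;> ring

/-- The vector field defined by an element of `sp(2,ℝ)`. -/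
def symmetryField : sp4 →ₗ[ℝ] (Pos → E3) where
  -- The field S is determined by `flatForm 1`(S) ≡ -`parallel A` modulo 𝔭. The minus sign makes the
  -- map a homomorphism rather than an anti-homomorphism of Lie algebras.
  toFun A p := parallel A.1 p f₂ e₁ • along p + (-(2 * parallel A.1 p e₂ e₁)) • turn p +
    (- parallel A.1 p f₁ e₁) • across p
  map_add' A B := by
    funext p
    change parallel (A.1 + B.1) p f₂ e₁ • along p + (-(2 * parallel (A.1 + B.1) p e₂ e₁)) • turn p +
      (- parallel (A.1 + B.1) p f₁ e₁) • across p = _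
    simp only [parallel_add, Matrix.add_apply, Pi.add_apply]
    module
  map_smul' a A := by
    funext p
    change parallel (a • A.1) p f₂ e₁ • along p + (-(2 * parallel (a • A.1) p e₂ e₁)) • turn p +
      (- parallel (a • A.1) p f₁ e₁) • across p = _
    simp only [parallel_smul, Matrix.smul_apply, Pi.smul_apply, smul_eq_mul, RingHom.id_apply]
    module

section SymmetryField

variable (A B : sp4) (p : Pos)

theorem coAlong_symmetryField : coAlong p (symmetryField A p) = parallel A.1 p f₂ e₁ := by
  simp [symmetryField]
theorem coTurn_symmetryField : coTurn p (symmetryField A p) = -(2 * parallel A.1 p e₂ e₁) := by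
  simp [symmetryField]
theorem coAcross_symmetryField : coAcross p (symmetryField A p) = -parallel A.1 p f₁ e₁ := by
  simp [symmetryField]

theorem smoothOn_symmetryField (U : Set Pos) : SmoothOn U (symmetryField A) := by
  have h := smoothMat_parallel A.1 U
  exact (((h f₂ e₁).smul (smoothOn_along U)).add
    ((((smoothOn_const U (2 : ℝ)).mul (h e₂ e₁)).neg).smul (smoothOn_turn U))).add
    ((h f₁ e₁).neg.smul (smoothOn_across U))

theorem dirDeriv_two_mul {f : Pos → ℝ} {p : Pos} (hf : DiffAt f p) (u : E3) :
    dirDeriv (fun q => -(2 * f q)) p u = -(2 * dirDeriv f p u) := by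
  have hk : DiffAt (fun _ : Pos => (2 : ℝ)) p := differentiableAt_const _
  rw [dirDeriv_neg, dirDeriv_mul hk hf, dirDeriv_const]
  ring

/-- Parallel sections commute with the pointwise bracket, and `parallel_entries` turns the
derivatives occurring in the bracket of fields into entries. What remains is the negative part of
the matrix commutator. -/
theorem symmetryField_lie : symmetryField ⁅A, B⁆ = bracket (symmetryField A) (symmetryField B) := by
  funext p
  have hA := (smoothOn_symmetryField A Set.univ).diffAt isOpen_univ (Set.mem_univ p)
  have hB := (smoothOn_symmetryField B Set.univ).diffAt isOpen_univ (Set.mem_univ p)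
  have dA := (smoothMat_parallel A.1 Set.univ).diffAt isOpen_univ (Set.mem_univ p)
  have dB := (smoothMat_parallel B.1 Set.univ).diffAt isOpen_univ (Set.mem_univ p)
  obtain ⟨a1, a2, a3, -⟩ := parallel_entries (parallel_mem A.2 p) (dMat_parallel A.1 p (symmetryField B p))
  obtain ⟨b1, b2, b3, -⟩ := parallel_entries (parallel_mem B.2 p) (dMat_parallel B.1 p (symmetryField A p))
  obtain ⟨g1, g2, g3, g4, g5, g6⟩ := sp4_entries (parallel_mem A.2 p)
  obtain ⟨k1, k2, k3, k4, k5, k6⟩ := sp4_entries (parallel_mem B.2 p)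
  apply frame_ext (p := p)
  · rw [coAlong_bracket hA hB]
    simp only [coAlong_symmetryField, coTurn_symmetryField, coAcross_symmetryField] at *
    rw [a3, b3, LieSubalgebra.coe_bracket, parallel_lie, mat_lie_apply, g2, g4, k2, k4]
    ring
  · rw [coTurn_bracket hA hB]
    simp only [coAlong_symmetryField, coTurn_symmetryField, coAcross_symmetryField] at *
    rw [dirDeriv_two_mul (dA _ _), dirDeriv_two_mul (dB _ _), a2, b2, LieSubalgebra.coe_bracket,
      parallel_lie, mat_lie_apply, g6, k6]
    ring
  · rw [coAcross_bracket hA hB]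
    simp only [coAlong_symmetryField, coTurn_symmetryField, coAcross_symmetryField] at *
    rw [dirDeriv_neg, dirDeriv_neg, a1, b1, LieSubalgebra.coe_bracket,
      parallel_lie, mat_lie_apply, g1, g3, g5, k1, k3, k5]
    ring

end SymmetryField

theorem SmoothOn.bracket {U : Set Pos} (hU : IsOpen U) {V W : Pos → E3} (hV : SmoothOn U V)
    (hW : SmoothOn U W) : SmoothOn U (bracket V W) :=
  ((hW.dirDeriv hU hV).sub (hV.dirDeriv hU hW)).congr fun p _ => bracket_eq V W p

theorem SmoothOn.connection_cov {U : Set Pos} (hU : IsOpen U) (nabla : Connection)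
    {V W : Pos → E3} (hV : SmoothOn U V) (hW : SmoothOn U W) : SmoothOn U (nabla.cov V W) := by
  let b : Fin 3 → E3 := ![(1, 0, 0), (0, 1, 0), (0, 0, 1)]
  let κ : Fin 3 → E3 → ℝ := ![fun v => v.1, fun v => v.2.1, fun v => v.2.2]
  have hb : ∀ v : E3, v = ∑ i, κ i v • b i := fun v => by
    simp [Fin.sum_univ_three, b, κ]
  have hκ : ∀ {V : Pos → E3}, SmoothOn U V → ∀ i, SmoothOn U fun p => κ i (V p) := by
    intro V hV i
    fin_cases i
    · exact hV.fst
    · exact hV.snd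
    · exact hV.thd
  refine (hW.dirDeriv hU hV).add ?_
  have h : ∀ p, nabla.Γ p (V p) (W p) =
      ∑ i, ∑ j, (κ i (V p) * κ j (W p)) • nabla.Γ p (b i) (b j) := fun p => by
    conv_lhs => rw [hb (V p), hb (W p)]
    simp only [map_sum, map_smul, LinearMap.sum_apply, LinearMap.smul_apply, Finset.smul_sum,
      smul_smul]
    rw [Finset.sum_comm]
    exact Finset.sum_congr rfl fun i _ => Finset.sum_congr rfl fun j _ => by rw [mul_comm]
  exact SmoothOn.congr (SmoothOn.sum fun i _ => SmoothOn.sum fun j _ =>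
    ((hκ hV i).mul (hκ hW j)).smul ((nabla.smooth (b i) (b j)).mono (Set.subset_univ U)))
    fun p _ => h p

/-- The covariant derivative of fields tangent to the contact distribution. -/
theorem carConnection_cov {X Y : Pos → E3} {p : Pos} (hY : DiffAt Y p)
    (hY0 : ∀ q, coAcross q (Y q) = 0) :
    coAlong p (carConnection.cov X Y p) = dirDeriv (fun q => coAlong q (Y q)) p (X p) ∧
    coTurn p (carConnection.cov X Y p) = dirDeriv (fun q => coTurn q (Y q)) p (X p) ∧
    coAcross p (carConnection.cov X Y p) =
      (coTurn p (X p) * coAlong p (Y p) - coAlong p (X p) * coTurn p (Y p)) / 2 := by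
  simp only [Connection.cov, carConnection_Γ, map_add, map_smul, coAlong_across, coTurn_across,
    coAcross_across, coAlong_dirDeriv hY, coTurn_dirDeriv hY, coAcross_dirDeriv hY, hY0,
    dirDeriv_const, smul_eq_mul]
  refine ⟨by ring, by ring, by ring⟩

/-- The contact part is the first row of `parallel_entries`. For the geodesics, the bracket with S
acts on the contact components of X as a derivation plus a linear map, whose coefficients are
entries of the parallel section. Their derivatives are again entries, and the Lie derivative of the
connection reduces to a multiple of X. -/
theorem isInfinitesimalSymmetry_symmetryField {ℓ : ℝ} (hℓ : 0 < ℓ) (A : sp4) :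
    IsInfinitesimalSymmetry (inducedDistribution (gas ℓ)) (inducedCurves (gas ℓ)) Set.univ
      (symmetryField A) := by
  have hS := smoothOn_symmetryField A Set.univ
  have hpar := smoothMat_parallel A.1 Set.univ
  have hdp := fun p => hpar.diffAt isOpen_univ (Set.mem_univ p)
  have hcontact : ∀ X, SmoothOn Set.univ X → (∀ p, coAcross p (X p) = 0) →
      ∀ p, coAcross p (bracket (symmetryField A) X p) = 0 := fun X hX hX0 p => by
    rw [coAcross_bracket (hS.diffAt isOpen_univ trivial) (hX.diffAt isOpen_univ trivial)]
    simp only [hX0, dirDeriv_const, coAcross_symmetryField, coTurn_symmetryField,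
      coAlong_symmetryField]
    rw [dirDeriv_neg, (parallel_entries (parallel_mem A.2 p) (dMat_parallel A.1 p (X p))).1, hX0]
    ring
  refine ⟨hS, fun X hX hXC p _ => ?_, carConnection, fun K hK => isGeodesic_carConnection hℓ hK,
    fun X hX hXC p _ => ?_⟩
  · rw [inducedDistribution_gas hℓ, LinearMap.mem_ker]
    refine hcontact X hX (fun p => ?_) p
    have := hXC p trivial
    rwa [inducedDistribution_gas hℓ, LinearMap.mem_ker] at this
  have hX0 : ∀ p, coAcross p (X p) = 0 := fun p => by
    have := hXC p trivial
    rwa [inducedDistribution_gas hℓ, LinearMap.mem_ker] at this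
  set S := symmetryField A with hSdef
  set N := carConnection.cov X X with hN
  set Y := bracket S X with hY
  have sY : SmoothOn Set.univ Y := hS.bracket isOpen_univ hX
  have sN : SmoothOn Set.univ N := SmoothOn.connection_cov isOpen_univ carConnection hX hX
  have dS : ∀ q, DiffAt S q := fun q => hS.diffAt isOpen_univ trivial
  have dX : ∀ q, DiffAt X q := fun q => hX.diffAt isOpen_univ trivial
  have dN : ∀ q, DiffAt N q := fun q => sN.diffAt isOpen_univ trivial
  have dY : ∀ q, DiffAt Y q := fun q => sY.diffAt isOpen_univ trivial
  have hY0 : ∀ q, coAcross q (Y q) = 0 := hcontact X hX hX0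
  have hNc := fun q => carConnection_cov (X := X) (dX q) hX0
  have hN0 : ∀ q, coAcross q (N q) = 0 := fun q => by rw [(hNc q).2.2]; ring
  obtain ⟨y1, y2, y3⟩ := carConnection_cov (X := Y) (dX p) hX0
  obtain ⟨x1, x2, x3⟩ := carConnection_cov (X := X) (dY p) hY0
  have sa := hX.coAlong
  have sb := hX.coTurn
  have da : ∀ q, DiffAt (fun q => coAlong q (X q)) q := fun q => sa.diffAt isOpen_univ trivial
  have db : ∀ q, DiffAt (fun q => coTurn q (X q)) q := fun q => sb.diffAt isOpen_univ trivial
  have e1 : (fun q => coAlong q (N q)) =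
      fun q => dirDeriv (fun q => coAlong q (X q)) q (X q) := funext fun q => (hNc q).1
  have e2 : (fun q => coTurn q (N q)) =
      fun q => dirDeriv (fun q => coTurn q (X q)) q (X q) := funext fun q => (hNc q).2.1
  have c1 : ∀ q, coAlong q (Y q) = dirDeriv (fun q => coAlong q (X q)) q (S q) -
      ((parallel A.1 q e₁ e₁ + parallel A.1 q e₂ e₂) * coAlong q (X q) +
        (parallel A.1 q f₂ e₂ + parallel A.1 q f₁ e₁) / 2 * coTurn q (X q)) := fun q => by
    rw [hY, coAlong_bracket (dS q) (dX q)]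
    simp only [hSdef, coAlong_symmetryField, coAcross_symmetryField, coTurn_symmetryField]
    rw [(parallel_entries (parallel_mem A.2 q) (dMat_parallel A.1 q (X q))).2.2.1, hX0]
    ring
  have c2 : ∀ q, coTurn q (Y q) = dirDeriv (fun q => coTurn q (X q)) q (S q) -
      (2 * parallel A.1 q e₂ f₂ * coAlong q (X q) +
        (parallel A.1 q e₁ e₁ - parallel A.1 q e₂ e₂) * coTurn q (X q)) := fun q => by
    rw [hY, coTurn_bracket (dS q) (dX q)]
    simp only [hSdef, coTurn_symmetryField]
    rw [dirDeriv_two_mul (hdp q _ _), (parallel_entries (parallel_mem A.2 q) (dMat_parallel A.1 q (X q))).2.1, hX0]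
    ring
  -- These identities cancel the second derivatives of the components of X.
  have k1 := dirDeriv_bracket isOpen_univ sa hS hX (Set.mem_univ p)
  have k2 := dirDeriv_bracket isOpen_univ sb hS hX (Set.mem_univ p)
  have ddS : ∀ {f : Pos → ℝ}, SmoothOn Set.univ f →
      DiffAt (fun q => dirDeriv f q (S q)) p := fun hf =>
    (hf.dirDeriv isOpen_univ hS).diffAt isOpen_univ trivial
  have hk : ∀ a : ℝ, DiffAt (fun _ : Pos => a) p := fun a => differentiableAt_const _
  obtain ⟨t1, t2, t3, t4, t5, t6, t7, t8, t9, t10⟩ := parallel_entries (parallel_mem A.2 p) (dMat_parallel A.1 p (X p))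
  obtain ⟨-, n2, n3, -⟩ := parallel_entries (parallel_mem A.2 p) (dMat_parallel A.1 p (N p))
  have z1 : dirDeriv (fun q => coAlong q (Y q)) p (X p) =
      dirDeriv (fun q => dirDeriv (fun q => coAlong q (X q)) q (S q)) p (X p) -
      ((parallel A.1 p e₁ e₁ + parallel A.1 p e₂ e₂) *
          dirDeriv (fun q => coAlong q (X q)) p (X p) +
        coAlong p (X p) * (dirDeriv (fun q => parallel A.1 q e₁ e₁) p (X p) +
          dirDeriv (fun q => parallel A.1 q e₂ e₂) p (X p)) +
        ((parallel A.1 p f₂ e₂ + parallel A.1 p f₁ e₁) / 2 *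
          dirDeriv (fun q => coTurn q (X q)) p (X p) +
        coTurn p (X p) * ((dirDeriv (fun q => parallel A.1 q f₂ e₂) p (X p) +
          dirDeriv (fun q => parallel A.1 q f₁ e₁) p (X p)) / 2))) := by
    have e : (fun q => (parallel A.1 q f₂ e₂ + parallel A.1 q f₁ e₁) / 2) =
        fun q => 1 / 2 * (parallel A.1 q f₂ e₂ + parallel A.1 q f₁ e₁) := by funext q; ring
    have d4 : DiffAt (fun q => (parallel A.1 q f₂ e₂ + parallel A.1 q f₁ e₁) / 2) p := by
      rw [e]; exact (hk _).mul ((hdp p _ _).add (hdp p _ _))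
    simp only [c1]
    rw [dirDeriv_sub (ddS sa) (((DiffAt.add (hdp p _ _) (hdp p _ _)).mul (da p)).add
      (d4.mul (db p))), dirDeriv_add ((DiffAt.add (hdp p _ _) (hdp p _ _)).mul (da p))
      (d4.mul (db p)), dirDeriv_mul ((hdp p _ _).add (hdp p _ _)) (da p), dirDeriv_mul d4 (db p),
      dirDeriv_add (hdp p _ _) (hdp p _ _), e, dirDeriv_mul (hk _) ((hdp p _ _).add (hdp p _ _)),
      dirDeriv_add (hdp p _ _) (hdp p _ _), dirDeriv_const]
    ring
  have z2 : dirDeriv (fun q => coTurn q (Y q)) p (X p) =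
      dirDeriv (fun q => dirDeriv (fun q => coTurn q (X q)) q (S q)) p (X p) -
      (2 * (parallel A.1 p e₂ f₂ * dirDeriv (fun q => coAlong q (X q)) p (X p) +
        coAlong p (X p) * dirDeriv (fun q => parallel A.1 q e₂ f₂) p (X p)) +
        ((parallel A.1 p e₁ e₁ - parallel A.1 p e₂ e₂) *
          dirDeriv (fun q => coTurn q (X q)) p (X p) +
        coTurn p (X p) * (dirDeriv (fun q => parallel A.1 q e₁ e₁) p (X p) -
          dirDeriv (fun q => parallel A.1 q e₂ e₂) p (X p)))) := by
    simp only [c2]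
    rw [dirDeriv_sub (ddS sb) ((((hk 2).mul (hdp p _ _)).mul (da p)).add
      ((DiffAt.sub (hdp p _ _) (hdp p _ _)).mul (db p))),
      dirDeriv_add (((hk 2).mul (hdp p _ _)).mul (da p))
        ((DiffAt.sub (hdp p _ _) (hdp p _ _)).mul (db p)),
      dirDeriv_mul ((hk 2).mul (hdp p _ _)) (da p), dirDeriv_mul (hk 2) (hdp p _ _),
      dirDeriv_mul ((hdp p _ _).sub (hdp p _ _)) (db p),
      dirDeriv_sub (hdp p _ _) (hdp p _ _), dirDeriv_const]
    ring
  -- The factor is linear in X: the flow of S changes the connection on contact directions by a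
  -- projective change with this 1-form.
  refine Submodule.mem_span_singleton.2 ⟨(parallel A.1 p e₁ e₂ + parallel A.1 p e₂ e₁) * coTurn p (X p) -
    2 * parallel A.1 p e₁ f₂ * coAlong p (X p), ?_⟩
  rw [lieConnection, ← hN, ← hY]
  apply frame_ext (p := p)
  · rw [map_sub, map_sub, y1, x1, coAlong_bracket (dS p) (dN p), e1, hN0, z1, t4, t5, t7, t1,
      map_smul, smul_eq_mul]
    simp only [hSdef, coAlong_symmetryField, coAcross_symmetryField]
    rw [n3, hX0, hN0, (hNc p).1, (hNc p).2.1]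
    simp only [hY, hSdef] at k1 ⊢
    linear_combination k1
  · rw [map_sub, map_sub, y2, x2, coTurn_bracket (dS p) (dN p), e2, z2, t4, t5, t6,
      map_smul, smul_eq_mul]
    simp only [hSdef, coTurn_symmetryField]
    rw [dirDeriv_two_mul (hdp p _ _), n2, hX0, hN0, (hNc p).1, (hNc p).2.1]
    simp only [hY, hSdef] at k2 ⊢
    linear_combination k2
  · rw [map_sub, map_sub, y3, x3, hcontact N sN hN0, map_smul, hX0]
    simp only [smul_zero]
    ring

/-! ## Derivatives along curves -/

section AlongCurve

variable {U : Set Pos} {c : ℝ → E3} {t : ℝ}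

theorem hasDerivAt_comp_cov {f : Pos → ℝ} (hU : IsOpen U) (hf : SmoothOn U f) {v : E3}
    (hc : HasDerivAt c v t) (ht : (Coords.cov (c t) : Pos) ∈ U) :
    HasDerivAt (fun s => f (Coords.cov (c s))) (dirDeriv f (Coords.cov (c t)) v) t := by
  rw [dirDeriv_cov]
  exact ((hf.contDiffAt hU ht).differentiableAt (by simp)).hasFDerivAt.comp_hasDerivAt t hc

theorem form_eq_sum (lam : Form ℝ) (p : Pos) (u : E3) : lam p u =
    u.1 * lam p (1, 0, 0) + u.2.1 * lam p (0, 1, 0) + u.2.2 * lam p (0, 0, 1) := by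
  have : u = u.1 • ((1, 0, 0) : E3) + u.2.1 • ((0, 1, 0) : E3) + u.2.2 • ((0, 0, 1) : E3) := by
    simp
  conv_lhs => rw [this]
  simp only [map_add, map_smul, smul_eq_mul]

/-- The derivative of the value of a form on the velocity of a curve. -/
theorem hasDerivAt_form (hU : IsOpen U) {lam : Form ℝ} (hlam : SmoothForm U lam)
    (hc : ContDiff ℝ ∞ c) (ht : (Coords.cov (c t) : Pos) ∈ U) :
    HasDerivAt (fun s => lam (Coords.cov (c s)) (deriv c s))
      (dirDeriv (fun q => lam q (deriv c t)) (Coords.cov (c t)) (deriv c t) +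
        lam (Coords.cov (c t)) (deriv (deriv c) t)) t := by
  have h1 : HasDerivAt c (deriv c t) t := ((hc.differentiable (by simp)) t).hasDerivAt
  have h2 : HasDerivAt (deriv c) (deriv (deriv c) t) t :=
    ((((contDiff_infty_iff_deriv (𝕜 := ℝ)).1 hc).2.differentiable (by simp)) t).hasDerivAt
  have x1 : HasDerivAt (fun s => (deriv c s).1) (deriv (deriv c) t).1 t :=
    (ContinuousLinearMap.fst ℝ ℝ (ℝ × ℝ)).hasFDerivAt.comp_hasDerivAt t h2
  have x2 : HasDerivAt (fun s => (deriv c s).2.1) (deriv (deriv c) t).2.1 t :=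
    ((ContinuousLinearMap.fst ℝ ℝ ℝ).comp
      (ContinuousLinearMap.snd ℝ ℝ (ℝ × ℝ))).hasFDerivAt.comp_hasDerivAt t h2
  have x3 : HasDerivAt (fun s => (deriv c s).2.2) (deriv (deriv c) t).2.2 t :=
    ((ContinuousLinearMap.snd ℝ ℝ ℝ).comp
      (ContinuousLinearMap.snd ℝ ℝ (ℝ × ℝ))).hasFDerivAt.comp_hasDerivAt t h2
  have y := fun u => hasDerivAt_comp_cov hU (hlam u) h1 ht
  have e : (fun s => lam (Coords.cov (c s)) (deriv c s)) = fun s =>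
      (deriv c s).1 * lam (Coords.cov (c s)) (1, 0, 0) +
      (deriv c s).2.1 * lam (Coords.cov (c s)) (0, 1, 0) +
      (deriv c s).2.2 * lam (Coords.cov (c s)) (0, 0, 1) := funext fun s => form_eq_sum _ _ _
  rw [e]
  refine (((x1.mul (y _)).add (x2.mul (y _))).add (x3.mul (y _))).congr_deriv ?_
  have d := fun u => (hlam u).diffAt hU ht
  have hk : ∀ a : ℝ, DiffAt (fun _ : Pos => a) (Coords.cov (c t)) := fun a =>
    differentiableAt_const _
  have e2 : (fun q => lam q (deriv c t)) = fun q =>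
      (deriv c t).1 * lam q (1, 0, 0) + (deriv c t).2.1 * lam q (0, 1, 0) +
      (deriv c t).2.2 * lam q (0, 0, 1) := funext fun q => form_eq_sum _ _ _
  rw [e2, dirDeriv_add (DiffAt.add ((hk _).mul (d _)) ((hk _).mul (d _))) ((hk _).mul (d _)),
    dirDeriv_add ((hk _).mul (d _)) ((hk _).mul (d _)), dirDeriv_mul (hk _) (d _),
    dirDeriv_mul (hk _) (d _), dirDeriv_mul (hk _) (d _),
    form_eq_sum lam _ (deriv (deriv c) t)]
  simp only [dirDeriv_const]
  ring

/-- The acceleration of a parametrisation of a curve of the family. -/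
theorem acceleration_of_parametrizes {a b : ℝ} (h : a ≠ 0 ∨ b ≠ 0) {p : Pos}
    (hc : Parametrizes c (carCurve a b p)) (t : ℝ) :
    a * coTurn (Coords.cov (c t)) (deriv (deriv c) t) =
        b * coAlong (Coords.cov (c t)) (deriv (deriv c) t) ∧
      coAcross (Coords.cov (c t)) (deriv (deriv c) t) =
        coTurn (Coords.cov (c t)) (deriv c t) * coAlong (Coords.cov (c t)) (deriv c t) := by
  have hv := velocity_of_parametrizes h hc
  have s1 := hasDerivAt_form (t := t) isOpen_univ
    (fun u => (smoothOn_coframe Set.univ u).1) hc.1 trivial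
  have s2 := hasDerivAt_form (t := t) isOpen_univ
    (fun u => (smoothOn_coframe Set.univ u).2.1) hc.1 trivial
  have s3 := hasDerivAt_form (t := t) isOpen_univ
    (fun u => (smoothOn_coframe Set.univ u).2.2) hc.1 trivial
  obtain ⟨d1, d2, d3⟩ := dirDeriv_coframe (deriv c t) (Coords.cov (c t)) (deriv c t)
  rw [d1] at s1
  rw [d2] at s2
  rw [d3] at s3
  have e1 := (s2.const_mul a).unique ((s1.const_mul b).congr_of_eventuallyEq
    (Filter.Eventually.of_forall fun s => (hv s).1))
  have e2 := s3.unique ((hasDerivAt_const t (0 : ℝ)).congr_of_eventuallyEq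
    (Filter.Eventually.of_forall fun s => (hv s).2))
  rw [(hv t).2] at e1
  constructor <;> linarith

end AlongCurve

/-! ## Connections with the given geodesics -/

theorem exists_parametrizes_at {K : Set Pos} {p : Pos} (hp : p ∈ K) {c : ℝ → E3}
    (hc : Parametrizes c K) : ∃ t, Coords.cov (c t) = p := by
  rw [← hc.2.2] at hp
  exact hp

theorem parallel_of_mul_eq {a b x y : ℝ} (h : a ≠ 0 ∨ b ≠ 0) (he : a * y = b * x) :
    ∃ k, x = k * a ∧ y = k * b := by
  rcases h with h | h
  · exact ⟨x / a, by field_simp, by field_simp; linarith⟩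
  · exact ⟨y / b, by field_simp; linarith, by field_simp⟩

/-- A parametrisation has velocity v = k · (a along + b turn) with k ≠ 0, and the geodesic equation
gives k² Γ(x, x) = μ v - w with w the acceleration. The conclusions are the components that do not
involve the arbitrary μ. -/
theorem Connection.christoffel_of_isGeodesic {nabla : Connection} {a b : ℝ} {p : Pos}
    (h : a ≠ 0 ∨ b ≠ 0) (hg : nabla.IsGeodesic (carCurve a b p)) :
    coAcross p (nabla.Γ p (a • along p + b • turn p) (a • along p + b • turn p)) = -(a * b) ∧
    b * coAlong p (nabla.Γ p (a • along p + b • turn p) (a • along p + b • turn p)) =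
      a * coTurn p (nabla.Γ p (a • along p + b • turn p) (a • along p + b • turn p)) := by
  obtain ⟨c, hc, hgeo⟩ := hg
  obtain ⟨t, rfl⟩ := exists_parametrizes_at (self_mem_carCurve a b p) hc
  obtain ⟨v1, v2⟩ := velocity_of_parametrizes h hc t
  obtain ⟨w1, w2⟩ := acceleration_of_parametrizes h hc t
  obtain ⟨k, k1, k2⟩ := parallel_of_mul_eq h v1
  obtain ⟨μ, hμ⟩ := Submodule.mem_span_singleton.1 (hgeo t)
  have hne := hc.2.1 t
  generalize deriv c t = v at *
  generalize deriv (deriv c) t = w at *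
  generalize (Coords.cov (c t) : Pos) = p at *
  have hv : v = k • (a • along p + b • turn p) := by
    rw [frame_decomp p v, v2, k1, k2]; module
  have hk : k ≠ 0 := by rintro rfl; exact hne (by rw [hv, zero_smul])
  have hΓ : nabla.Γ p (a • along p + b • turn p) (a • along p + b • turn p) =
      (k * k)⁻¹ • (μ • v - w) := by
    rw [hμ, hv]
    generalize a • along p + b • turn p = x
    simp only [map_smul, LinearMap.smul_apply]
    rw [add_sub_cancel_left, smul_smul, smul_smul, mul_assoc, inv_mul_cancel₀ (mul_ne_zero hk hk),
      one_smul]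
  rw [hΓ]
  simp only [map_smul, map_sub, smul_eq_mul, v2, w2, k1, k2]
  constructor
  · field_simp; ring
  · linear_combination (k * k)⁻¹ * w1

/-- The structure of the Christoffel symbols on the contact distribution. -/
theorem Connection.exists_christoffel {ℓ : ℝ} (hℓ : 0 < ℓ) {nabla : Connection}
    (h : ∀ K ∈ inducedCurves (gas ℓ), nabla.IsGeodesic K) (p : Pos) : ∃ k₁ k₂ : ℝ,
    ∀ v w, coAcross p v = 0 → coAcross p w = 0 →
      coAlong p (nabla.Γ p v w) = ((k₁ * coAlong p v + k₂ * coTurn p v) * coAlong p w +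
        (k₁ * coAlong p w + k₂ * coTurn p w) * coAlong p v) / 2 ∧
      coTurn p (nabla.Γ p v w) = ((k₁ * coAlong p v + k₂ * coTurn p v) * coTurn p w +
        (k₁ * coAlong p w + k₂ * coTurn p w) * coTurn p v) / 2 ∧
      coAcross p (nabla.Γ p v w) =
        -(coAlong p v * coTurn p w + coTurn p v * coAlong p w) / 2 := by
  have key : ∀ a b : ℝ, a ≠ 0 ∨ b ≠ 0 → _ := fun a b hab =>
    nabla.christoffel_of_isGeodesic (p := p) hab (h _ (carCurve_mem_inducedCurves hℓ hab p))
  -- A quadratic map Q of the plane with Q(x) parallel to x has the form k(x) x with k linear. The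
  -- four directions determine the coefficients, and polarisation gives the bilinear statement.
  obtain ⟨a1, b1⟩ := key 1 0 (by simp)
  obtain ⟨a2, b2⟩ := key 0 1 (by simp)
  obtain ⟨a3, b3⟩ := key 1 1 (by simp)
  obtain ⟨a4, b4⟩ := key 1 (-1) (by simp)
  have hs := nabla.symm p (turn p) (along p)
  simp only [map_add, map_smul, LinearMap.add_apply, LinearMap.smul_apply, smul_eq_mul, hs,
    one_mul, zero_mul, add_zero, zero_add, neg_mul, mul_neg, mul_one, mul_zero, neg_neg, neg_zero]
    at a1 a2 a3 a4 b1 b2 b3 b4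
  refine ⟨coAlong p (nabla.Γ p (along p) (along p)), coTurn p (nabla.Γ p (turn p) (turn p)),
    fun v w hv hw => ?_⟩
  have dv := frame_decomp p v
  have dw := frame_decomp p w
  rw [hv, zero_smul, add_zero] at dv
  rw [hw, zero_smul, add_zero] at dw
  generalize coAlong p v = x at *
  generalize coTurn p v = y at *
  generalize coAlong p w = x' at *
  generalize coTurn p w = y' at *
  rw [dv, dw]
  simp only [map_add, map_smul, LinearMap.add_apply, LinearMap.smul_apply, smul_eq_mul, hs]
  generalize coAlong p (nabla.Γ p (along p) (along p)) = q1 at *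
  generalize coAlong p (nabla.Γ p (along p) (turn p)) = q2 at *
  generalize coAlong p (nabla.Γ p (turn p) (turn p)) = q3 at *
  generalize coTurn p (nabla.Γ p (along p) (along p)) = r1 at *
  generalize coTurn p (nabla.Γ p (along p) (turn p)) = r2 at *
  generalize coTurn p (nabla.Γ p (turn p) (turn p)) = r3 at *
  generalize coAcross p (nabla.Γ p (along p) (along p)) = s1 at *
  generalize coAcross p (nabla.Γ p (along p) (turn p)) = s2 at *
  generalize coAcross p (nabla.Γ p (turn p) (turn p)) = s3 at *
  obtain rfl : r1 = 0 := by linarith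
  obtain rfl : q3 = 0 := by linarith
  obtain rfl : s1 = 0 := by linarith
  obtain rfl : s3 = 0 := by linarith
  obtain rfl : s2 = -1 / 2 := by linarith
  obtain rfl : q2 = r3 / 2 := by linarith
  obtain rfl : r2 = q1 / 2 := by linarith
  refine ⟨by ring, by ring, by ring⟩

/-! ## The differential equations for infinitesimal symmetries -/

section Potential

variable {U : Set Pos} {f : Pos → ℝ} {p : Pos}

theorem dFrame_add {f g : Pos → ℝ} (hf : DiffAt f p) (hg : DiffAt g p) :
    dAlong (fun q => f q + g q) p = dAlong f p + dAlong g p ∧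
    dTurn (fun q => f q + g q) p = dTurn f p + dTurn g p ∧
    dAcross (fun q => f q + g q) p = dAcross f p + dAcross g p :=
  ⟨dirDeriv_add hf hg _, dirDeriv_add hf hg _, dirDeriv_add hf hg _⟩

theorem dFrame_sub {f g : Pos → ℝ} (hf : DiffAt f p) (hg : DiffAt g p) :
    dAlong (fun q => f q - g q) p = dAlong f p - dAlong g p ∧
    dTurn (fun q => f q - g q) p = dTurn f p - dTurn g p ∧
    dAcross (fun q => f q - g q) p = dAcross f p - dAcross g p :=
  ⟨dirDeriv_sub hf hg _, dirDeriv_sub hf hg _, dirDeriv_sub hf hg _⟩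

theorem dFrame_congr {f g : Pos → ℝ} (hU : IsOpen U) (h : ∀ q ∈ U, f q = g q) (hp : p ∈ U) :
    dAlong f p = dAlong g p ∧ dTurn f p = dTurn g p ∧ dAcross f p = dAcross g p :=
  ⟨dirDeriv_congr hU h hp _, dirDeriv_congr hU h hp _, dirDeriv_congr hU h hp _⟩

theorem dFrame_zero (hU : IsOpen U) (h : ∀ q ∈ U, f q = 0) (hp : p ∈ U) :
    dAlong f p = 0 ∧ dTurn f p = 0 ∧ dAcross f p = 0 := by
  obtain ⟨h1, h2, h3⟩ := dFrame_congr hU h hp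
  exact ⟨h1.trans (dirDeriv_const _ _ _), h2.trans (dirDeriv_const _ _ _),
    h3.trans (dirDeriv_const _ _ _)⟩

/-- The equations satisfied by the contact potential of an infinitesimal symmetry. -/
def IsPotential (U : Set Pos) (f : Pos → ℝ) : Prop :=
  SmoothOn U f ∧ ∀ p ∈ U, dAlong (dAlong (dAlong f)) p = 0 ∧ dAlong (dTurn (dAlong f)) p = 0 ∧
    dTurn (dAlong (dTurn f)) p = 0 ∧ dTurn (dTurn (dTurn f)) p = -dTurn f p

/-- The components of a symmetry on the contact distribution are derivatives of its contact
component. -/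
theorem IsInfinitesimalSymmetry.components {ℓ : ℝ} (hℓ : 0 < ℓ) {S : Pos → E3} (hU : IsOpen U)
    (hS : IsInfinitesimalSymmetry (inducedDistribution (gas ℓ)) (inducedCurves (gas ℓ)) U S)
    (hp : p ∈ U) : coAlong p (S p) = -dTurn (fun q => coAcross q (S q)) p ∧
      coTurn p (S p) = dAlong (fun q => coAcross q (S q)) p := by
  obtain ⟨hs, hC, -⟩ := hS
  have dS := hs.diffAt hU hp
  obtain ⟨d1, d2, -⟩ := diffAt_frame p
  have h1 := hC along (smoothOn_along U) (fun q _ => by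
    rw [inducedDistribution_gas hℓ, LinearMap.mem_ker, coAcross_along]) p hp
  have h2 := hC turn (smoothOn_turn U) (fun q _ => by
    rw [inducedDistribution_gas hℓ, LinearMap.mem_ker, coAcross_turn]) p hp
  rw [inducedDistribution_gas hℓ, LinearMap.mem_ker, coAcross_bracket dS d1] at h1
  rw [inducedDistribution_gas hℓ, LinearMap.mem_ker, coAcross_bracket dS d2] at h2
  simp only [coAcross_along, coAcross_turn, coAlong_along, coAlong_turn, coTurn_along,
    coTurn_turn, dirDeriv_const] at h1 h2
  simp only [dAlong, dTurn]
  constructor <;> linarith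

/-- The symmetry condition is tested on V = a along + b turn with constant a and b. The combination
b · coAlong - a · coTurn removes the multiple of V, and `Connection.exists_christoffel` shows that
the choice of connection drops out. The result is a cubic polynomial in (a, b). -/
theorem IsInfinitesimalSymmetry.equation {ℓ : ℝ} (hℓ : 0 < ℓ) {S : Pos → E3} (hU : IsOpen U)
    (hS : IsInfinitesimalSymmetry (inducedDistribution (gas ℓ)) (inducedCurves (gas ℓ)) U S)
    (hp : p ∈ U) (a b : ℝ) :
    let X : (Pos → ℝ) → Pos → ℝ := fun f q => a * dAlong f q + b * dTurn f q
    let f : Pos → ℝ := fun q => coAcross q (S q)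
    b * (X (X (dTurn f)) p + b * X f p) + a * X (X (dAlong f)) p = 0 := by
  intro X f
  obtain ⟨hs, hC, nabla, hgeo, hlie⟩ := id hS
  have hf : SmoothOn U f := hs.coAcross
  have dS := fun q (hq : q ∈ U) => hs.diffAt hU hq
  set V : Pos → E3 := fun q => a • along q + b • turn q with hVdef
  have hV : SmoothOn U V := ((smoothOn_const U a).smul (smoothOn_along U)).add
    ((smoothOn_const U b).smul (smoothOn_turn U))
  have dV := fun q (hq : q ∈ U) => hV.diffAt hU hq
  have v1 : ∀ q, coAlong q (V q) = a := fun q => by simp [V]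
  have v2 : ∀ q, coTurn q (V q) = b := fun q => by simp [V]
  have v3 : ∀ q, coAcross q (V q) = 0 := fun q => by simp [V]
  have hX : ∀ g q, dirDeriv g q (V q) = X g q := fun g q => by
    rw [dirDeriv_frame, v1, v2, v3]; simp [X]
  have hVC : ∀ q ∈ U, V q ∈ inducedDistribution (gas ℓ) q := fun q _ => by
    rw [inducedDistribution_gas hℓ, LinearMap.mem_ker, v3]
  have hcomp := fun q (hq : q ∈ U) => hS.components hℓ hU hq
  set Y := bracket S V with hY
  have y1 : ∀ q ∈ U, coAlong q (Y q) = X (dTurn f) q + b * f q := fun q hq => by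
    rw [hY, coAlong_bracket (dS q hq) (dV q hq)]
    simp only [v1, v2, v3, dirDeriv_const]
    rw [dirDeriv_congr hU (fun q hq => (hcomp q hq).1) hq, dirDeriv_neg, hX]
    ring
  have y2 : ∀ q ∈ U, coTurn q (Y q) = -X (dAlong f) q := fun q hq => by
    rw [hY, coTurn_bracket (dS q hq) (dV q hq)]
    simp only [v2, dirDeriv_const]
    rw [dirDeriv_congr hU (fun q hq => (hcomp q hq).2) hq, hX]
    ring
  have y3 : ∀ q ∈ U, coAcross q (Y q) = 0 := fun q hq => by
    have := hC V hV hVC q hq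
    rwa [inducedDistribution_gas hℓ, LinearMap.mem_ker] at this
  have sY : SmoothOn U Y := hs.bracket hU hV
  set N := nabla.cov V V with hN
  have sN : SmoothOn U N := SmoothOn.connection_cov hU nabla hV hV
  -- The connection enters only through the number k with ∇_V V = kV, both in ∇_V V and, by
  -- polarisation, in the terms Γ(V, [S, V]).
  have hNp : ∀ q ∈ U, ∃ k, coAlong q (N q) = k * a ∧ coTurn q (N q) = k * b ∧
      coAcross q (N q) = 0 ∧ ∀ w, coAcross q w = 0 →
        2 * (b * coAlong q (nabla.Γ q (V q) w) - a * coTurn q (nabla.Γ q (V q) w)) =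
          k * (b * coAlong q w - a * coTurn q w) := fun q hq => by
    obtain ⟨k1, k2, hk⟩ := nabla.exists_christoffel hℓ hgeo q
    obtain ⟨g1, g2, g3⟩ := hk (V q) (V q) (v3 q) (v3 q)
    rw [v1, v2] at g1 g2 g3
    have n1 : coAlong q (N q) = _ := map_add (coAlong q) _ _
    have n2 : coTurn q (N q) = _ := map_add (coTurn q) _ _
    have n3 : coAcross q (N q) = _ := map_add (coAcross q) _ _
    rw [coAlong_dirDeriv (dV q hq), g1] at n1
    rw [coTurn_dirDeriv (dV q hq), g2] at n2
    rw [coAcross_dirDeriv (dV q hq), g3] at n3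
    simp only [v1, v2, v3, dirDeriv_const] at n1 n2 n3
    refine ⟨k1 * a + k2 * b, by rw [n1]; ring, by rw [n2]; ring, by rw [n3]; ring,
      fun w hw => ?_⟩
    obtain ⟨l1, l2, -⟩ := hk (V q) w (v3 q) hw
    rw [l1, l2, v1, v2]
    ring
  obtain ⟨k, n1, n2, n3, hk⟩ := hNp p hp
  have hNV : N p = k • V p := frame_ext (p := p) (by rw [n1, map_smul, v1, smul_eq_mul])
    (by rw [n2, map_smul, v2, smul_eq_mul]) (by rw [n3, map_smul, v3, smul_zero])
  obtain ⟨μ, hμ⟩ := Submodule.mem_span_singleton.1 (hlie V hV hVC p hp)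
  have m1 := congrArg (coAlong p) hμ
  have m2 := congrArg (coTurn p) hμ
  have dN := sN.diffAt hU hp
  have c1 : coAlong p (nabla.cov Y V p) = coAlong p (nabla.Γ p (V p) (Y p)) := by
    rw [Connection.cov, map_add, coAlong_dirDeriv (dV p hp), v3, nabla.symm]
    simp only [v1, dirDeriv_const]
    ring
  have c2 : coTurn p (nabla.cov Y V p) = coTurn p (nabla.Γ p (V p) (Y p)) := by
    rw [Connection.cov, map_add, coTurn_dirDeriv (dV p hp), nabla.symm]
    simp only [v2, dirDeriv_const]
    ring
  have e1 : coAlong p (nabla.cov V Y p) =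
      X (X (dTurn f)) p + b * X f p + coAlong p (nabla.Γ p (V p) (Y p)) := by
    have sXf : SmoothOn U (X (dTurn f)) :=
      ((smoothOn_const U a).mul ((hf.dTurn hU).dAlong hU)).add
        ((smoothOn_const U b).mul ((hf.dTurn hU).dTurn hU))
    have hb : DiffAt (fun _ : Pos => b) p := differentiableAt_const _
    rw [Connection.cov, map_add, coAlong_dirDeriv (sY.diffAt hU hp), y3 p hp,
      dirDeriv_congr hU y1 hp, dirDeriv_add (sXf.diffAt hU hp) (hb.mul (hf.diffAt hU hp)),
      dirDeriv_mul hb (hf.diffAt hU hp), dirDeriv_const, hX, hX]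
    ring
  have e2 : coTurn p (nabla.cov V Y p) =
      -X (X (dAlong f)) p + coTurn p (nabla.Γ p (V p) (Y p)) := by
    rw [Connection.cov, map_add, coTurn_dirDeriv (sY.diffAt hU hp),
      dirDeriv_congr hU y2 hp, dirDeriv_neg, hX]
  -- As ∇_V V is parallel to V throughout U, the combination b · coAlong - a · coTurn of it vanishes
  -- identically, and so does its derivative along S.
  have hlam : b * dirDeriv (fun q => coAlong q (N q)) p (S p) -
      a * dirDeriv (fun q => coTurn q (N q)) p (S p) = 0 := by
    have hd1 : DiffAt (fun q => coAlong q (N q)) p := sN.coAlong.diffAt hU hp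
    have hd2 : DiffAt (fun q => coTurn q (N q)) p := sN.coTurn.diffAt hU hp
    have hcst : ∀ a : ℝ, DiffAt (fun _ : Pos => a) p := fun a => differentiableAt_const _
    have h0 : ∀ q ∈ U, b * coAlong q (N q) - a * coTurn q (N q) = 0 := fun q hq => by
      obtain ⟨k, n1, n2, -⟩ := hNp q hq
      rw [n1, n2]; ring
    have := dirDeriv_congr hU h0 hp (S p)
    rw [dirDeriv_const, dirDeriv_sub ((hcst b).mul hd1) ((hcst a).mul hd2),
      dirDeriv_mul (hcst b) hd1, dirDeriv_mul (hcst a) hd2, dirDeriv_const, dirDeriv_const] at this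
    linarith
  have l1 := y1 p hp
  have l2 := y2 p hp
  rw [hY, coAlong_bracket (dS p hp) (dV p hp)] at l1
  rw [hY, coTurn_bracket (dS p hp) (dV p hp)] at l2
  simp only [v1, v2, v3, dirDeriv_const] at l1 l2
  have hkY := hk (Y p) (y3 p hp)
  rw [y1 p hp, y2 p hp] at hkY
  rw [lieConnection, ← hN, ← hY, map_sub, map_sub, coAlong_bracket (dS p hp) dN, c1, e1, n2, n3,
    map_smul, v1, smul_eq_mul] at m1
  rw [lieConnection, ← hN, ← hY, map_sub, map_sub, coTurn_bracket (dS p hp) dN, c2, e2,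
    map_smul, v2, smul_eq_mul] at m2
  have t1 : dirDeriv (fun q => coAlong q (S q)) p (N p) =
      k * dirDeriv (fun q => coAlong q (S q)) p (V p) := by
    rw [hNV, dirDeriv_smul_apply, smul_eq_mul]
  have t2 : dirDeriv (fun q => coTurn q (S q)) p (N p) =
      k * dirDeriv (fun q => coTurn q (S q)) p (V p) := by
    rw [hNV, dirDeriv_smul_apply, smul_eq_mul]
  rw [t1] at m1
  rw [t2] at m2
  linear_combination b * m1 - a * m2 + hlam + b * k * l1 - a * k * l2 - hkY

end Potential

/-! ### Prolongation of the equations for the potential to a parallel section -/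

section Prolongation

variable {U : Set Pos} {f : Pos → ℝ} {p : Pos}

/-- The four coefficients of the cubic condition. The mixed ones are sums of third derivatives over
the orders of differentiation; the commutation relations reduce each to three times a single term.
-/
theorem IsInfinitesimalSymmetry.isPotential {ℓ : ℝ} (hℓ : 0 < ℓ) {S : Pos → E3} (hU : IsOpen U)
    (hS : IsInfinitesimalSymmetry (inducedDistribution (gas ℓ)) (inducedCurves (gas ℓ)) U S) :
    IsPotential U fun q => coAcross q (S q) := by
  have hf : SmoothOn U fun q => coAcross q (S q) := hS.1.coAcross
  refine ⟨hf, fun p hp => ?_⟩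
  have key := fun a b => hS.equation hℓ hU hp a b
  set f : Pos → ℝ := fun q => coAcross q (S q) with hfdef
  have s1 := hf.dAlong hU
  have s2 := hf.dTurn hU
  have hexp : ∀ {g : Pos → ℝ}, SmoothOn U g → ∀ a b : ℝ,
      a * dAlong (fun q => a * dAlong g q + b * dTurn g q) p +
        b * dTurn (fun q => a * dAlong g q + b * dTurn g q) p =
      a * (a * dAlong (dAlong g) p + b * dAlong (dTurn g) p) +
        b * (a * dTurn (dAlong g) p + b * dTurn (dTurn g) p) := fun {g} hg a b => by
    have d1 := (hg.dAlong hU).diffAt hU hp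
    have d2 := (hg.dTurn hU).diffAt hU hp
    have hk : ∀ a : ℝ, DiffAt (fun _ : Pos => a) p := fun a => differentiableAt_const _
    have h : ∀ u, dirDeriv (fun q => a * dAlong g q + b * dTurn g q) p u =
        a * dirDeriv (dAlong g) p u + b * dirDeriv (dTurn g) p u := fun u => by
      rw [dirDeriv_add ((hk a).mul d1) ((hk b).mul d2), dirDeriv_mul (hk a) d1,
        dirDeriv_mul (hk b) d2, dirDeriv_const, dirDeriv_const]
      ring
    rw [dAlong, dTurn, h, h]
    simp only [dAlong, dTurn]
  simp only [hexp s1, hexp s2] at key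
  -- Four values determine a homogeneous cubic in two variables.
  have k1 := key 1 0
  have k2 := key 0 1
  have k3 := key 1 1
  have k4 := key 1 (-1)
  have hA : dTurn (dAlong (dAlong f)) p = dAlong (dTurn (dAlong f)) p + dAcross (dAlong f) p :=
    dTurn_dAlong hU s1 hp
  have ec : ∀ q ∈ U, dTurn (dAlong f) q = dAlong (dTurn f) q + dAcross f q := fun q hq =>
    dTurn_dAlong hU hf hq
  have s12 := s2.dAlong hU
  have s3 := hf.dAcross hU
  have hB := dFrame_congr hU ec hp
  have hB' := dFrame_add (s12.diffAt hU hp) (s3.diffAt hU hp)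
  have hC : dAlong (dAcross f) p = dAcross (dAlong f) p := dAlong_dAcross hU hf hp
  have hD : dTurn (dAlong (dTurn f)) p = dAlong (dTurn (dTurn f)) p + dAcross (dTurn f) p :=
    dTurn_dAlong hU s2 hp
  have hE : dTurn (dAcross f) p = dAcross (dTurn f) p - dAlong f p := dTurn_dAcross hU hf hp
  obtain ⟨b1, b2, -⟩ := hB
  obtain ⟨b3, b4, -⟩ := hB'
  refine ⟨?_, ?_, ?_, ?_⟩ <;> linarith

/-- The derivatives of the derivatives of the potential of an infinitesimal symmetry. -/
theorem IsPotential.jets (hU : IsOpen U) (hf : IsPotential U f) (hp : p ∈ U) :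
    dTurn (dTurn (dAlong f)) p = -dAlong (fun q => f q + dTurn (dTurn f) q) p ∧
    dAlong (dAlong (dTurn f)) p = -dTurn (dAlong (dAlong f)) p ∧
    dTurn (fun q => f q + dTurn (dTurn f) q) p = 0 ∧
    dAlong (dTurn (dAlong (dAlong f))) p = 0 ∧
    dTurn (dTurn (dAlong (dAlong f))) p =
      dAlong (dAlong fun q => f q + dTurn (dTurn f) q) p - dAlong (dAlong f) p ∧
    dTurn (dAlong fun q => f q + dTurn (dTurn f) q) p = dTurn (dAlong f) p ∧
    dAlong (dAlong (dAlong fun q => f q + dTurn (dTurn f) q)) p = 0 ∧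
    dTurn (dAlong (dAlong fun q => f q + dTurn (dTurn f) q)) p = 0 := by
  obtain ⟨hf, hpde⟩ := hf
  have s1 := hf.dAlong hU
  have s2 := hf.dTurn hU
  have s3 := hf.dAcross hU
  have s11 := s1.dAlong hU
  have s12 := s2.dAlong hU
  have s21 := s1.dTurn hU
  have s22 := s2.dTurn hU
  have sg : SmoothOn U fun q => f q + dTurn (dTurn f) q := hf.add s22
  -- With this g the last equation of the system says that `dTurn g` vanishes, so further
  -- derivatives are taken of g instead of the second turn-derivative of f.
  set g : Pos → ℝ := fun q => f q + dTurn (dTurn f) q with hg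
  have sk := sg.dAlong hU
  have sw := sk.dAlong hU
  have sh := s11.dTurn hU
  have pd : ∀ {q}, q ∈ U → ∀ {a : Pos → ℝ}, SmoothOn U a → DiffAt a q :=
    fun hq _ ha => ha.diffAt hU hq
  have dg := fun q (hq : q ∈ U) => dFrame_add (pd hq hf) (pd hq s22)
  have e3 : ∀ q ∈ U, dAcross f q = dTurn (dAlong f) q - dAlong (dTurn f) q := fun q hq => by
    have := dTurn_dAlong hU hf hq
    linarith
  have d3 := fun q (hq : q ∈ U) => dFrame_congr hU e3 hq
  have d3' := fun q (hq : q ∈ U) => dFrame_sub (pd hq s21) (pd hq s12)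
  -- second derivatives of `f`
  have q1 : ∀ q ∈ U, dAcross (dAlong f) q = dTurn (dAlong (dAlong f)) q := fun q hq => by
    have h := dTurn_dAlong hU s1 hq
    have := (hpde q hq).2.1
    linarith
  have q2 : ∀ q ∈ U, dAlong (dAlong (dTurn f)) q = -dTurn (dAlong (dAlong f)) q := fun q hq => by
    have h1 := dAlong_dAcross hU hf hq
    rw [(d3 q hq).1, (d3' q hq).1, q1 q hq, (hpde q hq).2.1] at h1
    linarith
  have q3 : ∀ q ∈ U, dTurn g q = 0 := fun q hq => by
    rw [(dg q hq).2.1, (hpde q hq).2.2.2]; ring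
  have q4 : ∀ q ∈ U, dAcross (dTurn f) q = dAlong f q - dAlong g q := fun q hq => by
    have h := dTurn_dAlong hU s2 hq
    have h' := (hpde q hq).2.2.1
    have h'' := (dg q hq).1
    linarith
  have q5 : ∀ q ∈ U, dTurn (dTurn (dAlong f)) q = -dAlong g q := fun q hq => by
    have h1 := dTurn_dAcross hU hf hq
    rw [(d3 q hq).2.1, (d3' q hq).2.1, (hpde q hq).2.2.1, q4 q hq] at h1
    linarith
  -- derivatives of `dTurn (dAlong (dAlong f))`
  have q6 : ∀ q ∈ U, dAlong (dTurn (dAlong (dAlong f))) q = 0 := fun q hq => by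
    have h1 := dTurn_dAlong hU s11 hq
    have h2 := dAlong_dAcross hU s1 hq
    rw [(dFrame_congr hU q1 hq).1] at h2
    have h3 := (dFrame_zero hU (fun q hq => (hpde q hq).1) hq).2.1
    linarith
  have q7 : ∀ q ∈ U, dAcross (dTurn (dAlong f)) q = dAlong (dAlong g) q := fun q hq => by
    have h1 := dTurn_dAlong hU s21 hq
    rw [(dFrame_congr hU q5 hq).1] at h1
    have h2 := (dFrame_zero hU (fun q hq => (hpde q hq).2.1) hq).2.1
    have h3 : dAlong (fun q => -dAlong g q) q = -dAlong (dAlong g) q := dirDeriv_neg _ _ _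
    linarith
  have q8 : ∀ q ∈ U, dTurn (dTurn (dAlong (dAlong f))) q =
      dAlong (dAlong g) q - dAlong (dAlong f) q := fun q hq => by
    have h1 := dTurn_dAcross hU s1 hq
    rw [(dFrame_congr hU q1 hq).2.1, q7 q hq] at h1
    exact h1
  -- derivatives of `dAlong g`
  have q9 : ∀ q ∈ U, dTurn (dAlong g) q = dAcross g q := fun q hq => by
    have h1 := dTurn_dAlong hU sg hq
    rw [(dFrame_zero hU q3 hq).1] at h1
    linarith
  have q10 : ∀ q ∈ U, dTurn (dAlong g) q = dTurn (dAlong f) q := fun q hq => by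
    have h1 := dTurn_dAcross hU s2 hq
    rw [(dFrame_congr hU q4 hq).2.1, (dFrame_sub (pd hq s1) (pd hq sk)).2.1] at h1
    have h2 := (dg q hq).2.2
    have h3 := e3 q hq
    have h4 := q9 q hq
    linarith
  have q11 : ∀ q ∈ U, dAcross (dTurn (dAlong (dAlong f))) q = 0 := fun q hq => by
    have h1 := dTurn_dAcross hU s11 hq
    have h2 : ∀ q ∈ U, dAcross (dAlong (dAlong f)) q = 0 := fun q hq => by
      have h := dTurn_dAlong hU s11 hq
      rw [q6 q hq, (dFrame_zero hU (fun q hq => (hpde q hq).1) hq).2.1] at h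
      linarith
    rw [(dFrame_zero hU h2 hq).2.1, (hpde q hq).1] at h1
    linarith
  have q12 : ∀ q ∈ U, dAlong (dAlong (dAlong g)) q = 0 := fun q hq => by
    have h1 := dTurn_dAlong hU sh hq
    rw [(dFrame_zero hU q6 hq).2.1, (dFrame_congr hU q8 hq).1,
      (dFrame_sub (pd hq sw) (pd hq s11)).1, q11 q hq, (hpde q hq).1] at h1
    linarith
  have q13 : ∀ q ∈ U, dTurn (dAlong (dAlong g)) q = 0 := fun q hq => by
    have h1 := dTurn_dAlong hU sk hq
    have h2 := dAlong_dAcross hU sg hq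
    rw [(dFrame_congr hU (fun q hq => (q9 q hq).symm.trans (q10 q hq)) hq).1,
      (hpde q hq).2.1] at h2
    rw [(dFrame_congr hU q10 hq).1, (hpde q hq).2.1] at h1
    linarith
  exact ⟨q5 p hp, q2 p hp, q3 p hp, q6 p hp, q8 p hp, q10 p hp, q12 p hp, q13 p hp⟩

/-- The section of the adjoint bundle defined by the potential of an infinitesimal symmetry. -/
def prolong (f : Pos → ℝ) (p : Pos) : Mat :=
  -- The first entry is the potential, with the sign of `symmetryField`. The table
  -- `parallel_entries` then forces the others one after the other; together they contain f, its
  -- first derivatives along `along` and `turn`, and seven higher derivatives.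
  let g : Pos → ℝ := fun q => f q + dTurn (dTurn f) q
  spMat (-f p) (-(1 / 2 * dAlong f p)) (-dTurn f p)
    (1 / 2 * (dTurn (dAlong f) p - dAlong (dTurn f) p))
    (-(1 / 2 * (dAlong (dTurn f) p + dTurn (dAlong f) p))) (1 / 2 * dAlong (dAlong f) p)
    (f p - 2 * g p) (1 / 2 * dAlong f p - dAlong g p)
    (-(1 / 2 * dTurn (dAlong (dAlong f)) p)) (dAlong (dAlong g) p - 1 / 2 * dAlong (dAlong f) p)

theorem prolong_mem (f : Pos → ℝ) (p : Pos) : prolong f p ∈ sp4 := spMat_mem ..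

theorem smoothMat_spMat {m q r a s t u b c z : Pos → ℝ} (hm : SmoothOn U m) (hq : SmoothOn U q)
    (hr : SmoothOn U r) (ha : SmoothOn U a) (hs : SmoothOn U s) (ht : SmoothOn U t)
    (hu : SmoothOn U u) (hb : SmoothOn U b) (hc : SmoothOn U c) (hz : SmoothOn U z) :
    SmoothMat U fun p => spMat (m p) (q p) (r p) (a p) (s p) (t p) (u p) (b p) (c p) (z p) := by
  refine fun i j => forall_index (P := fun i => SmoothOn U fun p => spMat (m p) (q p) (r p) (a p)
    (s p) (t p) (u p) (b p) (c p) (z p) i j) ?_ ?_ ?_ ?_ i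
  all_goals
    revert j
    refine forall_index ?_ ?_ ?_ ?_
  exacts [ha, hb, hz, hc, hq, hs, hc, ht, hm, hr, ha.neg, hq.neg, hr, hu, hb.neg, hs.neg]

theorem dMat_spMat {m q r a s t u b c z : Pos → ℝ} (p : Pos) (v : E3) :
    dMat (fun p => spMat (m p) (q p) (r p) (a p) (s p) (t p) (u p) (b p) (c p) (z p)) p v =
      spMat (dirDeriv m p v) (dirDeriv q p v) (dirDeriv r p v) (dirDeriv a p v) (dirDeriv s p v)
        (dirDeriv t p v) (dirDeriv u p v) (dirDeriv b p v) (dirDeriv c p v) (dirDeriv z p v) := by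
  refine mat_ext_index (forall_index ?_ ?_ ?_ ?_)
  exacts [⟨rfl, rfl, rfl, rfl⟩, ⟨rfl, rfl, rfl, rfl⟩,
    ⟨rfl, rfl, dirDeriv_neg a p v, dirDeriv_neg q p v⟩,
    ⟨rfl, rfl, dirDeriv_neg b p v, dirDeriv_neg s p v⟩]

theorem smoothMat_prolong (hU : IsOpen U) (hf : SmoothOn U f) : SmoothMat U (prolong f) := by
  have s1 := hf.dAlong hU
  have s2 := hf.dTurn hU
  have s11 := s1.dAlong hU
  have s12 := s2.dAlong hU
  have s21 := s1.dTurn hU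
  have s22 := s2.dTurn hU
  have sg : SmoothOn U fun q => f q + dTurn (dTurn f) q := hf.add s22
  have k := smoothOn_const U (1 / 2 : ℝ)
  exact smoothMat_spMat hf.neg (k.mul s1).neg s2.neg (k.mul (s21.sub s12)) (k.mul (s12.add s21)).neg
    (k.mul s11) (hf.sub ((smoothOn_const U (2 : ℝ)).mul sg)) ((k.mul s1).sub (sg.dAlong hU))
    (k.mul (s11.dTurn hU)).neg (((sg.dAlong hU).dAlong hU).sub (k.mul s11))

theorem dirDeriv_const_mul {f : Pos → ℝ} (hf : DiffAt f p) (a : ℝ) (u : E3) :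
    dirDeriv (fun q => a * f q) p u = a * dirDeriv f p u := by
  have hk : DiffAt (fun _ : Pos => a) p := differentiableAt_const _
  rw [dirDeriv_mul hk hf, dirDeriv_const]; ring

/-- The system closes: by `IsPotential.jets` every contact derivative of the ten chosen quantities
is a linear combination of them. The direction `across` is not needed, since it is a bracket. -/
theorem IsPotential.dMat_prolong (hU : IsOpen U) (hf : IsPotential U f) (hp : p ∈ U) :
    (dMat (prolong f) p (along p) = prolong f p * flatForm 1 p (along p) -
      flatForm 1 p (along p) * prolong f p) ∧
    dMat (prolong f) p (turn p) = prolong f p * flatForm 1 p (turn p) -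
      flatForm 1 p (turn p) * prolong f p := by
  obtain ⟨j1, j2, j3, j4, j5, j6, j7, j8⟩ := hf.jets hU hp
  obtain ⟨sf, hpde⟩ := hf
  obtain ⟨i1, i2, i3, i4⟩ := hpde p hp
  have s1 := sf.dAlong hU
  have s2 := sf.dTurn hU
  have s11 := s1.dAlong hU
  have s12 := s2.dAlong hU
  have s21 := s1.dTurn hU
  have s22 := s2.dTurn hU
  have sg : SmoothOn U fun q => f q + dTurn (dTurn f) q := sf.add s22
  have d22 : dTurn (dTurn f) p = (fun q => f q + dTurn (dTurn f) q) p - f p := by simp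
  set g : Pos → ℝ := fun q => f q + dTurn (dTurn f) q with hg
  have sk := sg.dAlong hU
  have sw := sk.dAlong hU
  have sh := s11.dTurn hU
  have hmem : ∀ u, prolong f p * flatForm 1 p u - flatForm 1 p u * prolong f p ∈ sp4 := fun u =>
    lie_mem_sp4 (prolong_mem f p) (flatForm_mem 1 p u)
  have pd : ∀ {a : Pos → ℝ}, SmoothOn U a → DiffAt a p := fun ha => ha.diffAt hU hp
  have hk : ∀ {a : Pos → ℝ}, SmoothOn U a → ∀ c : ℝ, DiffAt (fun q => c * a q) p := fun ha c =>
    pd ((smoothOn_const U c).mul ha)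
  have hd : ∀ u, dMat (prolong f) p u = spMat (-dirDeriv f p u)
      (-(1 / 2 * dirDeriv (dAlong f) p u)) (-dirDeriv (dTurn f) p u)
      (1 / 2 * (dirDeriv (dTurn (dAlong f)) p u - dirDeriv (dAlong (dTurn f)) p u))
      (-(1 / 2 * (dirDeriv (dAlong (dTurn f)) p u + dirDeriv (dTurn (dAlong f)) p u)))
      (1 / 2 * dirDeriv (dAlong (dAlong f)) p u) (dirDeriv f p u - 2 * dirDeriv g p u)
      (1 / 2 * dirDeriv (dAlong f) p u - dirDeriv (dAlong g) p u)
      (-(1 / 2 * dirDeriv (dTurn (dAlong (dAlong f))) p u))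
      (dirDeriv (dAlong (dAlong g)) p u - 1 / 2 * dirDeriv (dAlong (dAlong f)) p u) := fun u => by
    have := dMat_spMat (m := fun p => -f p) (q := fun p => -(1 / 2 * dAlong f p))
      (r := fun p => -dTurn f p) (a := fun p => 1 / 2 * (dTurn (dAlong f) p - dAlong (dTurn f) p))
      (s := fun p => -(1 / 2 * (dAlong (dTurn f) p + dTurn (dAlong f) p)))
      (t := fun p => 1 / 2 * dAlong (dAlong f) p) (u := fun p => f p - 2 * g p)
      (b := fun p => 1 / 2 * dAlong f p - dAlong g p)
      (c := fun p => -(1 / 2 * dTurn (dAlong (dAlong f)) p))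
      (z := fun p => dAlong (dAlong g) p - 1 / 2 * dAlong (dAlong f) p) p u
    refine Eq.trans this ?_
    simp only [dirDeriv_neg]
    rw [dirDeriv_const_mul (pd s1), dirDeriv_const_mul (DiffAt.sub (pd s21) (pd s12)),
      dirDeriv_sub (pd s21) (pd s12), dirDeriv_const_mul (DiffAt.add (pd s12) (pd s21)),
      dirDeriv_add (pd s12) (pd s21), dirDeriv_const_mul (pd s11),
      dirDeriv_sub (pd sf) (hk sg 2), dirDeriv_const_mul (pd sg),
      dirDeriv_sub (hk s1 _) (pd sk), dirDeriv_const_mul (pd s1), dirDeriv_const_mul (pd sh),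
      dirDeriv_sub (pd sw) (hk s11 _), dirDeriv_const_mul (pd s11)]
  have hΨ : prolong f p = spMat (-f p) (-(1 / 2 * dAlong f p)) (-dTurn f p)
      (1 / 2 * (dTurn (dAlong f) p - dAlong (dTurn f) p))
      (-(1 / 2 * (dAlong (dTurn f) p + dTurn (dAlong f) p))) (1 / 2 * dAlong (dAlong f) p)
      (f p - 2 * g p) (1 / 2 * dAlong f p - dAlong g p)
      (-(1 / 2 * dTurn (dAlong (dAlong f)) p))
      (dAlong (dAlong g) p - 1 / 2 * dAlong (dAlong f) p) := rfl
  have fold : ∀ a : Pos → ℝ, dirDeriv a p (along p) = dAlong a p ∧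
      dirDeriv a p (turn p) = dTurn a p := fun a => ⟨rfl, rfl⟩
  have h1 := hd (along p)
  have h2 := hd (turn p)
  simp only [fold] at h1 h2
  constructor
  · apply sp4_ext (by rw [hd]; exact spMat_mem ..) (hmem _)
    all_goals
      rw [h1, Matrix.sub_apply, mat_mul_apply, mat_mul_apply, flatForm_apply, hΨ]
      simp [spMat]
      try linarith
  · apply sp4_ext (by rw [hd]; exact spMat_mem ..) (hmem _)
    all_goals
      rw [h2, Matrix.sub_apply, mat_mul_apply, mat_mul_apply, flatForm_apply, hΨ]
      simp [spMat]
      try linarith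

end Prolongation

/-! ## All infinitesimal symmetries -/

/-- A section of the adjoint bundle that is parallel along the contact distribution over a
connected open set comes from an element of `sp(2,ℝ)`. -/
theorem eq_parallel_of_dMat {U : Set Pos} (hU : IsOpen U) (hc : IsPreconnected U) {Ψ : Pos → Mat}
    (hΨ : SmoothMat U Ψ)
    (h1 : ∀ p ∈ U, dMat Ψ p (along p) = Ψ p * flatForm 1 p (along p) -
      flatForm 1 p (along p) * Ψ p)
    (h2 : ∀ p ∈ U, dMat Ψ p (turn p) = Ψ p * flatForm 1 p (turn p) - flatForm 1 p (turn p) * Ψ p)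
    {A : Mat} {p : Pos} (hp : p ∈ U) (hA : Ψ p = parallel A p) {q : Pos} (hq : q ∈ U) :
    Ψ q = parallel A q := by
  -- Pairing the difference with a parallel section by the trace form turns the claim into constancy
  -- of a scalar function. B is an arbitrary matrix, which makes nondegeneracy of the pairing
  -- immediate.
  have key : ∀ B, ((Ψ q - parallel A q) * parallel B q).trace = 0 := fun B => by
    set Δ : Pos → Mat := fun q => Ψ q - parallel A q with hΔ
    have sA := smoothMat_parallel A U
    have sB := smoothMat_parallel B U
    have sΔ : SmoothMat U Δ := hΨ.sub sA
    have sF : SmoothOn U fun q => (Δ q * parallel B q).trace := (sΔ.mul sB).trace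
    have hd : ∀ q ∈ U, ∀ u, dMat Ψ q u = Ψ q * flatForm 1 q u - flatForm 1 q u * Ψ q →
        dirDeriv (fun q => (Δ q * parallel B q).trace) q u = 0 := fun q hq u h => by
      rw [dirDeriv_trace ((sΔ.mul sB).diffAt hU hq), dMat_mul (sΔ.diffAt hU hq) (sB.diffAt hU hq),
        dMat_sub (hΨ.diffAt hU hq) (sA.diffAt hU hq), h, dMat_parallel, dMat_parallel,
        Matrix.trace_add]
      have e1 : Δ q * (parallel B q * flatForm 1 q u - flatForm 1 q u * parallel B q) =
          Δ q * parallel B q * flatForm 1 q u - Δ q * flatForm 1 q u * parallel B q := by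
        rw [mul_sub, mul_assoc, mul_assoc]
      have e2 : (Ψ q * flatForm 1 q u - flatForm 1 q u * Ψ q -
          (parallel A q * flatForm 1 q u - flatForm 1 q u * parallel A q)) * parallel B q =
          Δ q * flatForm 1 q u * parallel B q - flatForm 1 q u * (Δ q * parallel B q) := by
        rw [hΔ]
        noncomm_ring
      rw [e1, e2, Matrix.trace_sub, Matrix.trace_sub,
        Matrix.trace_mul_comm (flatForm 1 q u)]
      ring
    have d1 : ∀ q ∈ U, dAlong (fun q => (Δ q * parallel B q).trace) q = 0 := fun q hq =>
      hd q hq _ (h1 q hq)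
    have d2 : ∀ q ∈ U, dTurn (fun q => (Δ q * parallel B q).trace) q = 0 := fun q hq =>
      hd q hq _ (h2 q hq)
    -- A function with zero derivative in both contact directions has zero derivative along their
    -- bracket.
    have d3 : ∀ q ∈ U, dAcross (fun q => (Δ q * parallel B q).trace) q = 0 := fun q hq => by
      have h := dTurn_dAlong hU sF hq
      rw [(dFrame_zero hU d1 hq).2.1, (dFrame_zero hU d2 hq).1] at h
      linarith
    have h0 := eq_of_dirDeriv_eq_zero hU hc sF (fun q hq u => by
      rw [dirDeriv_frame, d1 q hq, d2 q hq, d3 q hq]; ring) hq hp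
    change (Δ q * parallel B q).trace = 0
    rw [h0, hΔ]
    simp only [hA, sub_self, zero_mul, Matrix.trace_zero]
  obtain ⟨G, Gi, hG, hGi, hpar, -⟩ := exists_parallel_eq_conj q
  refine sub_eq_zero.1 ((Matrix.ext_iff_trace_mul_right).2 fun X => ?_)
  have := key (G * X * Gi)
  rw [hpar (G * X * Gi), show Gi * (G * X * Gi) * G = (Gi * G) * X * (Gi * G) by
    simp only [mul_assoc], hGi, one_mul, mul_one] at this
  rw [this, zero_mul, Matrix.trace_zero]

theorem exists_parallel_eq {Ψ : Mat} (hΨ : Ψ ∈ sp4) (p : Pos) : ∃ A ∈ sp4, parallel A p = Ψ := by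
  obtain ⟨G, Gi, hG, hGi, hpar, -, hmem⟩ := exists_parallel_eq_conj p
  refine ⟨G * Ψ * Gi, hmem Ψ hΨ, ?_⟩
  rw [hpar, show Gi * (G * Ψ * Gi) * G = (Gi * G) * Ψ * (Gi * G) by simp only [mul_assoc], hGi,
    one_mul, mul_one]

/-- If the field vanishes on an open set, so do the three entries of negative degree; their
derivatives, read in `parallel_entries`, give the degree 0 entries and then those of degrees 1 and
2. A parallel section vanishing at a point is zero. -/
theorem parallel_eq_zero_of_symmetryField {U : Set Pos} (hU : IsOpen U) {A : sp4}
    (h : ∀ p ∈ U, symmetryField A p = 0) {p : Pos} (hp : p ∈ U) : A = 0 := by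
  have hA := fun p => parallel_mem A.2 p
  have tab := fun p u => parallel_entries (hA p) (dMat_parallel A.1 p u)
  have key : ∀ {f : Pos → ℝ}, (∀ p ∈ U, f p = 0) → ∀ p ∈ U, ∀ u, dirDeriv f p u = 0 :=
    fun h0 p hp u => (dirDeriv_congr hU h0 hp u).trans (dirDeriv_const _ _ _)
  have m : ∀ p ∈ U, parallel A.1 p f₁ e₁ = 0 := fun p hp => by
    have := coAcross_symmetryField A p
    rw [h p hp, map_zero] at this; linarith
  have r : ∀ p ∈ U, parallel A.1 p e₂ e₁ = 0 := fun p hp => by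
    have := coTurn_symmetryField A p
    rw [h p hp, map_zero] at this; linarith
  have q : ∀ p ∈ U, parallel A.1 p f₂ e₁ = 0 := fun p hp => by
    have := coAlong_symmetryField A p
    rw [h p hp, map_zero] at this; linarith
  have a : ∀ p ∈ U, parallel A.1 p e₁ e₁ = 0 := fun p hp => by
    have := (tab p (across p)).1
    rw [key m p hp] at this
    simp at this; exact this
  have t : ∀ p ∈ U, parallel A.1 p e₂ f₂ = 0 := fun p hp => by
    have := (tab p (along p)).2.1
    rw [key r p hp] at this
    simpa using this
  have s : ∀ p ∈ U, parallel A.1 p e₂ e₂ = 0 := fun p hp => by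
    have := (tab p (turn p)).2.1
    rw [key r p hp, a p hp] at this
    simp at this
    linarith
  have c : ∀ p ∈ U, parallel A.1 p e₁ f₂ = 0 := fun p hp => by
    have := (tab p (across p)).2.1
    rw [key r p hp] at this
    simpa using this.symm
  have u : ∀ p ∈ U, parallel A.1 p f₂ e₂ = 0 := fun p hp => by
    have := (tab p (turn p)).2.2.1
    rw [key q p hp, m p hp] at this
    simp at this
    linarith
  have b : ∀ p ∈ U, parallel A.1 p e₁ e₂ = 0 := fun p hp => by
    have := (tab p (across p)).2.2.1
    rw [key q p hp, r p hp] at this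
    simpa using this
  have z : ∀ p ∈ U, parallel A.1 p e₁ f₁ = 0 := fun p hp => by
    have := (tab p (across p)).2.2.2.1
    rw [key a p hp] at this
    simpa using this.symm
  refine Subtype.ext (parallel_eq_zero (p := p) ?_)
  rw [eq_spMat (hA p), m p hp, r p hp, q p hp, a p hp, s p hp, t p hp, u p hp, b p hp, c p hp,
    z p hp]
  refine mat_ext_index (forall_index ?_ ?_ ?_ ?_) <;> simp [spMat]

/-- The value of the prolonged potential at one point determines A. Both sections are parallel, so
they agree on U, and the components of S are entries of the prolongation. -/
theorem existsUnique_symmetryField {ℓ : ℝ} (hℓ : 0 < ℓ) {U : Set Pos} (hU : IsOpen U)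
    (hc : IsConnected U) {S : Pos → E3}
    (hS : IsInfinitesimalSymmetry (inducedDistribution (gas ℓ)) (inducedCurves (gas ℓ)) U S) :
    ∃! A, ∀ p ∈ U, S p = symmetryField A p := by
  obtain ⟨p₀, hp₀⟩ := hc.nonempty
  set f : Pos → ℝ := fun q => coAcross q (S q) with hf
  have hpot : IsPotential U f := hS.isPotential hℓ hU
  obtain ⟨A, hA, hA0⟩ := exists_parallel_eq (prolong_mem f p₀) p₀
  have hall : ∀ q ∈ U, prolong f q = parallel A q := fun q hq =>
    eq_parallel_of_dMat hU hc.isPreconnected (smoothMat_prolong hU hpot.1)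
      (fun p hp => (hpot.dMat_prolong hU hp).1) (fun p hp => (hpot.dMat_prolong hU hp).2) hp₀
      hA0.symm hq
  have hSA : ∀ p ∈ U, S p = symmetryField ⟨A, hA⟩ p := fun p hp => by
    obtain ⟨c1, c2⟩ := hS.components hℓ hU hp
    apply frame_ext (p := p)
    · rw [coAlong_symmetryField, ← hall p hp, c1]
      rfl
    · rw [coTurn_symmetryField, ← hall p hp, c2]
      simp [prolong, spMat]
      rfl
    · rw [coAcross_symmetryField, ← hall p hp]
      simp [prolong, spMat, hf]
  refine ⟨⟨A, hA⟩, hSA, fun B hB => sub_eq_zero.1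
    (parallel_eq_zero_of_symmetryField hU (fun p hp => ?_) hp₀)⟩
  rw [map_sub, Pi.sub_apply, ← hB p hp, ← hSA p hp, sub_self]

/-! ## The parabolic subgroup -/

theorem inParabolic_one : InParabolic 1 :=
  ⟨one_mem _, fun _ hi => Matrix.one_apply_ne hi⟩

theorem PreservesLine.mul_apply {A B : Mat} (hB : PreservesLine B) (i : Fin 2 ⊕ Fin 2) :
    (A * B) i e₁ = A i e₁ * B e₁ e₁ := by
  rw [mat_mul_apply, hB e₂ (by simp), hB f₁ (by simp), hB f₂ (by simp)]; ring

theorem InParabolic.mul {h k : Mat} (hh : InParabolic h) (hk : InParabolic k) :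
    InParabolic (h * k) :=
  ⟨mul_mem hh.1 hk.1, fun i hi => by rw [hk.2.mul_apply, hh.2 i hi, zero_mul]⟩

theorem InParabolic.inv_mul {h : Mat} (hh : InParabolic h) : h⁻¹ * h = 1 := by
  rw [inv_eq_sympInv hh.1]; exact sympInv_mul hh.1

theorem InParabolic.mul_inv {h : Mat} (hh : InParabolic h) : h * h⁻¹ = 1 :=
  mul_eq_one_comm.1 hh.inv_mul

theorem InParabolic.inv_apply_mul {h : Mat} (hh : InParabolic h) (i : Fin 2 ⊕ Fin 2) :
    h⁻¹ i e₁ * h e₁ e₁ = (1 : Mat) i e₁ := by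
  rw [← hh.2.mul_apply, hh.inv_mul]

theorem InParabolic.ne_zero {h : Mat} (hh : InParabolic h) : h e₁ e₁ ≠ 0 := fun h0 => by
  have := hh.inv_apply_mul e₁
  rw [h0, mul_zero, Matrix.one_apply_eq] at this
  exact zero_ne_one this

theorem InParabolic.inv {h : Mat} (hh : InParabolic h) : InParabolic h⁻¹ := by
  refine ⟨?_, fun i hi => ?_⟩
  · rw [inv_eq_sympInv hh.1]
    exact SymplecticGroup.neg_mem (mul_mem (mul_mem (SymplecticGroup.J_mem _ _)
      (SymplecticGroup.transpose_mem hh.1)) (SymplecticGroup.J_mem _ _))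
  · have := hh.inv_apply_mul i
    rw [Matrix.one_apply_ne hi] at this
    exact (mul_eq_zero.1 this).resolve_right hh.ne_zero

theorem InParabolic.inv_inv {h : Mat} (hh : InParabolic h) : h⁻¹⁻¹ = h :=
  Matrix.inv_eq_left_inv hh.mul_inv

/-- The last row of the inverse of an element of the parabolic subgroup. -/
theorem InParabolic.inv_row {h : Mat} (hh : InParabolic h) (A : Mat) (j : Fin 2 ⊕ Fin 2) :
    (h⁻¹ * A) f₁ j = h e₁ e₁ * A f₁ j := by
  -- In h⁻¹ = -J hᵀ J the row of f₁ is, up to signs and order, the column of e₁ in h, which has a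
  -- single nonzero entry.
  rw [inv_eq_sympInv hh.1, sympInv, J_entries, mat_mul_apply]
  simp [mat_mul_apply, hh.2 e₂ (by simp), hh.2 f₁ (by simp), hh.2 f₂ (by simp)]

/-! ## Changes of gauge -/

/-- The form `θ'` is the transform of `θ` by the function `h` with values in the parabolic
subgroup. -/
structure IsTransform (U : Set Pos) (h : Pos → Mat) (θ θ' : Form Mat) : Prop where
  smooth : SmoothMat U h
  mem : ∀ p ∈ U, InParabolic (h p)
  eq : ∀ p ∈ U, ∀ u, θ' p u = (h p)⁻¹ * θ p u * h p + (h p)⁻¹ * dMat h p u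

theorem compatible_iff {g g' : Set Pos × Form Mat} : Compatible g g' ↔
    ∀ p ∈ g.1 ∩ g'.1, ∃ W : Set Pos, IsOpen W ∧ p ∈ W ∧ W ⊆ g.1 ∩ g'.1 ∧
      ∃ h, IsTransform W h g.2 g'.2 :=
  forall₂_congr fun _ _ => exists_congr fun _ => and_congr_right fun _ => and_congr_right fun _ =>
    and_congr_right fun _ => exists_congr fun _ =>
      ⟨fun ⟨a, b⟩ => ⟨a, fun q hq => (b q hq).1, fun q hq => (b q hq).2⟩,
        fun h => ⟨h.smooth, fun q hq => ⟨h.mem q hq, h.eq q hq⟩⟩⟩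

section Transform

variable {U : Set Pos} {h k : Pos → Mat} {θ θ' θ'' : Form Mat} {p : Pos}

theorem SmoothMat.sympInv (hh : SmoothMat U h) : SmoothMat U fun p => sympInv (h p) :=
  (((smoothMat_const U _).mul hh.transpose).mul (smoothMat_const U _)).neg

theorem IsTransform.smooth_inv (ht : IsTransform U h θ θ') : SmoothMat U fun p => (h p)⁻¹ :=
  ht.smooth.sympInv.congr fun p hp => inv_eq_sympInv (ht.mem p hp).1

theorem IsTransform.mono {W : Set Pos} (ht : IsTransform U h θ θ') (hW : W ⊆ U) :
    IsTransform W h θ θ' :=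
  ⟨ht.smooth.mono hW, fun p hp => ht.mem p (hW hp), fun p hp => ht.eq p (hW hp)⟩

theorem isTransform_refl (U : Set Pos) (θ : Form Mat) : IsTransform U (fun _ => 1) θ θ :=
  ⟨smoothMat_const U 1, fun _ _ => inParabolic_one, fun p _ u => by
    rw [dMat_const, inv_one, one_mul, mul_one, mul_zero, add_zero]⟩

theorem IsTransform.dMat_inv (hU : IsOpen U) (ht : IsTransform U h θ θ') (hp : p ∈ U) (u : E3) :
    dMat (fun q => (h q)⁻¹) p u = -((h p)⁻¹ * dMat h p u * (h p)⁻¹) := by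
  have e := dMat_congr (M := fun q => (h q)⁻¹ * h q) (N := fun _ => 1) hU
    (fun q hq => (ht.mem q hq).inv_mul) hp u
  rw [dMat_const, dMat_mul (ht.smooth_inv.diffAt hU hp) (ht.smooth.diffAt hU hp)] at e
  have hk := (ht.mem p hp).mul_inv
  calc dMat (fun q => (h q)⁻¹) p u = dMat (fun q => (h q)⁻¹) p u * (h p * (h p)⁻¹) := by
        rw [hk, mul_one]
    _ = (dMat (fun q => (h q)⁻¹) p u * h p + (h p)⁻¹ * dMat h p u) * (h p)⁻¹ -
        (h p)⁻¹ * dMat h p u * (h p)⁻¹ := by rw [add_mul, mul_assoc, add_sub_cancel_right]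
    _ = _ := by rw [e, zero_mul, zero_sub]

theorem IsTransform.symm (hU : IsOpen U) (ht : IsTransform U h θ θ') :
    IsTransform U (fun p => (h p)⁻¹) θ' θ := by
  refine ⟨ht.smooth_inv, fun p hp => (ht.mem p hp).inv, fun p hp u => ?_⟩
  have hk := (ht.mem p hp).mul_inv
  rw [ht.dMat_inv hU hp, (ht.mem p hp).inv_inv, ht.eq p hp u, mul_add, add_mul,
    show h p * ((h p)⁻¹ * θ p u * h p) * (h p)⁻¹ = (h p * (h p)⁻¹) * θ p u * (h p * (h p)⁻¹) by
      simp only [mul_assoc], mul_neg]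
  simp only [hk, ← mul_assoc, one_mul, mul_one]
  abel

theorem IsTransform.trans (hU : IsOpen U) (ht : IsTransform U h θ θ')
    (ht' : IsTransform U k θ' θ'') : IsTransform U (fun p => h p * k p) θ θ'' := by
  refine ⟨ht.smooth.mul ht'.smooth, fun p hp => (ht.mem p hp).mul (ht'.mem p hp), fun p hp u => ?_⟩
  rw [dMat_mul (ht.smooth.diffAt hU hp) (ht'.smooth.diffAt hU hp), ht'.eq p hp, ht.eq p hp,
    Matrix.mul_inv_rev]
  have hk : ∀ A, (h p)⁻¹ * (h p * A) = A := fun A => by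
    rw [← mul_assoc, (ht.mem p hp).inv_mul, one_mul]
  simp only [mul_add, add_mul, mul_assoc, hk]
  abel

theorem dMat_dMat_comm {M : Pos → Mat} (hU : IsOpen U) (hM : SmoothMat U M) (hp : p ∈ U)
    (u v : E3) : dMat (fun q => dMat M q v) p u = dMat (fun q => dMat M q u) p v := by
  ext i j
  have h := dirDeriv_bracket hU (hM i j) (smoothOn_const U u) (smoothOn_const U v) hp
  rw [bracket_eq, dirDeriv_const, dirDeriv_const, sub_zero, CarGeometry.dirDeriv, map_zero] at h
  exact (sub_eq_zero.1 h.symm)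

theorem SmoothMat.dMat {M : Pos → Mat} (hU : IsOpen U) (hM : SmoothMat U M) (v : E3) :
    SmoothMat U fun q => dMat M q v := fun i j =>
  SmoothOn.dirDeriv hU (hM i j) (smoothOn_const U v)

/-- The derivative of a transformed gauge. -/
theorem IsTransform.dMat_eq (hU : IsOpen U) (hθ : ∀ u, SmoothMat U fun p => θ p u)
    (ht : IsTransform U h θ θ') (hp : p ∈ U) (u v : E3) :
    dMat (fun q => θ' q v) p u =
      -((h p)⁻¹ * dMat h p u * (h p)⁻¹) * θ p v * h p + (h p)⁻¹ * dMat (fun q => θ q v) p u * h p +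
        (h p)⁻¹ * θ p v * dMat h p u - (h p)⁻¹ * dMat h p u * (h p)⁻¹ * dMat h p v +
        (h p)⁻¹ * dMat (fun q => dMat h q v) p u := by
  have s1 := ht.smooth_inv
  have s2 := hθ v
  have s3 := ht.smooth
  have s4 := s3.dMat hU v
  rw [dMat_congr hU (fun q hq => ht.eq q hq v) hp,
    dMat_add (((s1.mul s2).mul s3).diffAt hU hp) ((s1.mul s4).diffAt hU hp),
    dMat_mul ((s1.mul s2).diffAt hU hp) (s3.diffAt hU hp),
    dMat_mul (s1.diffAt hU hp) (s2.diffAt hU hp), dMat_mul (s1.diffAt hU hp) (s4.diffAt hU hp),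
    ht.dMat_inv hU hp]
  noncomm_ring

theorem IsTransform.curvature_eq (hU : IsOpen U) (hθ : ∀ u, SmoothMat U fun p => θ p u)
    (ht : IsTransform U h θ θ') (hp : p ∈ U) (u v : E3) :
    curvature θ' p u v = (h p)⁻¹ * curvature θ p u v * h p := by
  have hk : ∀ A, h p * ((h p)⁻¹ * A) = A := fun A => by
    rw [← mul_assoc, (ht.mem p hp).mul_inv, one_mul]
  rw [CarGeometry.curvature_eq, CarGeometry.curvature_eq, ht.dMat_eq hU hθ hp,
    ht.dMat_eq hU hθ hp, ht.eq p hp, ht.eq p hp, mat_lie, mat_lie, dMat_dMat_comm hU ht.smooth hp u v]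
  simp only [mul_add, add_mul, mul_sub, sub_mul, neg_mul, mul_assoc, hk]
  abel

/-- The covariant derivative of `θ(v)` along a curve with velocity `v` and acceleration `w`, as an
endomorphism. -/
def acceleration (θ : Form Mat) (p : Pos) (v w : E3) : Mat :=
  dMat (fun q => θ q v) p v + θ p w + θ p v * θ p v

theorem IsTransform.acceleration_eq (hU : IsOpen U) (hθ : ∀ u, SmoothMat U fun p => θ p u)
    (ht : IsTransform U h θ θ') (hp : p ∈ U) (v w : E3) :
    acceleration θ' p v w = (h p)⁻¹ * acceleration θ p v w * h p +
      (2 : ℝ) • ((h p)⁻¹ * θ p v * dMat h p v) + (h p)⁻¹ * dMat (fun q => dMat h q v) p v +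
      (h p)⁻¹ * dMat h p w := by
  have hk : ∀ A, h p * ((h p)⁻¹ * A) = A := fun A => by
    rw [← mul_assoc, (ht.mem p hp).mul_inv, one_mul]
  rw [acceleration, acceleration, ht.dMat_eq hU hθ hp, ht.eq p hp, ht.eq p hp, two_smul]
  simp only [mul_add, add_mul, neg_mul, mul_assoc, hk]
  abel

theorem preservesLine_dMat (hU : IsOpen U) {M : Pos → Mat} (hM : ∀ p ∈ U, PreservesLine (M p))
    (hp : p ∈ U) (u : E3) : PreservesLine (dMat M p u) := fun i hi =>
  (dirDeriv_congr hU (f := fun q => M q i e₁) (g := fun _ => 0) (fun q hq => hM q hq i hi) hp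
    u).trans (dirDeriv_const _ _ _)

theorem IsTransform.apply_col (hU : IsOpen U) (ht : IsTransform U h θ θ') (hp : p ∈ U) (u : E3) :
    ∃ x, ∀ i, θ' p u i e₁ = ((h p)⁻¹ * θ p u) i e₁ * h p e₁ e₁ + x * (1 : Mat) i e₁ := by
  have hd := preservesLine_dMat hU (fun q hq => (ht.mem q hq).2) hp u
  refine ⟨dMat h p u e₁ e₁ / h p e₁ e₁, fun i => ?_⟩
  rw [ht.eq p hp, Matrix.add_apply, (ht.mem p hp).2.mul_apply, hd.mul_apply,
    ← (ht.mem p hp).inv_apply_mul i]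
  have := (ht.mem p hp).ne_zero
  field_simp

/-- The factor is a square, so changes of gauge preserve the co-orientation, and the flat gauges
with ε = 1 and ε = -1 are not equivalent. -/
theorem IsTransform.apply_contact (hU : IsOpen U) (ht : IsTransform U h θ θ') (hp : p ∈ U)
    (u : E3) : θ' p u f₁ e₁ = h p e₁ e₁ ^ 2 * θ p u f₁ e₁ := by
  obtain ⟨x, hx⟩ := ht.apply_col hU hp u
  rw [hx, (ht.mem p hp).inv_row]
  simp
  ring

/-- The condition on a curve to develop into a projective line is invariant. -/
theorem IsTransform.acceleration_mem (hU : IsOpen U) (hθ : ∀ u, SmoothMat U fun p => θ p u)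
    (ht : IsTransform U h θ θ') (hp : p ∈ U) {v w : E3}
    (H : ∃ a b : ℝ, ∀ i, acceleration θ p v w i e₁ = a * (1 : Mat) i e₁ + b * θ p v i e₁) :
    ∃ a b : ℝ, ∀ i, acceleration θ' p v w i e₁ = a * (1 : Mat) i e₁ + b * θ' p v i e₁ := by
  obtain ⟨a, b, H⟩ := H
  obtain ⟨x, hx⟩ := ht.apply_col hU hp v
  have hm := fun q hq => (ht.mem q hq).2
  have h1 := preservesLine_dMat hU hm hp v
  have h2 := preservesLine_dMat hU hm hp w
  have h3 := preservesLine_dMat hU (fun q hq => preservesLine_dMat hU hm hq v) hp v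
  have hr := (ht.mem p hp).ne_zero
  have hA : ∀ i, ((h p)⁻¹ * acceleration θ p v w) i e₁ =
      a * (h p)⁻¹ i e₁ + b * ((h p)⁻¹ * θ p v) i e₁ := fun i => by
    rw [mat_mul_apply, mat_mul_apply, H, H, H, H]
    simp
    ring
  have hy : ∀ i, ((h p)⁻¹ * θ p v) i e₁ = (θ' p v i e₁ - x * (1 : Mat) i e₁) / h p e₁ e₁ :=
    fun i => by rw [hx]; field_simp; ring
  have hz : ∀ i, (h p)⁻¹ i e₁ = (1 : Mat) i e₁ / h p e₁ e₁ := fun i => by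
    rw [← (ht.mem p hp).inv_apply_mul i]; field_simp
  refine ⟨a - b * x - 2 * dMat h p v e₁ e₁ * x / h p e₁ e₁ +
    (dMat (fun q => dMat h q v) p v e₁ e₁ + dMat h p w e₁ e₁) / h p e₁ e₁,
    b + 2 * dMat h p v e₁ e₁ / h p e₁ e₁, fun i => ?_⟩
  rw [ht.acceleration_eq hU hθ hp, Matrix.add_apply, Matrix.add_apply, Matrix.add_apply,
    Matrix.smul_apply, smul_eq_mul, (hm p hp).mul_apply, h1.mul_apply, h2.mul_apply, h3.mul_apply,
    hA, hy, hz]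
  field_simp
  ring

end Transform

theorem Compatible.symm {g g' : Set Pos × Form Mat} (h : Compatible g g') : Compatible g' g := by
  rw [compatible_iff] at h ⊢
  intro p hp
  obtain ⟨W, hW, hpW, hWs, k, hk⟩ := h p hp.symm
  exact ⟨W, hW, hpW, fun q hq => (hWs hq).symm, _, hk.symm hW⟩

/-- The middle gauge has to be global: otherwise nothing is known at common points of the outer
domains where it is undefined. -/
theorem Compatible.trans {g g' g'' : Set Pos × Form Mat} (h : Compatible g g')
    (h' : Compatible g' g'') (hg : g'.1 = Set.univ) : Compatible g g'' := by
  rw [compatible_iff] at h h' ⊢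
  intro p hp
  obtain ⟨W, hW, hpW, hWs, k, hk⟩ := h p ⟨hp.1, hg ▸ trivial⟩
  obtain ⟨W', hW', hpW', hWs', k', hk'⟩ := h' p ⟨hg ▸ trivial, hp.2⟩
  exact ⟨W ∩ W', hW.inter hW', ⟨hpW, hpW'⟩, fun q hq => ⟨(hWs hq.1).1, (hWs' hq.2).2⟩, _,
    (hk.mono Set.inter_subset_left).trans (hW.inter hW') (hk'.mono Set.inter_subset_right)⟩

/-! ## The flat Cartan connection -/

theorem isCartanGauge_flatForm {ε : ℝ} (hε : ε ≠ 0) :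
    IsCartanGauge Set.univ (flatForm ε) where
  isOpen := isOpen_univ
  smooth u := smoothMat_flatForm ε _ u
  mem p _ u := flatForm_mem ε p u
  iso p _ u h := by
    have h1 := h f₁ (by simp)
    have h2 := h f₂ (by simp)
    have h3 := h e₂ (by simp)
    rw [flatForm_apply] at h1 h2 h3
    simp [spMat, hε] at h1 h2 h3
    exact frame_ext (p := p) (by rw [h2, map_zero]) (by rw [h3, map_zero]) (by rw [h1, map_zero])

theorem SmoothForm.apply {U : Set Pos} {lam : Form ℝ} (hs : SmoothForm U lam) {V : Pos → E3}
    (hV : SmoothOn U V) : SmoothOn U fun p => lam p (V p) :=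
  (((hV.fst.mul (hs _)).add (hV.snd.mul (hs _))).add (hV.thd.mul (hs _))).congr
    fun p _ => form_eq_sum lam p _

/-- A contact form for the distribution has a constant sign with respect to `coAcross`. -/
theorem exists_sign {lam : Form ℝ} (hs : SmoothForm Set.univ lam)
    (hker : ∀ p, LinearMap.ker (lam p) = LinearMap.ker (coAcross p)) :
    ∃ ε : ℝ, ε * ε = 1 ∧ ∃ φ : Pos → ℝ, ∀ p, 0 < φ p ∧ ∀ u, ε * coAcross p u = φ p * lam p u := by
  set ψ : Pos → ℝ := fun p => lam p (across p) with hψ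
  have hlam : ∀ p u, lam p u = ψ p * coAcross p u := fun p u => by
    have h1 : u - coAcross p u • across p ∈ LinearMap.ker (lam p) := by
      rw [hker, LinearMap.mem_ker, map_sub, map_smul, coAcross_across]; simp
    rw [LinearMap.mem_ker, map_sub, map_smul, sub_eq_zero] at h1
    rw [h1, smul_eq_mul, mul_comm]
  have hne : ∀ p, ψ p ≠ 0 := fun p h0 => by
    have : across p ∈ LinearMap.ker (coAcross p) := by rw [← hker, LinearMap.mem_ker]; exact h0
    rw [LinearMap.mem_ker, coAcross_across] at this
    exact one_ne_zero this
  have hsm : SmoothOn Set.univ ψ := hs.apply (smoothOn_across _)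
  have hcont : Continuous fun c : E3 => ψ (Coords.cov c) := by
    have h : ContDiffOn ℝ ∞ (fun c : E3 => ψ (Coords.cov c)) Set.univ := hsm
    exact continuousOn_univ.1 h.continuousOn
  -- The factor between the two contact forms never vanishes, so it has constant sign on the
  -- connected covering space.
  have hsign : (∀ c : E3, 0 < ψ (Coords.cov c)) ∨ ∀ c : E3, ψ (Coords.cov c) < 0 := by
    by_contra! hcon
    obtain ⟨⟨c, hc⟩, c', hc'⟩ := hcon
    obtain ⟨d, hd⟩ := mem_range_of_exists_le_of_exists_ge hcont ⟨c, hc⟩ ⟨c', hc'⟩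
    exact hne _ hd
  rcases hsign with h | h
  · refine ⟨1, by norm_num, fun p => (ψ p)⁻¹, fun p => ⟨?_, fun u => ?_⟩⟩
    · have := h (Coords.lift p)
      rw [Coords.cov_lift] at this
      exact inv_pos.2 this
    · rw [hlam p u, one_mul, inv_mul_cancel_left₀ (hne p)]
  · refine ⟨-1, by norm_num, fun p => -(ψ p)⁻¹, fun p => ⟨?_, fun u => ?_⟩⟩
    · have := h (Coords.lift p)
      rw [Coords.cov_lift] at this
      exact neg_pos.2 (inv_lt_zero.2 this)
    · rw [hlam p u, neg_mul, neg_mul, inv_mul_cancel_left₀ (hne p), one_mul]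

/-- The condition on the curves in a Cartan gauge, in terms of velocity and acceleration. -/
theorem deriv_gauge {U : Set Pos} {θ : Form Mat} (hθ : IsCartanGauge U θ) {c : ℝ → E3}
    (hc : ContDiff ℝ ∞ c) {t : ℝ} (ht : (Coords.cov (c t) : Pos) ∈ U) (i : Fin 2 ⊕ Fin 2) :
    deriv (fun s => θ (Coords.cov (c s)) (deriv c s) i e₁) t +
        (θ (Coords.cov (c t)) (deriv c t) * θ (Coords.cov (c t)) (deriv c t)) i e₁ =
      acceleration θ (Coords.cov (c t)) (deriv c t) (deriv (deriv c) t) i e₁ := by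
  let lam : Form ℝ := fun p => (Matrix.entryLinearMap ℝ ℝ i e₁).comp (θ p)
  have h := hasDerivAt_form (lam := lam) hθ.isOpen (fun u => hθ.smooth u i e₁) hc ht
  have h' : deriv (fun s => θ (Coords.cov (c s)) (deriv c s) i e₁) t = _ := h.deriv
  rw [h', acceleration, Matrix.add_apply, Matrix.add_apply]
  rfl

/-- The curves of the car develop into projective lines in the flat gauge: the transverse part of
the acceleration cancels the derivative of the form, and what remains is parallel to the velocity
modulo e₁. -/
theorem acceleration_flatForm {ε a b : ℝ} (h : a ≠ 0 ∨ b ≠ 0) {p : Pos} {v w : E3}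
    (hv : coAcross p v = 0) (hv' : a * coTurn p v = b * coAlong p v) (hne : v ≠ 0)
    (hw : coAcross p w = coTurn p v * coAlong p v) (hw' : a * coTurn p w = b * coAlong p w) :
    ∃ x y : ℝ, ∀ i, acceleration (flatForm ε) p v w i e₁ =
      x * (1 : Mat) i e₁ + y * flatForm ε p v i e₁ := by
  obtain ⟨k, k1, k2⟩ := parallel_of_mul_eq h hv'
  obtain ⟨l, l1, l2⟩ := parallel_of_mul_eq h hw'
  have hk : k ≠ 0 := by
    rintro rfl
    exact hne (by rw [frame_decomp p v, hv, k1, k2]; simp)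
  -- The coefficient of e₁ comes from turnMat² = -1/4; l/k is the ratio of the contact parts of
  -- acceleration and velocity, both multiples of (a, b).
  refine ⟨-(coTurn p v * coTurn p v) / 4, l / k, ?_⟩
  rw [acceleration, dMat_flatForm, flatForm_apply, flatForm_apply]
  refine forall_index ?_ ?_ ?_ ?_ <;>
    simp [mat_mul_apply, spMat, alongMat, acrossMat, hv, hw, k1, k2, l1, l2] <;> field_simp <;> ring

theorem acceleration_flatForm_of_mem {ℓ : ℝ} (hℓ : 0 < ℓ) (ε : ℝ) {K : Set Pos}
    (hK : K ∈ inducedCurves (gas ℓ)) {c : ℝ → E3} (hc : Parametrizes c K) (t : ℝ) :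
    ∃ x y : ℝ, ∀ i, acceleration (flatForm ε) (Coords.cov (c t)) (deriv c t)
        (deriv (deriv c) t) i e₁ =
      x * (1 : Mat) i e₁ + y * flatForm ε (Coords.cov (c t)) (deriv c t) i e₁ := by
  obtain ⟨a, b, q, hab, rfl⟩ := mem_inducedCurves hℓ hK
  obtain ⟨v1, v2⟩ := velocity_of_parametrizes hab hc t
  obtain ⟨w1, w2⟩ := acceleration_of_parametrizes hab hc t
  exact acceleration_flatForm hab v2 v1 (hc.2.1 t) w2 w1

section Compatible

variable {ε : ℝ} {U : Set Pos} {θ : Form Mat}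

theorem exists_isTransform (h : Compatible (Set.univ, flatForm ε) (U, θ)) {p : Pos} (hp : p ∈ U) :
    ∃ W, IsOpen W ∧ p ∈ W ∧ ∃ h, IsTransform W h (flatForm ε) θ := by
  obtain ⟨W, hW, hpW, -, h⟩ := compatible_iff.1 h p ⟨trivial, hp⟩
  exact ⟨W, hW, hpW, h⟩

theorem curvature_eq_zero_of_compatible (h : Compatible (Set.univ, flatForm ε) (U, θ)) {p : Pos}
    (hp : p ∈ U) (u v : E3) : curvature θ p u v = 0 := by
  obtain ⟨W, hW, hpW, h, ht⟩ := exists_isTransform h hp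
  rw [ht.curvature_eq hW (smoothMat_flatForm ε W) hpW, curvature_flatForm, mul_zero, zero_mul]

/-- Regularity and normality are automatic as the curvature vanishes; the contact form and the
condition on curves are carried over from the flat gauge by invariance under transforms. -/
theorem induces_of_compatible {ℓ : ℝ} (hℓ : 0 < ℓ) {lam : Form ℝ} {φ : Pos → ℝ}
    (hφ : ∀ p, 0 < φ p ∧ ∀ u, ε * coAcross p u = φ p * lam p u) (hθ : IsCartanGauge U θ)
    (h : Compatible (Set.univ, flatForm ε) (U, θ)) :
    Induces U θ lam (inducedCurves (gas ℓ)) ∧ IsNormal U θ := by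
  refine ⟨⟨fun p hp => ?_, fun p hp u v _ _ => ?_, fun K hK c hc t htU => ?_⟩,
    fun p hp u _ k => ?_⟩
  · obtain ⟨W, hW, hpW, h, ht⟩ := exists_isTransform h hp
    have hr := (ht.mem p hpW).ne_zero
    refine ⟨h p e₁ e₁ ^ 2 * φ p, mul_pos (by positivity) (hφ p).1, fun u => ?_⟩
    have e : flatForm ε p u f₁ e₁ = ε * coAcross p u := by rw [flatForm_apply]; simp [spMat]
    rw [ht.apply_contact hW hpW, e, (hφ p).2, mul_assoc]
  · rw [curvature_eq_zero_of_compatible h hp]; rfl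
  · obtain ⟨W, hW, hpW, h, ht⟩ := exists_isTransform h htU
    obtain ⟨a, b, hab⟩ := ht.acceleration_mem hW (smoothMat_flatForm ε W) hpW
      (acceleration_flatForm_of_mem hℓ ε hK hc t)
    exact ⟨a, b, fun i => by rw [deriv_gauge hθ hc.1 htU, hab]⟩
  · simp only [curvature_eq_zero_of_compatible h hp, lie_zero, smul_zero, Finset.sum_const_zero,
      sub_zero]

end Compatible

/-- The flat Cartan connection, for the co-orientation `ε = ± 1`. -/
def flatConnection {ε : ℝ} (hε : ε ≠ 0) : CartanConnection where
  gauges := {g | IsCartanGauge g.1 g.2 ∧ Compatible (Set.univ, flatForm ε) g}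
  isGauge _ hg := hg.1
  covers _ := ⟨(Set.univ, flatForm ε), ⟨isCartanGauge_flatForm hε, compatible_iff.2 fun _ _ =>
    ⟨Set.univ, isOpen_univ, trivial, fun _ _ => ⟨trivial, trivial⟩, _, isTransform_refl _ _⟩⟩,
    trivial⟩
  compatible _ hg _ hg' := hg.2.symm.trans hg'.2 rfl
  maximal _ hg h := ⟨hg, (h (Set.univ, flatForm ε) ⟨isCartanGauge_flatForm hε,
    compatible_iff.2 fun _ _ => ⟨Set.univ, isOpen_univ, trivial, fun _ _ => ⟨trivial, trivial⟩, _,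
      isTransform_refl _ _⟩⟩).symm⟩

/-- A Cartan connection all of whose gauges are compatible with the flat gauge is the flat Cartan
connection. -/
theorem eq_flatConnection {ε : ℝ} (hε : ε ≠ 0) {conn : CartanConnection}
    (h : ∀ g ∈ conn.gauges, Compatible (Set.univ, flatForm ε) g) : conn = flatConnection hε := by
  ext g
  refine ⟨fun hg => ⟨conn.isGauge g hg, h g hg⟩, fun hg => conn.maximal g hg.1 fun g' hg' =>
    hg.2.symm.trans (h g' hg') rfl⟩

/-! ## Normal gauges -/

/-- The exterior derivatives on the contact distribution of a form that vanishes there. -/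
theorem extD_mul_of_vanishing {U : Set Pos} (hU : IsOpen U) {χ ν : Form ℝ} (hχ : SmoothForm U χ)
    (hν : SmoothForm U ν) (h : ∀ p ∈ U, ∀ u, ν p u = 0 → χ p u = 0) {p : Pos} (hp : p ∈ U)
    {u v : E3} (hu : ν p u = 0) (hv : ν p v = 0) (w : E3) :
    extD χ p u v * ν p w = χ p w * extD ν p u v := by
  have id1 : ∀ v, ∀ q ∈ U, χ q v * ν q w = χ q w * ν q v := fun v q hq => by
    have := h q hq (ν q w • v - ν q v • w) (by simp [mul_comm])
    simp only [map_sub, map_smul, smul_eq_mul] at this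
    linarith
  have d := fun v => (hχ v).diffAt hU hp
  have d' := fun v => (hν v).diffAt hU hp
  have key : ∀ u v, ν p v = 0 → dirDeriv (fun q => χ q v) p u * ν p w =
      χ p w * dirDeriv (fun q => ν q v) p u := fun u v hv => by
    have e := dirDeriv_congr hU (id1 v) hp u
    rw [dirDeriv_mul (d v) (d' w), dirDeriv_mul (d w) (d' v), h p hp v hv, hv] at e
    linarith
  rw [extD, extD, sub_mul, key u v hv, key v u hu]
  ring

/-- An entry of a matrix-valued form. -/
def entryForm (θ : Form Mat) (i j : Fin 2 ⊕ Fin 2) : Form ℝ := fun p =>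
  (Matrix.entryLinearMap ℝ ℝ i j).comp (θ p)

theorem entryForm_apply (θ : Form Mat) (i j : Fin 2 ⊕ Fin 2) (p : Pos) (u : E3) :
    entryForm θ i j p u = θ p u i j := rfl

/-- The tangent vectors `u i` correspond to the basis of `sp(2,ℝ)/𝔭`. -/
def IsFrame (θ : Form Mat) (p : Pos) (u : Fin 3 → E3) : Prop :=
  ∀ i, PreservesLine (θ p (u i) - negBasis i)

section Frame

variable {U : Set Pos} {θ η : Form Mat} {p : Pos}

theorem IsCartanGauge.eq_of_entries (hθ : IsCartanGauge U θ) (hp : p ∈ U) {u v : E3}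
    (h1 : θ p u f₁ e₁ = θ p v f₁ e₁) (h2 : θ p u e₂ e₁ = θ p v e₂ e₁)
    (h3 : θ p u f₂ e₁ = θ p v f₂ e₁) : u = v := by
  refine sub_eq_zero.1 (hθ.iso p hp _ fun i hi => ?_)
  rw [map_sub, Matrix.sub_apply, sub_eq_zero]
  revert hi
  revert i
  exact forall_index (fun h => absurd rfl h) (fun _ => h2) (fun _ => h1) (fun _ => h3)

theorem IsCartanGauge.exists_entries (hθ : IsCartanGauge U θ) (hp : p ∈ U) (a b c : ℝ) :
    ∃ u, θ p u f₁ e₁ = a ∧ θ p u e₂ e₁ = b ∧ θ p u f₂ e₁ = c := by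
  let L : E3 →ₗ[ℝ] ℝ × ℝ × ℝ := (entryForm θ f₁ e₁ p).prod
    ((entryForm θ e₂ e₁ p).prod (entryForm θ f₂ e₁ p))
  have hinj : Function.Injective L := fun u v huv =>
    hθ.eq_of_entries hp (congrArg Prod.fst huv) (congrArg (fun x => x.2.1) huv)
      (congrArg (fun x => x.2.2) huv)
  obtain ⟨u, hu⟩ := LinearMap.injective_iff_surjective.1 hinj (a, b, c)
  exact ⟨u, congrArg Prod.fst hu, congrArg (fun x => x.2.1) hu, congrArg (fun x => x.2.2) hu⟩

theorem isFrame_iff {u : Fin 3 → E3} : IsFrame θ p u ↔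
    (θ p (u 0) f₁ e₁ = 1 ∧ θ p (u 0) e₂ e₁ = 0 ∧ θ p (u 0) f₂ e₁ = 0) ∧
    (θ p (u 1) f₁ e₁ = 0 ∧ θ p (u 1) e₂ e₁ = 1 ∧ θ p (u 1) f₂ e₁ = 0) ∧
    (θ p (u 2) f₁ e₁ = 0 ∧ θ p (u 2) e₂ e₁ = 0 ∧ θ p (u 2) f₂ e₁ = 1) := by
  have key : ∀ A B : Mat, PreservesLine (A - B) ↔
      A f₁ e₁ = B f₁ e₁ ∧ A e₂ e₁ = B e₂ e₁ ∧ A f₂ e₁ = B f₂ e₁ := fun A B => by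
    refine ⟨fun h => ⟨sub_eq_zero.1 (h f₁ (by simp)), sub_eq_zero.1 (h e₂ (by simp)),
      sub_eq_zero.1 (h f₂ (by simp))⟩, fun ⟨h1, h2, h3⟩ => ?_⟩
    exact forall_index (fun h => absurd rfl h) (fun _ => sub_eq_zero.2 h2)
      (fun _ => sub_eq_zero.2 h1) (fun _ => sub_eq_zero.2 h3)
  simp only [IsFrame, Fin.forall_fin_succ, key]
  simp [negBasis]

theorem IsCartanGauge.exists_isFrame (hθ : IsCartanGauge U θ) (hp : p ∈ U) :
    ∃ u, IsFrame θ p u := by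
  obtain ⟨u0, h0⟩ := hθ.exists_entries hp 1 0 0
  obtain ⟨u1, h1⟩ := hθ.exists_entries hp 0 1 0
  obtain ⟨u2, h2⟩ := hθ.exists_entries hp 0 0 1
  exact ⟨![u0, u1, u2], isFrame_iff.2 ⟨h0, h1, h2⟩⟩

theorem IsFrame.decomp (hθ : IsCartanGauge U θ) (hp : p ∈ U) {u : Fin 3 → E3}
    (hu : IsFrame θ p u) (v : E3) :
    v = θ p v f₁ e₁ • u 0 + θ p v e₂ e₁ • u 1 + θ p v f₂ e₁ • u 2 := by
  obtain ⟨⟨a1, a2, a3⟩, ⟨b1, b2, b3⟩, c1, c2, c3⟩ := isFrame_iff.1 hu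
  apply hθ.eq_of_entries hp <;>
    simp only [map_add, map_smul, Matrix.add_apply, Matrix.smul_apply, smul_eq_mul, a1, a2, a3, b1,
      b2, b3, c1, c2, c3] <;> ring

/-- The components of the normality condition. -/
theorem IsNormal.components (hn : IsNormal U θ) (hp : p ∈ U) {u : Fin 3 → E3}
    (hu : IsFrame θ p u) :
    ⁅posBasis 1, curvature θ p (u 0) (u 1)⁆ + ⁅posBasis 2, curvature θ p (u 0) (u 2)⁆ =
      (2⁻¹ : ℝ) • curvature θ p (u 1) (u 2) ∧
    ⁅posBasis 2, curvature θ p (u 1) (u 2)⁆ = ⁅posBasis 0, curvature θ p (u 0) (u 1)⁆ ∧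
    ⁅posBasis 1, curvature θ p (u 1) (u 2)⁆ = -⁅posBasis 0, curvature θ p (u 0) (u 2)⁆ := by
  have hanti : ∀ u v, curvature θ p u v = -curvature θ p v u := fun u v => by
    rw [curvature_eq, curvature_eq, mat_lie, mat_lie]; abel
  have hself : ∀ u, curvature θ p u u = 0 := fun u => by
    rw [curvature_eq, mat_lie, sub_self, sub_self, add_zero]
  -- The nilradical of 𝔭 is a Heisenberg algebra: in the dual basis its only nontrivial bracket is
  -- [Z₁, Z₂] = ½ Z₀.
  have hlie : ∀ i j k : Fin 3, Matrix.trace (⁅posBasis i, posBasis j⁆ * negBasis k) =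
      if i = 1 ∧ j = 2 ∧ k = 0 then 2⁻¹ else if i = 2 ∧ j = 1 ∧ k = 0 then -2⁻¹ else 0 := by
    intro i j k
    fin_cases i <;> fin_cases j <;> fin_cases k <;>
      simp [mat_trace, mat_mul_apply, mat_lie_apply, posBasis, negBasis] <;>
      norm_num
  have H := fun k => hn p hp u hu k
  simp only [hlie, Fin.sum_univ_three] at H
  have h0 := H 0
  have h1 := H 1
  have h2 := H 2
  simp only [hself, lie_zero, hanti (u 2) (u 1), hanti (u 1) (u 0), hanti (u 2) (u 0),
    lie_neg] at h0 h1 h2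
  simp at h0 h1 h2
  refine ⟨?_, ?_, ?_⟩
  · rw [← sub_eq_zero, ← h0]
    module
  · rw [← sub_eq_zero, sub_eq_add_neg, lie_skew, add_comm]
    exact h1
  · rw [lie_skew, ← lie_skew (posBasis 1)]
    exact (eq_neg_of_add_eq_zero_left h2).symm

theorem dMat_mem_sp4 {M : Pos → Mat} (hU : IsOpen U) (hM : ∀ p ∈ U, M p ∈ sp4) (hp : p ∈ U)
    (u : E3) : dMat M p u ∈ sp4 := by
  have h := dMat_congr hU (fun q hq => eq_spMat (hM q hq)) hp u
  rw [dMat_spMat] at h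
  rw [h]
  exact spMat_mem ..

theorem IsCartanGauge.curvature_mem (hθ : IsCartanGauge U θ) (hp : p ∈ U) (u v : E3) :
    curvature θ p u v ∈ sp4 :=
  add_mem (sub_mem (dMat_mem_sp4 hθ.isOpen (fun q hq => hθ.mem q hq v) hp u)
    (dMat_mem_sp4 hθ.isOpen (fun q hq => hθ.mem q hq u) hp v))
    (lie_mem_sp4 (hθ.mem p hp u) (hθ.mem p hp v))

/-- Each equation relates curvature entries of the same homogeneity. Some entries occur twice with
different factors, as in K = -A and K = 2A, which makes them vanish at once. -/
theorem IsNormal.entries (hθ : IsCartanGauge U θ) (hn : IsNormal U θ) (hp : p ∈ U)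
    {u : Fin 3 → E3} (hu : IsFrame θ p u) {A B K : Mat} (hA : A = curvature θ p (u 0) (u 1))
    (hB : B = curvature θ p (u 0) (u 2)) (hK : K = curvature θ p (u 1) (u 2)) :
    (-A f₁ e₁ = K f₂ e₁ ∧ B f₁ e₁ = K e₂ e₁ ∧ A e₂ e₁ + B f₂ e₁ = K e₁ e₁ ∧
      -A e₂ e₁ + B f₂ e₁ = K e₂ e₂ ∧ -(2 * B e₂ e₁) = K e₂ f₂ ∧ -(2 * A f₂ e₁) = K f₂ e₂ ∧
      A e₂ e₂ - A e₁ e₁ + B f₂ e₂ = K e₁ e₂ ∧ A e₂ f₂ - B e₂ e₂ - B e₁ e₁ = K e₁ f₂ ∧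
      2 * A e₁ f₂ - 2 * B e₁ e₂ = K e₁ f₁) ∧
    (K f₂ e₁ = 2 * A f₁ e₁ ∧ K f₂ e₂ = 2 * A f₂ e₁ ∧ K e₂ e₂ + K e₁ e₁ = 2 * A e₂ e₁ ∧
      K e₁ e₂ = 2 * A e₁ e₁) ∧
    (K e₂ e₁ = -(2 * B f₁ e₁) ∧ K e₂ f₂ = 2 * B e₂ e₁ ∧ K e₁ f₂ = 2 * B e₁ e₁) := by
  obtain ⟨h0, h1, h2⟩ := hn.components hp hu
  have mA := hθ.curvature_mem hp (u 0) (u 1)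
  have mB := hθ.curvature_mem hp (u 0) (u 2)
  have mK := hθ.curvature_mem hp (u 1) (u 2)
  rw [← hA] at h0 h1 mA
  rw [← hB] at h0 h2 mB
  rw [← hK] at h0 h1 h2 mK
  clear hA hB hK
  rw [eq_spMat mA, eq_spMat mB, eq_spMat mK] at h0
  rw [eq_spMat mA, eq_spMat mK] at h1
  rw [eq_spMat mB, eq_spMat mK] at h2
  have E0 := fun i j => congrFun (congrFun h0 i) j
  have E1 := fun i j => congrFun (congrFun h1 i) j
  have E2 := fun i j => congrFun (congrFun h2 i) j
  simp only [Matrix.add_apply, Matrix.smul_apply, Matrix.neg_apply, mat_lie_apply,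
    smul_eq_mul] at E0 E1 E2
  have a1 := E0 f₂ e₁
  have a2 := E0 e₂ e₁
  have a3 := E0 e₁ e₁
  have a4 := E0 e₂ e₂
  have a5 := E0 e₂ f₂
  have a6 := E0 f₂ e₂
  have a7 := E0 e₁ e₂
  have a8 := E0 e₁ f₂
  have a9 := E0 e₁ f₁
  have b1 := E1 e₁ e₁
  have b2 := E1 e₁ e₂
  have b3 := E1 e₁ f₂
  have b4 := E1 e₁ f₁
  have c1 := E2 e₁ e₁
  have c2 := E2 e₁ f₂
  have c3 := E2 e₁ f₁
  simp [posBasis, negBasis, spMat] at a1 a2 a3 a4 a5 a6 a7 a8 a9 b1 b2 b3 b4 c1 c2 c3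
  refine ⟨⟨?_, ?_, ?_, ?_, ?_, ?_, ?_, ?_, ?_⟩, ⟨?_, ?_, ?_, ?_⟩, ?_, ?_, ?_⟩ <;> linarith

end Frame

/-! ## Uniqueness of normal gauges with a given negative part -/

/-- A gauge `θ` and a flat gauge `η` with the same values modulo `𝔭`, such that the curves of the
flat gauge satisfy the condition on curves for `θ`. -/
structure IsDeformation (U : Set Pos) (θ η : Form Mat) : Prop where
  gauge : IsCartanGauge U θ
  gauge' : IsCartanGauge U η
  flat : ∀ p ∈ U, ∀ u v, curvature η p u v = 0
  line : ∀ p ∈ U, ∀ u, PreservesLine (θ p u - η p u)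
  normal : IsNormal U θ
  curves : ∀ p ∈ U, ∀ v, θ p v f₁ e₁ = 0 →
    ∃ a b : ℝ, ∀ i, ((θ p v - η p v) * θ p v) i e₁ = a * (1 : Mat) i e₁ + b * θ p v i e₁
  scale : ∀ p ∈ U, ∃ v, θ p v f₁ e₁ ≠ 0 ∧ θ p v e₁ e₁ = η p v e₁ e₁

namespace IsDeformation

variable {U : Set Pos} {θ η : Form Mat} {p : Pos}

theorem curvature_eq (hd : IsDeformation U θ η) (hp : p ∈ U) (u v : E3) (i j : Fin 2 ⊕ Fin 2) :
    curvature θ p u v i j = extD (entryForm (θ - η) i j) p u v +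
      (⁅θ p u, (θ - η) p v⁆ - ⁅θ p v, (θ - η) p u⁆ - ⁅(θ - η) p u, (θ - η) p v⁆) i j := by
  have h := hd.flat p hp u v
  have hU := hd.gauge.isOpen
  have dθ := fun u => SmoothMat.diffAt hU (hd.gauge.smooth u) hp
  have dη := fun u => SmoothMat.diffAt hU (hd.gauge'.smooth u) hp
  have e : extD (entryForm (θ - η) i j) p u v =
      (dMat (fun q => θ q v) p u - dMat (fun q => θ q u) p v -
        (dMat (fun q => η q v) p u - dMat (fun q => η q u) p v)) i j := by
    have e1 : dirDeriv (fun q => entryForm (θ - η) i j q v) p u =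
        dirDeriv (fun q => θ q v i j) p u - dirDeriv (fun q => η q v i j) p u :=
      dirDeriv_sub (dθ v i j) (dη v i j) u
    have e2 : dirDeriv (fun q => entryForm (θ - η) i j q u) p v =
        dirDeriv (fun q => θ q u i j) p v - dirDeriv (fun q => η q u i j) p v :=
      dirDeriv_sub (dθ u i j) (dη u i j) v
    rw [extD, e1, e2]
    simp only [Matrix.sub_apply, dMat_apply]
    ring
  rw [e, ← Matrix.add_apply, ← sub_zero (curvature θ p u v), ← h, CarGeometry.curvature_eq,
    CarGeometry.curvature_eq]
  refine congrFun (congrFun (?_ : (_ : Mat) = _) i) j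
  simp only [mat_lie, Pi.sub_apply, LinearMap.sub_apply]
  noncomm_ring

theorem sub_eq (hd : IsDeformation U θ η) (hp : p ∈ U) (v : E3) : (θ - η) p v =
    spMat 0 0 0 ((θ - η) p v e₁ e₁) ((θ - η) p v e₂ e₂) ((θ - η) p v e₂ f₂) ((θ - η) p v f₂ e₂)
      ((θ - η) p v e₁ e₂) ((θ - η) p v e₁ f₂) ((θ - η) p v e₁ f₁) := by
  have hm : (θ - η) p v ∈ sp4 := sub_mem (hd.gauge.mem p hp v) (hd.gauge'.mem p hp v)
  have hl := hd.line p hp v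
  have h1 : (θ - η) p v f₁ e₁ = 0 := hl f₁ (by simp)
  have h2 : (θ - η) p v e₂ e₁ = 0 := hl e₂ (by simp)
  have h3 : (θ - η) p v f₂ e₁ = 0 := hl f₂ (by simp)
  conv_lhs => rw [eq_spMat hm, h1, h2, h3]

theorem extD_of_forall (hd : IsDeformation U θ η) {i j : Fin 2 ⊕ Fin 2}
    (h : ∀ p ∈ U, ∀ v, (θ - η) p v i j = 0) (hp : p ∈ U) (u v : E3) :
    extD (entryForm (θ - η) i j) p u v = 0 := by
  have hU := hd.gauge.isOpen
  have key : ∀ u v, dirDeriv (fun q => entryForm (θ - η) i j q v) p u = 0 := fun u v =>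
    (dirDeriv_congr hU (fun q hq => h q hq v) hp u).trans (dirDeriv_const _ _ _)
  rw [extD, key, key, sub_zero]

theorem extD_line (hd : IsDeformation U θ η) {i : Fin 2 ⊕ Fin 2} (hi : i ≠ e₁) (hp : p ∈ U)
    (u v : E3) : extD (entryForm (θ - η) i e₁) p u v = 0 :=
  hd.extD_of_forall (fun p hp v => hd.line p hp v i hi) hp u v

theorem entry_eq (hd : IsDeformation U θ η) (hp : p ∈ U) (v : E3) {i : Fin 2 ⊕ Fin 2}
    (hi : i ≠ e₁) : η p v i e₁ = θ p v i e₁ := (sub_eq_zero.1 (hd.line p hp v i hi)).symm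

/-- The exterior derivative of a component that vanishes on the contact distribution. -/
theorem extD_of_forall_contact (hd : IsDeformation U θ η) {i j : Fin 2 ⊕ Fin 2}
    (h : ∀ p ∈ U, ∀ v, θ p v f₁ e₁ = 0 → (θ - η) p v i j = 0) (hp : p ∈ U) {u : Fin 3 → E3}
    (hu : IsFrame θ p u) :
    extD (entryForm (θ - η) i j) p (u 1) (u 2) = 2 * (θ - η) p (u 0) i j := by
  have hU := hd.gauge.isOpen
  obtain ⟨⟨a1, a2, a3⟩, ⟨b1, b2, b3⟩, c1, c2, c3⟩ := isFrame_iff.1 hu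
  have e := fun (v : E3) => hd.entry_eq hp v (i := f₁) (by simp)
  have e' := fun (v : E3) => hd.entry_eq hp v (i := f₂) (by simp)
  have e'' := fun (v : E3) => hd.entry_eq hp v (i := e₂) (by simp)
  have h1 := extD_mul_of_vanishing hU (χ := entryForm (θ - η) i j) (ν := entryForm η f₁ e₁)
    (fun u => (hd.gauge.smooth u i j).sub (hd.gauge'.smooth u i j))
    (fun u => hd.gauge'.smooth u f₁ e₁)
    (fun q hq v hv => h q hq v (by rw [← hd.entry_eq hq v (i := f₁) (by simp)]; exact hv)) hp
    (u := u 1) (v := u 2) (by rw [entryForm_apply, e, b1]) (by rw [entryForm_apply, e, c1]) (u 0)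
  -- The (f₁, e₁) entry of the flatness of η: its exterior derivative on the contact plane is minus
  -- the bracket of the two frame vectors of 𝔤₋₁.
  have h2 : extD (entryForm η f₁ e₁) p (u 1) (u 2) = 2 := by
    have h := congrFun (congrFun (hd.flat p hp (u 1) (u 2)) f₁) e₁
    rw [CarGeometry.curvature_eq, Matrix.add_apply, mat_lie_apply] at h
    have h' : extD (entryForm η f₁ e₁) p (u 1) (u 2) = (dMat (fun q => η q (u 2)) p (u 1) -
      dMat (fun q => η q (u 1)) p (u 2)) f₁ e₁ := rfl
    rw [← h'] at h
    obtain ⟨-, -, g3, -, g5, -⟩ := sp4_entries (hd.gauge'.mem p hp (u 1))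
    obtain ⟨-, -, k3, -, k5, -⟩ := sp4_entries (hd.gauge'.mem p hp (u 2))
    simp only [g3, g5, k3, k5, e, e', e'', b1, b2, b3, c1, c2, c3, Matrix.zero_apply] at h
    linarith
  rw [h2, entryForm_apply, entryForm_apply, e, a1] at h1
  linarith

/-- A component that vanishes on the frame vectors tangent to the contact distribution. -/
theorem vanishing_of_frame (hd : IsDeformation U θ η) (hp : p ∈ U) {u : Fin 3 → E3}
    (hu : IsFrame θ p u) {i j : Fin 2 ⊕ Fin 2} (h1 : (θ - η) p (u 1) i j = 0)
    (h2 : (θ - η) p (u 2) i j = 0) (v : E3) (hv : θ p v f₁ e₁ = 0) : (θ - η) p v i j = 0 := by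
  rw [hu.decomp hd.gauge hp v, hv, zero_smul, zero_add, map_add, map_smul, map_smul,
    Matrix.add_apply, Matrix.smul_apply, Matrix.smul_apply, h1, h2, smul_zero, smul_zero, add_zero]

theorem eq_zero_of_frame (hd : IsDeformation U θ η) (hp : p ∈ U) {u : Fin 3 → E3}
    (hu : IsFrame θ p u) {i j : Fin 2 ⊕ Fin 2} (h0 : (θ - η) p (u 0) i j = 0)
    (h : ∀ v, θ p v f₁ e₁ = 0 → (θ - η) p v i j = 0) (v : E3) : (θ - η) p v i j = 0 := by
  obtain ⟨-, ⟨b1, -⟩, c1, -⟩ := isFrame_iff.1 hu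
  rw [hu.decomp hd.gauge hp v, map_add, map_add, map_smul, map_smul, map_smul, Matrix.add_apply,
    Matrix.add_apply, Matrix.smul_apply, Matrix.smul_apply, Matrix.smul_apply, h0, h _ b1, h _ c1,
    smul_zero, smul_zero, smul_zero, add_zero, add_zero]

/-- On a contact vector the difference acts through its 2 × 2 block of degree 0, and the condition
on curves says that this block has the vector itself as an eigenvector. The determinant expressing
this is cubic in v. -/
theorem curves_det (hd : IsDeformation U θ η) (hp : p ∈ U) (v : E3) (hv : θ p v f₁ e₁ = 0) :
    (θ - η) p v f₂ e₂ * θ p v e₂ e₁ ^ 2 - 2 * (θ - η) p v e₂ e₂ * θ p v e₂ e₁ * θ p v f₂ e₁ -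
      (θ - η) p v e₂ f₂ * θ p v f₂ e₁ ^ 2 = 0 := by
  obtain ⟨a, b, h⟩ := hd.curves p hp v hv
  have h' : ∀ i, ((θ - η) p v * θ p v) i e₁ = a * (1 : Mat) i e₁ + b * θ p v i e₁ := h
  have h1 := h' e₂
  have h2 := h' f₂
  rw [hd.sub_eq hp v, mat_mul_apply, hv] at h1 h2
  simp [spMat] at h1 h2
  simp only [Pi.sub_apply, LinearMap.sub_apply, Matrix.sub_apply]
  linear_combination θ p v e₂ e₁ * h2 - θ p v f₂ e₁ * h1

/-- Homogeneity 1. The eight unknowns are the degree 0 components of the difference on the two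
contact frame vectors. The cubic of `curves_det` gives four equations, and normality, applied to the
curvature of homogeneity 1, gives four more. -/
theorem levi_eq_zero_of_contact (hd : IsDeformation U θ η) (hp : p ∈ U) (v : E3) (hv : θ p v f₁ e₁ = 0) :
    (θ - η) p v e₁ e₁ = 0 ∧ (θ - η) p v e₂ e₂ = 0 ∧ (θ - η) p v e₂ f₂ = 0 ∧
      (θ - η) p v f₂ e₂ = 0 := by
  obtain ⟨u, hu⟩ := hd.gauge.exists_isFrame hp
  obtain ⟨⟨n1, n2, -⟩, ⟨m1, m2, -⟩, k1, -⟩ := hd.normal.entries hd.gauge hp hu rfl rfl rfl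
  obtain ⟨⟨a1, a2, a3⟩, ⟨b1, b2, b3⟩, c1, c2, c3⟩ := isFrame_iff.1 hu
  have g1 := hd.curves_det hp (u 1) b1
  have g2 := hd.curves_det hp (u 2) c1
  have g3 := hd.curves_det hp (u 1 + u 2) (by rw [map_add, Matrix.add_apply, b1, c1, add_zero])
  have g4 := hd.curves_det hp (u 1 - u 2) (by rw [map_sub, Matrix.sub_apply, b1, c1, sub_zero])
  simp only [map_add, map_sub, Matrix.add_apply, Matrix.sub_apply (A := (θ p) (u 1)),
    Matrix.sub_apply (A := ((θ - η) p) (u 1)), b2, b3, c2, c3] at g1 g2 g3 g4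
  have t0 := eq_spMat (hd.gauge.mem p hp (u 0))
  have t1 := eq_spMat (hd.gauge.mem p hp (u 1))
  have t2 := eq_spMat (hd.gauge.mem p hp (u 2))
  rw [a1, a2, a3] at t0
  rw [b1, b2, b3] at t1
  rw [c1, c2, c3] at t2
  have f0 := hd.sub_eq hp (u 0)
  have f1 := hd.sub_eq hp (u 1)
  have f2 := hd.sub_eq hp (u 2)
  have x1 : curvature θ p (u 0) (u 1) f₁ e₁ = 2 * (θ - η) p (u 1) e₁ e₁ := by
    rw [hd.curvature_eq hp, hd.extD_line (by simp) hp, t0, t1, f0, f1, Matrix.sub_apply,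
      Matrix.sub_apply, mat_lie_apply, mat_lie_apply, mat_lie_apply]
    simp [spMat]; ring
  have x2 : curvature θ p (u 0) (u 2) f₁ e₁ = 2 * (θ - η) p (u 2) e₁ e₁ := by
    rw [hd.curvature_eq hp, hd.extD_line (by simp) hp, t0, t2, f0, f2, Matrix.sub_apply,
      Matrix.sub_apply, mat_lie_apply, mat_lie_apply, mat_lie_apply]
    simp [spMat]; ring
  have x3 : curvature θ p (u 1) (u 2) e₂ e₁ = (θ - η) p (u 2) e₁ e₁ - (θ - η) p (u 2) e₂ e₂ +
      (θ - η) p (u 1) e₂ f₂ := by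
    rw [hd.curvature_eq hp, hd.extD_line (by simp) hp, t1, t2, f1, f2, Matrix.sub_apply,
      Matrix.sub_apply, mat_lie_apply, mat_lie_apply, mat_lie_apply]
    simp [spMat]; ring
  have x4 : curvature θ p (u 1) (u 2) f₂ e₁ = -(θ - η) p (u 2) f₂ e₂ - (θ - η) p (u 1) e₁ e₁ -
      (θ - η) p (u 1) e₂ e₂ := by
    rw [hd.curvature_eq hp, hd.extD_line (by simp) hp, t1, t2, f1, f2, Matrix.sub_apply,
      Matrix.sub_apply, mat_lie_apply, mat_lie_apply, mat_lie_apply]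
    simp [spMat]; ring
  rw [x1] at n1 m1
  rw [x2] at n2 k1
  rw [x4] at n1 m1
  rw [x3] at n2 k1
  refine ⟨hd.vanishing_of_frame hp hu ?_ ?_ v hv, hd.vanishing_of_frame hp hu ?_ ?_ v hv,
    hd.vanishing_of_frame hp hu ?_ ?_ v hv, hd.vanishing_of_frame hp hu ?_ ?_ v hv⟩ <;> linarith

/-- Normality does not control this component of homogeneity 2: the central part of P₂ can change it
arbitrarily. It vanishes because the gauge η has been chosen accordingly, which is the field
`scale`. -/
theorem scale_eq_zero (hd : IsDeformation U θ η) (hp : p ∈ U) (v : E3) :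
    (θ - η) p v e₁ e₁ = 0 := by
  obtain ⟨u, hu⟩ := hd.gauge.exists_isFrame hp
  obtain ⟨w, hw, hw'⟩ := hd.scale p hp
  obtain ⟨-, ⟨b1, -⟩, c1, -⟩ := isFrame_iff.1 hu
  refine hd.eq_zero_of_frame hp hu ?_ (fun v hv => (hd.levi_eq_zero_of_contact hp v hv).1) v
  have h : (θ - η) p w e₁ e₁ = 0 := sub_eq_zero.2 hw'
  rw [hu.decomp hd.gauge hp w, map_add, map_add, map_smul, map_smul, map_smul, Matrix.add_apply,
    Matrix.add_apply, Matrix.smul_apply, Matrix.smul_apply, Matrix.smul_apply,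
    (hd.levi_eq_zero_of_contact hp _ b1).1, (hd.levi_eq_zero_of_contact hp _ c1).1] at h
  simpa [hw] using h

/-- Homogeneity 2. The seven unknowns are three degree 0 components on the transverse vector and two
degree 1 components on each contact vector; normality gives seven equations. The exterior
derivatives of the degree 0 components contribute through `extD_of_forall_contact`. -/
theorem levi_eq_zero (hd : IsDeformation U θ η) (hp : p ∈ U) :
    (∀ v, (θ - η) p v e₂ e₂ = 0 ∧ (θ - η) p v e₂ f₂ = 0 ∧ (θ - η) p v f₂ e₂ = 0) ∧
      ∀ v, θ p v f₁ e₁ = 0 → (θ - η) p v e₁ e₂ = 0 ∧ (θ - η) p v e₁ f₂ = 0 := by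
  obtain ⟨u, hu⟩ := hd.gauge.exists_isFrame hp
  obtain ⟨⟨-, -, n1, n2, n3, n4, -⟩, ⟨-, m1, m2, -⟩, -, k1, -⟩ :=
    hd.normal.entries hd.gauge hp hu rfl rfl rfl
  obtain ⟨⟨a1, a2, a3⟩, ⟨b1, b2, b3⟩, c1, c2, c3⟩ := isFrame_iff.1 hu
  have t0 := eq_spMat (hd.gauge.mem p hp (u 0))
  have t1 := eq_spMat (hd.gauge.mem p hp (u 1))
  have t2 := eq_spMat (hd.gauge.mem p hp (u 2))
  rw [a1, a2, a3] at t0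
  rw [b1, b2, b3] at t1
  rw [c1, c2, c3] at t2
  have f0 := hd.sub_eq hp (u 0)
  have f1 := hd.sub_eq hp (u 1)
  have f2 := hd.sub_eq hp (u 2)
  obtain ⟨-, p1, p2, p3⟩ := hd.levi_eq_zero_of_contact hp _ b1
  obtain ⟨-, q1, q2, q3⟩ := hd.levi_eq_zero_of_contact hp _ c1
  rw [hd.scale_eq_zero hp] at f0
  rw [hd.scale_eq_zero hp, p1, p2, p3] at f1
  rw [hd.scale_eq_zero hp, q1, q2, q3] at f2
  have hs := hd.extD_of_forall_contact (i := e₂) (j := e₂)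
    (fun p hp v hv => (hd.levi_eq_zero_of_contact hp v hv).2.1) hp hu
  have ht := hd.extD_of_forall_contact (i := e₂) (j := f₂)
    (fun p hp v hv => (hd.levi_eq_zero_of_contact hp v hv).2.2.1) hp hu
  have hr := hd.extD_of_forall_contact (i := f₂) (j := e₂)
    (fun p hp v hv => (hd.levi_eq_zero_of_contact hp v hv).2.2.2) hp hu
  have ha := hd.extD_of_forall (i := e₁) (j := e₁) (fun p hp v => hd.scale_eq_zero hp v) hp
    (u 1) (u 2)
  suffices h : ((θ - η) p (u 0) e₂ e₂ = 0 ∧ (θ - η) p (u 0) e₂ f₂ = 0 ∧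
      (θ - η) p (u 0) f₂ e₂ = 0) ∧ ((θ - η) p (u 1) e₁ e₂ = 0 ∧ (θ - η) p (u 1) e₁ f₂ = 0) ∧
      (θ - η) p (u 2) e₁ e₂ = 0 ∧ (θ - η) p (u 2) e₁ f₂ = 0 by
    obtain ⟨⟨h1, h2, h3⟩, ⟨h4, h5⟩, h6, h7⟩ := h
    exact ⟨fun v => ⟨hd.eq_zero_of_frame hp hu h1 (fun v hv => (hd.levi_eq_zero_of_contact hp v hv).2.1) v,
      hd.eq_zero_of_frame hp hu h2 (fun v hv => (hd.levi_eq_zero_of_contact hp v hv).2.2.1) v,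
      hd.eq_zero_of_frame hp hu h3 (fun v hv => (hd.levi_eq_zero_of_contact hp v hv).2.2.2) v⟩,
      fun v hv => ⟨hd.vanishing_of_frame hp hu h4 h6 v hv, hd.vanishing_of_frame hp hu h5 h7 v hv⟩⟩
  generalize (θ - η) p (u 0) e₂ e₂ = s at *
  generalize (θ - η) p (u 0) e₂ f₂ = t at *
  generalize (θ - η) p (u 0) f₂ e₂ = r at *
  have E := fun i j k l => hd.curvature_eq hp (u i) (u j) k l
  have x1 := E 0 1 e₂ e₁
  have x2 := E 0 1 f₂ e₁
  have y1 := E 0 2 e₂ e₁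
  have y2 := E 0 2 f₂ e₁
  have z1 := E 1 2 e₁ e₁
  have z2 := E 1 2 e₂ e₂
  have z3 := E 1 2 e₂ f₂
  have z4 := E 1 2 f₂ e₂
  rw [hd.extD_line (by simp) hp, t0, t1, f0, f1, Matrix.sub_apply,
      Matrix.sub_apply, mat_lie_apply, mat_lie_apply, mat_lie_apply] at x1 x2
  rw [hd.extD_line (by simp) hp, t0, t2, f0, f2, Matrix.sub_apply,
      Matrix.sub_apply, mat_lie_apply, mat_lie_apply, mat_lie_apply] at y1 y2
  rw [t1, t2, f1, f2, Matrix.sub_apply,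
      Matrix.sub_apply, mat_lie_apply, mat_lie_apply, mat_lie_apply] at z1 z2 z3 z4
  rw [ha] at z1
  rw [hs] at z2
  rw [ht] at z3
  rw [hr] at z4
  clear ha hs ht hr E t0 t1 t2 f0 f1 f2 p1 p2 p3 q1 q2 q3
  generalize (θ - η) p (u 1) e₁ e₂ = l1 at *
  generalize (θ - η) p (u 1) e₁ f₂ = l2 at *
  generalize (θ - η) p (u 2) e₁ e₂ = l3 at *
  generalize (θ - η) p (u 2) e₁ f₂ = l4 at *
  simp [spMat] at x1 x2 y1 y2 z1 z2 z3 z4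
  refine ⟨⟨?_, ?_, ?_⟩, ⟨?_, ?_⟩, ?_, ?_⟩ <;> linarith

/-- Homogeneity 3. Four unknowns, namely the degree 1 components on the transverse vector and the
degree 2 component on the contact vectors, and four equations from normality. -/
theorem unipotent_eq_zero (hd : IsDeformation U θ η) (hp : p ∈ U) :
    (∀ v, (θ - η) p v e₁ e₂ = 0 ∧ (θ - η) p v e₁ f₂ = 0) ∧
      ∀ v, θ p v f₁ e₁ = 0 → (θ - η) p v e₁ f₁ = 0 := by
  obtain ⟨u, hu⟩ := hd.gauge.exists_isFrame hp
  obtain ⟨⟨-, -, -, -, -, -, n1, n2, -⟩, ⟨-, -, -, m1⟩, -, -, k1⟩ :=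
    hd.normal.entries hd.gauge hp hu rfl rfl rfl
  obtain ⟨⟨a1, a2, a3⟩, ⟨b1, b2, b3⟩, c1, c2, c3⟩ := isFrame_iff.1 hu
  have t0 := eq_spMat (hd.gauge.mem p hp (u 0))
  have t1 := eq_spMat (hd.gauge.mem p hp (u 1))
  have t2 := eq_spMat (hd.gauge.mem p hp (u 2))
  rw [a1, a2, a3] at t0
  rw [b1, b2, b3] at t1
  rw [c1, c2, c3] at t2
  have f0 := hd.sub_eq hp (u 0)
  have f1 := hd.sub_eq hp (u 1)
  have f2 := hd.sub_eq hp (u 2)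
  obtain ⟨h2, h2'⟩ := hd.levi_eq_zero hp
  rw [hd.scale_eq_zero hp, (h2 _).1, (h2 _).2.1, (h2 _).2.2] at f0
  rw [hd.scale_eq_zero hp, (h2 _).1, (h2 _).2.1, (h2 _).2.2, (h2' _ b1).1, (h2' _ b1).2] at f1
  rw [hd.scale_eq_zero hp, (h2 _).1, (h2 _).2.1, (h2 _).2.2, (h2' _ c1).1, (h2' _ c1).2] at f2
  have hb := hd.extD_of_forall_contact (i := e₁) (j := e₂)
    (fun p hp v hv => ((hd.levi_eq_zero hp).2 v hv).1) hp hu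
  have hc := hd.extD_of_forall_contact (i := e₁) (j := f₂)
    (fun p hp v hv => ((hd.levi_eq_zero hp).2 v hv).2) hp hu
  have ha := hd.extD_of_forall (i := e₁) (j := e₁) (fun p hp v => hd.scale_eq_zero hp v) hp
  have hs := hd.extD_of_forall (i := e₂) (j := e₂) (fun p hp v => ((hd.levi_eq_zero hp).1 v).1) hp
  have ht := hd.extD_of_forall (i := e₂) (j := f₂) (fun p hp v => ((hd.levi_eq_zero hp).1 v).2.1) hp
  have hr := hd.extD_of_forall (i := f₂) (j := e₂) (fun p hp v => ((hd.levi_eq_zero hp).1 v).2.2) hp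
  suffices h : ((θ - η) p (u 0) e₁ e₂ = 0 ∧ (θ - η) p (u 0) e₁ f₂ = 0) ∧
      (θ - η) p (u 1) e₁ f₁ = 0 ∧ (θ - η) p (u 2) e₁ f₁ = 0 by
    obtain ⟨⟨h3, h4⟩, h5, h6⟩ := h
    exact ⟨fun v => ⟨hd.eq_zero_of_frame hp hu h3 (fun v hv => (h2' v hv).1) v,
      hd.eq_zero_of_frame hp hu h4 (fun v hv => (h2' v hv).2) v⟩,
      fun v hv => hd.vanishing_of_frame hp hu h5 h6 v hv⟩
  have E := fun i j k l => hd.curvature_eq hp (u i) (u j) k l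
  have x1 := E 0 1 e₁ e₁
  have x2 := E 0 1 e₂ e₂
  have x3 := E 0 1 e₂ f₂
  have y1 := E 0 2 e₁ e₁
  have y2 := E 0 2 e₂ e₂
  have y3 := E 0 2 f₂ e₂
  have z1 := E 1 2 e₁ e₂
  have z2 := E 1 2 e₁ f₂
  rw [t0, t1, f0, f1, Matrix.sub_apply,
      Matrix.sub_apply, mat_lie_apply, mat_lie_apply, mat_lie_apply] at x1 x2 x3
  rw [t0, t2, f0, f2, Matrix.sub_apply,
      Matrix.sub_apply, mat_lie_apply, mat_lie_apply, mat_lie_apply] at y1 y2 y3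
  rw [t1, t2, f1, f2, Matrix.sub_apply,
      Matrix.sub_apply, mat_lie_apply, mat_lie_apply, mat_lie_apply] at z1 z2
  rw [ha] at x1 y1
  rw [hs] at x2 y2
  rw [ht] at x3
  rw [hr] at y3
  rw [hb] at z1
  rw [hc] at z2
  clear ha hs ht hr hb hc E t0 t1 t2 f0 f1 f2 h2 h2'
  generalize (θ - η) p (u 0) e₁ e₂ = l1 at *
  generalize (θ - η) p (u 0) e₁ f₂ = l2 at *
  generalize (θ - η) p (u 1) e₁ f₁ = l3 at *
  generalize (θ - η) p (u 2) e₁ f₁ = l4 at *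
  simp [spMat] at x1 x2 x3 y1 y2 y3 z1 z2
  refine ⟨⟨?_, ?_⟩, ?_, ?_⟩ <;> linarith

/-- Homogeneity 4. The only unknown left is the degree 2 component on the transverse vector, and the
last equation of normality makes it vanish. -/
theorem center_eq_zero (hd : IsDeformation U θ η) (hp : p ∈ U) (v : E3) :
    (θ - η) p v e₁ f₁ = 0 := by
  obtain ⟨u, hu⟩ := hd.gauge.exists_isFrame hp
  obtain ⟨⟨-, -, -, -, -, -, -, -, n1⟩, -, -⟩ := hd.normal.entries hd.gauge hp hu rfl rfl rfl
  obtain ⟨⟨a1, a2, a3⟩, ⟨b1, b2, b3⟩, c1, c2, c3⟩ := isFrame_iff.1 hu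
  have t0 := eq_spMat (hd.gauge.mem p hp (u 0))
  have t1 := eq_spMat (hd.gauge.mem p hp (u 1))
  have t2 := eq_spMat (hd.gauge.mem p hp (u 2))
  rw [a1, a2, a3] at t0
  rw [b1, b2, b3] at t1
  rw [c1, c2, c3] at t2
  have f0 := hd.sub_eq hp (u 0)
  have f1 := hd.sub_eq hp (u 1)
  have f2 := hd.sub_eq hp (u 2)
  obtain ⟨h2, -⟩ := hd.levi_eq_zero hp
  obtain ⟨h3, h3'⟩ := hd.unipotent_eq_zero hp
  rw [hd.scale_eq_zero hp, (h2 _).1, (h2 _).2.1, (h2 _).2.2, (h3 _).1, (h3 _).2] at f0 f1 f2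
  rw [h3' _ b1] at f1
  rw [h3' _ c1] at f2
  have hz := hd.extD_of_forall_contact (i := e₁) (j := f₁)
    (fun p hp v hv => (hd.unipotent_eq_zero hp).2 v hv) hp hu
  have hb := hd.extD_of_forall (i := e₁) (j := e₂) (fun p hp v => ((hd.unipotent_eq_zero hp).1 v).1) hp
  have hc := hd.extD_of_forall (i := e₁) (j := f₂) (fun p hp v => ((hd.unipotent_eq_zero hp).1 v).2) hp
  refine hd.eq_zero_of_frame hp hu ?_ h3' v
  have x1 := hd.curvature_eq hp (u 0) (u 1) e₁ f₂
  have y1 := hd.curvature_eq hp (u 0) (u 2) e₁ e₂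
  have z1 := hd.curvature_eq hp (u 1) (u 2) e₁ f₁
  rw [hc, t0, t1, f0, f1, Matrix.sub_apply,
      Matrix.sub_apply, mat_lie_apply, mat_lie_apply, mat_lie_apply] at x1
  rw [hb, t0, t2, f0, f2, Matrix.sub_apply,
      Matrix.sub_apply, mat_lie_apply, mat_lie_apply, mat_lie_apply] at y1
  rw [hz, t1, t2, f1, f2, Matrix.sub_apply,
      Matrix.sub_apply, mat_lie_apply, mat_lie_apply, mat_lie_apply] at z1
  clear hz hb hc t0 t1 t2 f0 f1 f2 h2 h3 h3'
  generalize (θ - η) p (u 0) e₁ f₁ = l1 at *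
  simp [spMat] at x1 y1 z1
  linarith

theorem eq (hd : IsDeformation U θ η) (hp : p ∈ U) (v : E3) : θ p v = η p v := by
  refine sub_eq_zero.1 (Eq.trans (hd.sub_eq hp v) ?_)
  obtain ⟨h2, -⟩ := hd.levi_eq_zero hp
  obtain ⟨h3, -⟩ := hd.unipotent_eq_zero hp
  rw [hd.scale_eq_zero hp, (h2 _).1, (h2 _).2.1, (h2 _).2.2, (h3 _).1, (h3 _).2,
    hd.center_eq_zero hp]
  refine mat_ext_index (forall_index ?_ ?_ ?_ ?_) <;> simp [spMat]

end IsDeformation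

/-! ## Normal gauges are flat -/

/-- The transform of the form `θ` by the function `h`. -/
def transform (h : Pos → Mat) (θ : Form Mat) : Form Mat := fun p =>
  { toFun := fun u => (h p)⁻¹ * θ p u * h p + (h p)⁻¹ * dMat h p u
    map_add' := fun u v => by
      have : dMat h p (u + v) = dMat h p u + dMat h p v := by
        ext i j; exact dirDeriv_add_apply (fun q => h q i j) p u v
      rw [map_add, this]; simp only [mul_add, add_mul]; abel
    map_smul' := fun a u => by
      have : dMat h p (a • u) = a • dMat h p u := by
        ext i j; exact dirDeriv_smul_apply (fun q => h q i j) p a u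
      rw [map_smul, this, RingHom.id_apply, smul_add, mul_smul_comm, smul_mul_assoc,
        mul_smul_comm] }

section Transform

variable {U : Set Pos} {h : Pos → Mat} {θ θ' : Form Mat} {p : Pos}

theorem isTransform_transform (hs : SmoothMat U h) (hm : ∀ p ∈ U, InParabolic (h p))
    (θ : Form Mat) : IsTransform U h θ (transform h θ) :=
  ⟨hs, hm, fun _ _ _ => rfl⟩

theorem IsTransform.smooth_form (hU : IsOpen U) (ht : IsTransform U h θ θ')
    (hθ : ∀ u, SmoothMat U fun p => θ p u) (u : E3) : SmoothMat U fun p => θ' p u :=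
  (((ht.smooth_inv.mul (hθ u)).mul ht.smooth).add
    (ht.smooth_inv.mul (ht.smooth.dMat hU u))).congr fun p hp => ht.eq p hp u

/-- Differentiating hᵀJh = J shows that h⁻¹dh takes values in sp(2,ℝ). -/
theorem IsTransform.mem_sp4 (hU : IsOpen U) (ht : IsTransform U h θ θ') (hp : p ∈ U) {u : E3}
    (hθ : θ p u ∈ sp4) : θ' p u ∈ sp4 := by
  rw [ht.eq p hp]
  refine add_mem (conj_mem_sp4 (ht.mem p hp).1 hθ) ?_
  have hm := fun q hq => SymplecticGroup.mem_iff'.1 (ht.mem q hq).1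
  have hs := ht.smooth
  have hc := fun q hq => SymplecticGroup.mem_iff'.1 (ht.mem q hq).1
  have e := dMat_congr (M := fun q => (h q).transpose * Matrix.J (Fin 2) ℝ * h q) hU hm hp u
  rw [dMat_const, dMat_mul ((hs.transpose.mul (smoothMat_const U _)).diffAt hU hp)
    (hs.diffAt hU hp), dMat_mul (hs.transpose.diffAt hU hp)
    ((smoothMat_const U _).diffAt hU hp), dMat_const, mul_zero, add_zero] at e
  have e' : dMat (fun q => (h q).transpose) p u = (dMat h p u).transpose := rfl
  have hX : dMat h p u = h p * ((h p)⁻¹ * dMat h p u) := by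
    rw [← mul_assoc, (ht.mem p hp).mul_inv, one_mul]
  generalize (h p)⁻¹ * dMat h p u = X at *
  rw [e', hX, Matrix.transpose_mul, ← mul_assoc, mul_assoc X.transpose, mul_assoc X.transpose,
    hc p hp] at e
  rw [mem_sp4_iff]
  exact eq_neg_of_add_eq_zero_left e

end Transform

/-- An element of the parabolic subgroup, given by its columns. -/
def parabolicMat (s r y y' a b c d x z : ℝ) : Mat :=
  Matrix.fromBlocks !![s, y; 0, a] !![0, y'; x, b] !![0, 0; 0, c] !![r, 0; z, d]

theorem inParabolic_parabolicMat {s r y y' a b c d x z : ℝ} (h1 : s * r = 1)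
    (h2 : a * d - b * c = 1) (h3 : y * r + a * z - c * x = 0) (h4 : y' * r + b * z - d * x = 0) :
    InParabolic (parabolicMat s r y y' a b c d x z) := by
  refine ⟨?_, forall_index (fun h => absurd rfl h) (fun _ => rfl) (fun _ => rfl) (fun _ => rfl)⟩
  rw [SymplecticGroup.mem_iff', J_entries]
  refine mat_ext_index (forall_index ?_ ?_ ?_ ?_) <;>
    simp [mat_mul_apply, parabolicMat] <;> (repeat' apply And.intro) <;> linarith

theorem smoothMat_parabolicMat {U : Set Pos} {s r y y' a b c d x z : Pos → ℝ} (hs : SmoothOn U s)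
    (hr : SmoothOn U r) (hy : SmoothOn U y) (hy' : SmoothOn U y') (ha : SmoothOn U a)
    (hb : SmoothOn U b) (hc : SmoothOn U c) (hd : SmoothOn U d) (hx : SmoothOn U x)
    (hz : SmoothOn U z) : SmoothMat U fun p => parabolicMat (s p) (r p) (y p) (y' p) (a p) (b p)
      (c p) (d p) (x p) (z p) := by
  have h0 := smoothOn_const U (0 : ℝ)
  refine fun i j => forall_index (P := fun i => SmoothOn U fun p => parabolicMat (s p) (r p) (y p)
    (y' p) (a p) (b p) (c p) (d p) (x p) (z p) i j) ?_ ?_ ?_ ?_ i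
  all_goals
    revert j
    refine forall_index ?_ ?_ ?_ ?_
  exacts [hs, hy, h0, hy', h0, ha, hx, hb, h0, h0, hr, h0, h0, hc, hz, hd]

/-- An element of the center of the unipotent radical of the parabolic subgroup. -/
def centralMat (z : ℝ) : Mat := 1 + z • Matrix.single e₁ f₁ 1

theorem centralMat_mul (z : ℝ) : centralMat (-z) * centralMat z = 1 := by
  simp only [centralMat, add_mul, mul_add, one_mul, mul_one, smul_mul_assoc, mul_smul_comm]
  rw [Matrix.single_mul_single_of_ne _ _ _ _ (by simp)]
  module

theorem inParabolic_centralMat (z : ℝ) : InParabolic (centralMat z) := by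
  refine ⟨?_, forall_index (fun h => absurd rfl h) (fun _ => ?_) (fun _ => ?_) (fun _ => ?_)⟩
  · rw [SymplecticGroup.mem_iff', J_entries]
    refine mat_ext_index (forall_index ?_ ?_ ?_ ?_) <;>
      simp [mat_mul_apply, centralMat]
  all_goals simp [centralMat]

theorem centralMat_inv (z : ℝ) : (centralMat z)⁻¹ = centralMat (-z) :=
  Matrix.inv_eq_left_inv (centralMat_mul z)

theorem centralMat_mul_apply (z : ℝ) (A : Mat) : (centralMat z * A) e₁ e₁ = A e₁ e₁ + z * A f₁ e₁ ∧
    ∀ i ≠ e₁, (centralMat z * A) i e₁ = A i e₁ := by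
  rw [centralMat, add_mul, one_mul, smul_mul_assoc]
  refine ⟨by simp, forall_index (fun h => absurd rfl h) (fun _ => ?_)
    (fun _ => ?_) (fun _ => ?_)⟩ <;> simp

theorem smoothMat_centralMat {U : Set Pos} {z : Pos → ℝ} (hz : SmoothOn U z) :
    SmoothMat U fun p => centralMat (z p) :=
  (smoothMat_const U 1).add (SmoothMat.smul hz (smoothMat_const U _))

theorem dMat_centralMat {U : Set Pos} (hU : IsOpen U) {z : Pos → ℝ} (hz : SmoothOn U z) {p : Pos}
    (hp : p ∈ U) (u : E3) :
    dMat (fun p => centralMat (z p)) p u = dirDeriv z p u • Matrix.single e₁ f₁ 1 := by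
  have hc : ∀ A : Mat, ∀ i j, DiffAt (fun _ : Pos => A i j) p := fun A i j =>
    differentiableAt_const _
  have e : (fun p => centralMat (z p)) = fun p => (1 : Mat) + z p • Matrix.single e₁ f₁ 1 := rfl
  rw [e, dMat_add (M := fun _ => 1) (N := fun p => z p • Matrix.single e₁ f₁ 1) (hc 1)
    ((SmoothMat.smul hz (smoothMat_const U _)).diffAt hU hp), dMat_const,
    dMat_smul (hz.diffAt hU hp) (hc _), dMat_const, smul_zero, zero_add, add_zero]

/-- Two gauges with the same values modulo `𝔭` that both satisfy the condition on curves. -/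
theorem curves_of_acceleration {U : Set Pos} {θ η : Form Mat} (hθ : IsCartanGauge U θ)
    (hη : ∀ u, SmoothMat U fun p => η p u) (hl : ∀ p ∈ U, ∀ u, PreservesLine (θ p u - η p u))
    {p : Pos} (hp : p ∈ U) {v w : E3}
    (h : ∃ a b : ℝ, ∀ i, acceleration θ p v w i e₁ = a * (1 : Mat) i e₁ + b * θ p v i e₁)
    (h' : ∃ a b : ℝ, ∀ i, acceleration η p v w i e₁ = a * (1 : Mat) i e₁ + b * η p v i e₁) :
    ∃ a b : ℝ, ∀ i, ((θ p v - η p v) * θ p v) i e₁ = a * (1 : Mat) i e₁ + b * θ p v i e₁ := by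
  obtain ⟨a, b, h⟩ := h
  obtain ⟨a', b', h'⟩ := h'
  have hU := hθ.isOpen
  have hd := preservesLine_dMat hU (M := fun q => θ q v - η q v) (fun q hq => hl q hq v) hp v
  rw [dMat_sub (SmoothMat.diffAt hU (hθ.smooth v) hp) (SmoothMat.diffAt hU (hη v) hp)] at hd
  have key : ∀ A : Mat, PreservesLine A → ∀ i, A i e₁ = A e₁ e₁ * (1 : Mat) i e₁ := fun A hA i => by
    rcases eq_or_ne i e₁ with rfl | hi
    · simp
    · rw [hA i hi, Matrix.one_apply_ne hi, mul_zero]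
  have k1 := key _ hd
  have k2 := key _ (hl p hp w)
  have k3 := key _ (hl p hp v)
  have hmul : ∀ i, (η p v * (θ p v - η p v)) i e₁ = η p v i e₁ * (θ p v - η p v) e₁ e₁ := fun i =>
    (hl p hp v).mul_apply i
  -- In the difference of the two accelerations every derivative term, and the term with w, maps e₁
  -- to a multiple of e₁; only a product remains modulo e₁ and θ(v)e₁.
  have e : (θ p v - η p v) * θ p v = acceleration θ p v w - acceleration η p v w -
      (dMat (fun q => θ q v) p v - dMat (fun q => η q v) p v) - (θ p w - η p w) -
      η p v * (θ p v - η p v) := by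
    rw [acceleration, acceleration]; noncomm_ring
  refine ⟨a - a' - (dMat (fun q => θ q v) p v - dMat (fun q => η q v) p v) e₁ e₁ -
    (θ p w - η p w) e₁ e₁ + (b' + (θ p v - η p v) e₁ e₁) * (θ p v - η p v) e₁ e₁,
    b - b' - (θ p v - η p v) e₁ e₁, fun i => ?_⟩
  have k4 := k3 i
  rw [e, Matrix.sub_apply, Matrix.sub_apply, Matrix.sub_apply, hmul, k1, k2, Matrix.sub_apply,
    h, h']
  rw [Matrix.sub_apply (θ p v) (η p v) i] at k4
  have k5 : η p v i e₁ = θ p v i e₁ - (θ p v - η p v) e₁ e₁ * (1 : Mat) i e₁ := by linarith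
  rw [k5]
  ring

/-! ## Normal gauges that induce the structure are transforms of the flat gauge -/

section Uniqueness

variable {ε ℓ : ℝ} {U : Set Pos} {θ : Form Mat} {lam : Form ℝ} {φ : Pos → ℝ}

theorem Induces.exists_scale (hε : ε * ε = 1)
    (hφ : ∀ p, 0 < φ p ∧ ∀ u, ε * coAcross p u = φ p * lam p u)
    (h : Induces U θ lam (inducedCurves (gas ℓ))) {p : Pos} (hp : p ∈ U) :
    0 < ε * θ p (across p) f₁ e₁ ∧
      ∀ u, θ p u f₁ e₁ = θ p (across p) f₁ e₁ * coAcross p u := by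
  obtain ⟨a, ha, h⟩ := h.contact p hp
  obtain ⟨h0, h1⟩ := hφ p
  have h2 : ∀ u, θ p u f₁ e₁ = a / φ p * ε * coAcross p u := fun u => by
    rw [h, mul_assoc, h1]
    field_simp
  have h3 : θ p (across p) f₁ e₁ = a / φ p * ε := by rw [h2, coAcross_across, mul_one]
  refine ⟨?_, fun u => by rw [h3, h2]⟩
  rw [h3, mul_comm, mul_assoc, hε]
  positivity

theorem Induces.curvature_contact (hφ : ∀ p, 0 < φ p ∧ ∀ u, ε * coAcross p u = φ p * lam p u)
    (h : Induces U θ lam (inducedCurves (gas ℓ))) {p : Pos} (hp : p ∈ U) :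
    curvature θ p (along p) (turn p) f₁ e₁ = 0 := by
  have key : ∀ u, coAcross p u = 0 → lam p u = 0 := fun u hu => by
    have := (hφ p).2 u
    rw [hu, mul_zero] at this
    exact (mul_eq_zero.1 this.symm).resolve_left (hφ p).1.ne'
  exact h.regular p hp _ _ (key _ (coAcross_along p)) (key _ (coAcross_turn p))

/-- Regularity of a gauge, in terms of its negative part. -/
theorem IsCartanGauge.contact_det (hθ : IsCartanGauge U θ)
    (hm : ∀ p ∈ U, ∀ u, θ p u f₁ e₁ = θ p (across p) f₁ e₁ * coAcross p u) {p : Pos} (hp : p ∈ U)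
    (hr : curvature θ p (along p) (turn p) f₁ e₁ = 0) :
    2 * (θ p (along p) e₂ e₁ * θ p (turn p) f₂ e₁ - θ p (turn p) e₂ e₁ * θ p (along p) f₂ e₁) =
      θ p (across p) f₁ e₁ := by
  -- The (f₁, e₁) entry of θ is a multiple of `coAcross`, so on the contact plane its exterior
  -- derivative is that multiple of coAlong ∧ coTurn; vanishing curvature equates it with minus the
  -- bracket term, which is a determinant.
  have h1 := extD_mul_of_vanishing hθ.isOpen (χ := entryForm θ f₁ e₁) (fun u => hθ.smooth u f₁ e₁)
    (smoothForm_coAcross U) (fun q hq u hu => by rw [entryForm_apply, hm q hq, hu, mul_zero]) hp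
    (coAcross_along p) (coAcross_turn p) (across p)
  rw [extD_coAcross, entryForm_apply] at h1
  have h2 : curvature θ p (along p) (turn p) f₁ e₁ = extD (entryForm θ f₁ e₁) p (along p) (turn p) +
      ⁅θ p (along p), θ p (turn p)⁆ f₁ e₁ := rfl
  obtain ⟨a1, a2, a3, a4, a5, a6⟩ := sp4_entries (hθ.mem p hp (along p))
  obtain ⟨b1, b2, b3, b4, b5, b6⟩ := sp4_entries (hθ.mem p hp (turn p))
  have h3 := hm p hp (along p)
  have h4 := hm p hp (turn p)
  rw [coAcross_along, mul_zero] at h3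
  rw [coAcross_turn, mul_zero] at h4
  rw [hr, mat_lie_apply, h3, h4, a5, b5, a3, b3] at h2
  simp only [coAcross_across, coAlong_along, coTurn_turn, coAlong_turn, coTurn_along] at h1
  linarith

/-- The flat gauge can be transformed so that it agrees with a given gauge modulo `𝔭`. -/
theorem IsCartanGauge.exists_transform (hε : ε * ε = 1) (hθ : IsCartanGauge U θ)
    (hm : ∀ p ∈ U, 0 < ε * θ p (across p) f₁ e₁ ∧
      ∀ u, θ p u f₁ e₁ = θ p (across p) f₁ e₁ * coAcross p u)
    (hr : ∀ p ∈ U, curvature θ p (along p) (turn p) f₁ e₁ = 0) :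
    ∃ h, SmoothMat U h ∧ (∀ p ∈ U, InParabolic (h p)) ∧
      ∀ p ∈ U, ∀ u, ∀ i ≠ e₁, transform h (flatForm ε) p u i e₁ = θ p u i e₁ := by
  have hU := hθ.isOpen
  -- The contact component scales by the square of the (e₁, e₁) entry, so a square root is needed;
  -- it exists by the agreement of co-orientations.
  let r : Pos → ℝ := fun p => √(ε * θ p (across p) f₁ e₁)
  have hrr : ∀ p ∈ U, r p * r p = ε * θ p (across p) f₁ e₁ := fun p hp =>
    Real.mul_self_sqrt (hm p hp).1.le
  have hr0 : ∀ p ∈ U, r p ≠ 0 := fun p hp => (Real.sqrt_pos.2 (hm p hp).1).ne'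
  have hs : ∀ i j, ∀ {V : Pos → E3}, SmoothOn U V → SmoothOn U fun p => θ p (V p) i j :=
    fun i j V hV => SmoothForm.apply (lam := entryForm θ i j) (fun u => hθ.smooth u i j) hV
  have sr : SmoothOn U r := ((smoothOn_const U ε).mul (hs f₁ e₁ (smoothOn_across U))).sqrt
    fun p hp => (hm p hp).1.ne'
  have s3 : SmoothOn U fun p => r p * r p * r p := (sr.mul sr).mul sr
  have h3 : ∀ p ∈ U, r p * r p * r p ≠ 0 := fun p hp =>
    mul_ne_zero (mul_ne_zero (hr0 p hp) (hr0 p hp)) (hr0 p hp)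
  have sc := fun c : ℝ => smoothOn_const U c
  have P1 := hs e₂ e₁ (smoothOn_along U)
  have P2 := hs e₂ e₁ (smoothOn_turn U)
  have P3 := hs e₂ e₁ (smoothOn_across U)
  have Q1 := hs f₂ e₁ (smoothOn_along U)
  have Q2 := hs f₂ e₁ (smoothOn_turn U)
  have Q3 := hs f₂ e₁ (smoothOn_across U)
  -- The inverse of the required transform. Its columns e₂, f₂ and f₁ are prescribed modulo e₁ by
  -- the values of θ on `turn`, `along` and `across`, since the flat gauge takes there, modulo e₁,
  -- the values e₂/2, -ε f₂ and ε f₁ on e₁. The remaining entries make the matrix symplectic; the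
  -- determinant condition is `IsCartanGauge.contact_det`.
  let k : Pos → Mat := fun p => parabolicMat (1 / r p) (r p)
    (-2 * ε * (θ p (turn p) e₂ e₁ * θ p (across p) f₂ e₁ -
      θ p (turn p) f₂ e₁ * θ p (across p) e₂ e₁) / (r p * r p * r p))
    ((θ p (along p) e₂ e₁ * θ p (across p) f₂ e₁ -
      θ p (along p) f₂ e₁ * θ p (across p) e₂ e₁) / (r p * r p * r p))
    (2 * θ p (turn p) e₂ e₁ / r p) (-ε * θ p (along p) e₂ e₁ / r p)
    (2 * θ p (turn p) f₂ e₁ / r p) (-ε * θ p (along p) f₂ e₁ / r p)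
    (ε * θ p (across p) e₂ e₁ / r p) (ε * θ p (across p) f₂ e₁ / r p)
  have sk : SmoothMat U k := smoothMat_parabolicMat ((sc 1).div sr hr0) sr
    (((sc (-2 * ε)).mul ((P2.mul Q3).sub (Q2.mul P3))).div s3 h3)
    (((P1.mul Q3).sub (Q1.mul P3)).div s3 h3) (((sc 2).mul P2).div sr hr0)
    (((sc (-ε)).mul P1).div sr hr0) (((sc 2).mul Q2).div sr hr0)
    (((sc (-ε)).mul Q1).div sr hr0) (((sc ε).mul P3).div sr hr0) (((sc ε).mul Q3).div sr hr0)
  have mk : ∀ p ∈ U, InParabolic (k p) := fun p hp => by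
    have h0 := hr0 p hp
    have hd := hθ.contact_det (fun q hq => (hm q hq).2) hp (hr p hp)
    have e := hrr p hp
    refine inParabolic_parabolicMat (one_div_mul_cancel h0) ?_ ?_ ?_
    · field_simp
      rw [sq, e, ← hd]
      ring
    · field_simp
      ring
    · field_simp
      linear_combination (θ p (across p) f₂ e₁ * θ p (along p) e₂ e₁ -
        θ p (across p) e₂ e₁ * θ p (along p) f₂ e₁) * (-hε)
  have hik : ∀ p ∈ U, (k p)⁻¹ = sympInv (k p) := fun p hp => inv_eq_sympInv (mk p hp).1
  have sh : SmoothMat U fun p => (k p)⁻¹ := sk.sympInv.congr hik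
  have mh : ∀ p ∈ U, InParabolic (k p)⁻¹ := fun p hp => (mk p hp).inv
  refine ⟨_, sh, mh, fun p hp u i hi => ?_⟩
  obtain ⟨x, hx⟩ := (isTransform_transform sh mh (flatForm ε)).apply_col hU hp u
  have h0 := hr0 p hp
  have hk : (k p)⁻¹ e₁ e₁ = r p := by
    have := (mk p hp).inv_apply_mul e₁
    rw [Matrix.one_apply_eq, show k p e₁ e₁ = 1 / r p from rfl] at this
    field_simp at this
    exact this
  have hlin : θ p u i e₁ = coAlong p u * θ p (along p) i e₁ + coTurn p u * θ p (turn p) i e₁ +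
      coAcross p u * θ p (across p) i e₁ := by
    conv_lhs => rw [frame_decomp p u]
    simp only [map_add, map_smul, Matrix.add_apply, Matrix.smul_apply, smul_eq_mul]
  have e := hrr p hp
  rw [hx, (mk p hp).inv_inv, hk, Matrix.one_apply_ne hi, mul_zero, add_zero, flatForm_apply,
    mat_mul_apply]
  clear hx
  revert hi hlin
  revert i
  refine forall_index (fun h => absurd rfl h) (fun _ hlin => ?_) (fun _ _ => ?_) (fun _ hlin => ?_)
  · rw [hlin]
    simp [k, parabolicMat, spMat]
    field_simp
    linear_combination (coAlong p u * θ p (along p) e₂ e₁ + coAcross p u * θ p (across p) e₂ e₁) * hε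
  · rw [(hm p hp).2]
    simp [k, parabolicMat, spMat]
    linear_combination coAcross p u * ε * e + coAcross p u * θ p (across p) f₁ e₁ * hε
  · rw [hlin]
    simp [k, parabolicMat, spMat]
    field_simp
    linear_combination (coAlong p u * θ p (along p) f₂ e₁ + coAcross p u * θ p (across p) f₂ e₁) * hε

/-- The value modulo `𝔭` and the value of the `(e₁, e₁)` entry on `across` can be prescribed. -/
theorem IsCartanGauge.exists_isTransform (hε : ε * ε = 1) (hθ : IsCartanGauge U θ)
    (hm : ∀ p ∈ U, 0 < ε * θ p (across p) f₁ e₁ ∧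
      ∀ u, θ p u f₁ e₁ = θ p (across p) f₁ e₁ * coAcross p u)
    (hr : ∀ p ∈ U, curvature θ p (along p) (turn p) f₁ e₁ = 0) :
    ∃ h η, IsTransform U h (flatForm ε) η ∧
      (∀ p ∈ U, ∀ u, ∀ i ≠ e₁, η p u i e₁ = θ p u i e₁) ∧
      ∀ p ∈ U, η p (across p) e₁ e₁ = θ p (across p) e₁ e₁ := by
  have hU := hθ.isOpen
  obtain ⟨h, sh, mh, hh⟩ := hθ.exists_transform hε hm hr
  have ht := isTransform_transform sh mh (flatForm ε)
  set η := transform h (flatForm ε)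
  have hm0 : ∀ p ∈ U, θ p (across p) f₁ e₁ ≠ 0 := fun p hp h0 => by
    have := (hm p hp).1
    rw [h0, mul_zero] at this
    exact this.false
  have sη := ht.smooth_form hU (smoothMat_flatForm ε U)
  -- A central element with parameter z lowers the (e₁, e₁) entry by z times the (f₁, e₁) entry and
  -- leaves the values modulo 𝔭 unchanged.
  let z : Pos → ℝ := fun p => (η p (across p) e₁ e₁ - θ p (across p) e₁ e₁) / θ p (across p) f₁ e₁
  have sz : SmoothOn U z := ((SmoothForm.apply (lam := entryForm η e₁ e₁) (fun u => sη u e₁ e₁)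
    (smoothOn_across U)).sub (SmoothForm.apply (lam := entryForm θ e₁ e₁)
    (fun u => hθ.smooth u e₁ e₁) (smoothOn_across U))).div (SmoothForm.apply
    (lam := entryForm θ f₁ e₁) (fun u => hθ.smooth u f₁ e₁) (smoothOn_across U)) hm0
  have ht' := isTransform_transform (smoothMat_centralMat sz)
    (fun p _ => inParabolic_centralMat (z p)) η
  have hcol : ∀ p ∈ U, ∀ u i, transform (fun p => centralMat (z p)) η p u i e₁ =
      (centralMat (-z p) * η p u) i e₁ := fun p hp u i => by
    have hc : centralMat (z p) e₁ e₁ = 1 := by simp [centralMat]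
    have hd : PreservesLine (dirDeriv z p u • Matrix.single e₁ f₁ 1) := fun i _ => by simp
    rw [ht'.eq p hp, dMat_centralMat hU sz hp, centralMat_inv, Matrix.add_apply, hd.mul_apply,
      (inParabolic_centralMat (z p)).2.mul_apply, hc]
    simp
  refine ⟨_, _, ht.trans hU ht', fun p hp u i hi => ?_, fun p hp => ?_⟩
  · rw [hcol p hp, (centralMat_mul_apply _ _).2 i hi, hh p hp u i hi]
  · rw [hcol p hp, (centralMat_mul_apply _ _).1, hh p hp _ f₁ (by simp), neg_mul,
      div_mul_cancel₀ _ (hm0 p hp)]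
    ring

/-- After normalising the flat gauge by `IsCartanGauge.exists_isTransform`, the two gauges form an
`IsDeformation`, hence are equal. -/
theorem compatible_of_isNormal (hℓ : 0 < ℓ) (hε : ε * ε = 1)
    (hφ : ∀ p, 0 < φ p ∧ ∀ u, ε * coAcross p u = φ p * lam p u) (hθ : IsCartanGauge U θ)
    (h : Induces U θ lam (inducedCurves (gas ℓ))) (hn : IsNormal U θ) :
    Compatible (Set.univ, flatForm ε) (U, θ) := by
  have hU := hθ.isOpen
  have hm := fun p (hp : p ∈ U) => h.exists_scale hε hφ hp
  obtain ⟨k, η, ht, hcol, hsc⟩ := hθ.exists_isTransform hε hm fun p hp =>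
    h.curvature_contact hφ hp
  have hl : ∀ p ∈ U, ∀ u, PreservesLine (θ p u - η p u) := fun p hp u i hi => by
    rw [Matrix.sub_apply, hcol p hp u i hi, sub_self]
  have sη := ht.smooth_form hU (smoothMat_flatForm ε U)
  have hd : IsDeformation U θ η :=
    { gauge := hθ
      gauge' := ⟨hU, sη, fun p hp u => ht.mem_sp4 hU hp (flatForm_mem ε p u), fun p hp u hu =>
        hθ.iso p hp u fun i hi => by rw [← hcol p hp u i hi]; exact hu i hi⟩
      flat := fun p hp u v => by
        rw [ht.curvature_eq hU (smoothMat_flatForm ε U) hp, curvature_flatForm, mul_zero, zero_mul]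
      line := hl
      normal := hn
      scale := fun p hp => ⟨across p, fun h0 => by
        have := (hm p hp).1
        rw [h0, mul_zero] at this
        exact this.false, (hsc p hp).symm⟩
      curves := fun p hp v hv => by
        rw [(hm p hp).2] at hv
        have hv : coAcross p v = 0 := (mul_eq_zero.1 hv).resolve_left fun h0 => by
          have := (hm p hp).1
          rw [h0, mul_zero] at this
          exact this.false
        rcases eq_or_ne v 0 with rfl | hne
        · exact ⟨0, 0, fun i => by simp⟩
        -- Every contact vector is the velocity of a curve of the family, so the conditions of θ and
        -- of η on that curve can be compared at v.
        have hab := contact_ne_zero hv hne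
        have hK := carCurve_mem_inducedCurves hℓ hab p
        have hc := parametrizes_carPath hab (Coords.lift p)
        have hc0 : (Coords.cov (carPath (coAlong p v) (coTurn p v) (Coords.lift p) 0) : Pos) = p := by
          rw [carPath_zero, Coords.cov_lift]
        have hv' : deriv (carPath (coAlong p v) (coTurn p v) (Coords.lift p)) 0 = v := by
          rw [deriv_carPath, hc0]
          conv_rhs => rw [frame_decomp p v, hv, zero_smul, add_zero]
        rw [Coords.cov_lift] at hc
        have h1 := h.curves _ hK _ hc 0 (by rwa [hc0])
        simp only [deriv_gauge hθ hc.1 (t := 0) (by rwa [hc0])] at h1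
        have h2 := acceleration_flatForm_of_mem hℓ ε hK hc 0
        rw [hc0, hv'] at h1 h2
        exact curves_of_acceleration hθ sη hl hp h1
          (ht.acceleration_mem hU (smoothMat_flatForm ε U) hp h2) }
  exact compatible_iff.2 fun p hp => ⟨U, hU, hp.2, fun q hq => ⟨trivial, hq⟩, k, ht.smooth, ht.mem,
    fun q hq u => by rw [hd.eq hq, ht.eq q hq]⟩

end Uniqueness

end CarGeometry

end
-- The main theorem
open CarGeometry in
theorem mainTheorem2 (ℓ : ℝ) (hℓ : 0 < ℓ) :
    -- the car's structure is an Engel structure with a split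
    IsEngelWithSplit steering (gas ℓ) ∧
    -- the space of positions is the leaf space of the steering wheel foliation
    (∃ Φ : LeafSpace ≃ₜ Pos, ∀ m : Config, Φ (Quot.mk _ m) = proj m) ∧
    -- the induced contact projective structure
    IsContactProjective (inducedDistribution (gas ℓ)) (inducedCurves (gas ℓ)) ∧
    -- the identification with the first jet space of the car's equation
    IsFirstJetSpace (inducedDistribution (gas ℓ)) (inducedCurves (gas ℓ)) ∧
    -- the Lie algebra of infinitesimal symmetries, on `P` and on each connected open subset
    Module.finrank ℝ sp4 = 10 ∧
    (∃ ρ : sp4 →ₗ[ℝ] (Pos → E3),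
      (∀ A B, ρ ⁅A, B⁆ = bracket (ρ A) (ρ B)) ∧
      (∀ A, IsInfinitesimalSymmetry (inducedDistribution (gas ℓ)) (inducedCurves (gas ℓ))
        Set.univ (ρ A)) ∧
      ∀ U : Set Pos, IsOpen U → IsConnected U → ∀ S : Pos → E3,
        IsInfinitesimalSymmetry (inducedDistribution (gas ℓ)) (inducedCurves (gas ℓ)) U S →
          ∃! A, ∀ p ∈ U, S p = ρ A p) ∧
    -- the normal Cartan connection, for each co-orientation of the contact distribution
    (∃ lam : Form ℝ, SmoothForm Set.univ lam ∧
      ∀ p, LinearMap.ker (lam p) = inducedDistribution (gas ℓ) p) ∧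
    ∀ lam : Form ℝ, SmoothForm Set.univ lam →
      (∀ p, LinearMap.ker (lam p) = inducedDistribution (gas ℓ) p) →
      ∃ conn : CartanConnection, IsNormalCartanConnection lam (inducedCurves (gas ℓ)) conn ∧
        (∀ conn', IsNormalCartanConnection lam (inducedCurves (gas ℓ)) conn' → conn' = conn) ∧
        conn.IsFlat := by
  refine ⟨isEngelWithSplit_car hℓ, ⟨leafSpaceHomeomorph, fun _ => rfl⟩,
    isContactProjective_induced hℓ, isFirstJetSpace_car hℓ, finrank_sp4,
    ⟨symmetryField, symmetryField_lie, isInfinitesimalSymmetry_symmetryField hℓ,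
      fun U hU hc S hS => existsUnique_symmetryField hℓ hU hc hS⟩,
    ⟨coAcross, smoothForm_coAcross _, fun p => (inducedDistribution_gas hℓ p).symm⟩,
    fun lam hs hker => ?_⟩
  obtain ⟨ε, hε, φ, hφ⟩ := exists_sign hs fun p =>
    (hker p).trans (inducedDistribution_gas hℓ p)
  have hε0 : ε ≠ 0 := left_ne_zero_of_mul_eq_one hε
  exact ⟨flatConnection hε0, fun g hg => induces_of_compatible hℓ hφ hg.1 hg.2,
    fun conn h => eq_flatConnection hε0 fun g hg =>
      compatible_of_isNormal hℓ hε hφ (conn.isGauge g hg) (h g hg).1 (h g hg).2,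
    fun g hg p hp u v => curvature_eq_zero_of_compatible hg.2 hp u v⟩
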